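/- Let $\mathbb{T}=\mathbb{R}/2\pi\mathbb{Z}$ and let $m$ be the normalized Haar measure on $\mathbb{T}$. For a sequence $(n_j)_{j\ge 1}$ of positive integers define the finite Riesz products on $\mathbb{T}$ by $R_0\equiv 1$ and $$R_k(t)=\prod_{j=1}^{k}\bigl(1+\cos(n_j t)\bigr),\qquad k\ge 1.$$ For every real number $p\ge 1$ there are positive constants $d_p, c_p, C_p$ depending only on $p$ such that the following holds. If $(n_j)_{j\ge1}$ is a sequence of positive integers with $n_{j+1}/n_j\ge d_p$ for all $j\ge 1$, then for any vectors $v_0,v_1,\ldots$ in any normed space $(E,\|\cdot\|)$ and any integer $N\ge 0$, $$c_p\sum_{k=0}^N\|v_k\|^p\int_{\mathbb{T}}R_k^p\,dm\;\le\;\int_{\mathbb{T}}\Bigl\|\sum_{k=0}^N v_kR_k\Bigr\|^p dm\;\le\;C_p\sum_{k=0}^N\|v_k\|^p\int_{\mathbb{T}}R_k^p\,dm.$$ -/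

import Mathlib

open MeasureTheory

noncomputable section

/-- The torus `ℝ / 2πℤ`. -/
abbrev Torus : Type := AddCircle (2 * Real.pi)

/-- The finite Riesz product `R_k(t) = ∏_{j=1}^k (1 + cos (n_j t))` on the torus, with `R_0 = 1`.
Only the values `n 1, n 2, …` of the sequence `n` are used. Here `n j • t` is the multiple `n_j t`
in the group `ℝ / 2πℤ`, and `Real.Angle` is Mathlib's name for this quotient as the domain
of the cosine. -/
def rieszProduct (n : ℕ → ℕ) (k : ℕ) (t : Torus) : ℝ :=
  ∏ j ∈ Finset.Icc 1 k, (1 + Real.Angle.cos (n j • t : Torus))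

/-- The length `2π` of the circle is positive (needed for its normalized Haar measure). -/
instance fact_two_pi_pos : Fact (0 < 2 * Real.pi) := ⟨Real.two_pi_pos⟩

/-- The Haar measure on the torus, normalized to total mass one. -/
def torusMeasure : Measure Torus := AddCircle.haarAddCircle

end

/-!
The lower bound is a duality argument. Write `R_k = rieszProduct n k` and `c_j = cos (n_j t)`. For each
index `i = r + 1 ≤ N` the sum `S = ∑ R_k • v_k` is paired with a scalar test function `h_r`
(`testFun`) and a functional that norms `v_i`. The test function is

  `h_r = R_r ^ (p - 1) * (R_r ^ p / D) * (c_{r+2} ^ 2 - c_{r+2}) * c_{r+1}`,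

with `D = R_r ^ p + ε ∑ V_l` and `V_l` a substitute for `R_r ^ p * (R_l / R_r) ^ (1 / 2)`
(`comparison`, `denom`). Its parts have the following purposes.

* By the definition of `V_l`, the product `h_r * R_l` is `V_l ^ 2 / D` times a polynomial in
  `c_{r+1}` and `c_{r+2}`. For `l ≠ r + 1` this polynomial is odd in `c_{r+1}` or in `c_{r+2}`,
  because `(1 + c) * (c ^ 2 - c) = c ^ 3 - c`; for `l = r + 1` it is
  `c_{r+1} ^ 2 * c_{r+2} ^ 2` plus odd terms. A translation by about half a period of one of these
  two frequencies nearly reverses the odd polynomials, and it moves `V_l` and `D` little in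
  `L¹`: the lower frequencies hardly notice it, and it is chosen to be nearly a period of all
  higher ones (`Lacunary.exists_almost_half_period`). So the integrals of `h_r * R_l` with
  `l ≠ r + 1` are `O(1 / d)` times `∫ R_r ^ p` (`exists_abs_integral_odd_le`), while that of
  `h_r * R_{r+1}` is comparable to `∫ R_r ^ p` (`exists_integral_testFun_mul_succ_ge`).

* There are many pairs of indices, so decay in the distance of the indices is needed as well.
  It comes from strict inequalities between the means of powers of `1 + cos`, since the factors of a
  Riesz product are nearly independent for large `d` (`abs_integral_lacProd_succ_sub_le`,
  `exists_integral_lower_power_le`). The quotient `R_r ^ p / D` is small where some `R_l` is much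
  larger than `R_r`, and owing to this the decay holds for all `p ≥ 1`
  (`exists_mul_abs_integral_testFun_mul_le`).

* Pointwise `∑_r R_r ^ p / D ≤ 2 / ε` (`sum_locWeight_le`), so that the main terms, which are bounded
  with Young's inequality, add up to a multiple of `∫ ‖S‖ ^ p`.

Together this bounds the sum over the positive indices, up to a small multiple of the full sum
(`exists_sum_succ_le`). The term of index `0` follows from the upper bound applied to the other terms
(`exists_le_integral_norm_rpow`).

The upper bound is scalar (`exists_integral_rpow_sum_le`): `(∑ a_k R_k) ^ p` is expanded as a
telescoping sum, and the mixed terms `a_k R_k * (a_l R_l) ^ (p - 1)` decay geometrically in `k - l`.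
-/

open Filter

/-! ### The torus -/

instance : IsProbabilityMeasure torusMeasure := by unfold torusMeasure; infer_instance

instance : Measure.IsAddRightInvariant torusMeasure := by unfold torusMeasure; infer_instance

theorem Torus.exists_coe_eq_norm_eq (t : Torus) : ∃ x : ℝ, (x : Torus) = t ∧ ‖t‖ = |x| := by
  induction t using QuotientAddGroup.induction_on with
  | H x =>
    refine ⟨x - round ((2 * Real.pi)⁻¹ * x) * (2 * Real.pi), ?_, AddCircle.norm_eq (2 * Real.pi)⟩
    have h := AddCircle.coe_sub (p := 2 * Real.pi) x
      (round ((2 * Real.pi)⁻¹ * x) * (2 * Real.pi))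
    rw [h]
    have h2 : ((round ((2 * Real.pi)⁻¹ * x) * (2 * Real.pi) : ℝ) : Torus) = 0 := by
      rw [AddCircle.coe_eq_zero_iff]
      exact ⟨round ((2 * Real.pi)⁻¹ * x), by simp⟩
    rw [h2, sub_zero]

theorem Torus.norm_coe_le_abs (x : ℝ) : ‖(x : Torus)‖ ≤ |x| :=
  QuotientAddGroup.norm_mk_le_norm

/-- The cosine on the torus. -/
noncomputable def tcos (t : Torus) : ℝ := Real.Angle.cos t

theorem tcos_coe (x : ℝ) : tcos (x : Torus) = Real.cos x := Real.Angle.cos_coe x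

theorem abs_tcos_le_one (t : Torus) : |tcos t| ≤ 1 := by
  induction t using QuotientAddGroup.induction_on with
  | H x => exact (congrArg abs (tcos_coe x)).le.trans (Real.abs_cos_le_one x)

theorem tcos_add_pi (t : Torus) : tcos (t + ((Real.pi : ℝ) : Torus)) = -tcos t := by
  obtain ⟨x, rfl, -⟩ := Torus.exists_coe_eq_norm_eq t
  rw [← AddCircle.coe_add, tcos_coe, tcos_coe, Real.cos_add_pi]

theorem abs_tcos_sub_le (x y : Torus) : |tcos x - tcos y| ≤ ‖x - y‖ := by
  obtain ⟨a, rfl, -⟩ := Torus.exists_coe_eq_norm_eq y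
  obtain ⟨b, hb, hb'⟩ := Torus.exists_coe_eq_norm_eq (x - (a : Torus))
  have hx : x = ((b + a : ℝ) : Torus) := by rw [AddCircle.coe_add, hb]; abel
  rw [hb', hx, tcos_coe, tcos_coe]
  have h := Real.lipschitzWith_cos.dist_le_mul (b + a) a
  simpa [Real.dist_eq] using h

theorem continuous_of_abs_sub_le {f : Torus → ℝ} {L : ℝ}
    (h : ∀ x y, |f x - f y| ≤ L * ‖x - y‖) : Continuous f := by
  have : LipschitzWith (Real.toNNReal L) f := by
    refine LipschitzWith.of_dist_le_mul fun x y => ?_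
    rw [Real.dist_eq, dist_eq_norm]
    exact (h x y).trans (mul_le_mul_of_nonneg_right (Real.le_coe_toNNReal L) (norm_nonneg _))
  exact this.continuous

theorem continuous_tcos : Continuous tcos :=
  continuous_of_abs_sub_le (L := 1) fun x y => by simpa using abs_tcos_sub_le x y

theorem Continuous.integrable_torus {f : Torus → ℝ} (hf : Continuous f) :
    Integrable f torusMeasure :=
  hf.integrable_of_hasCompactSupport (HasCompactSupport.of_compactSpace f)

theorem integral_torus_add (f : Torus → ℝ) (s : Torus) :
    ∫ t, f (t + s) ∂torusMeasure = ∫ t, f t ∂torusMeasure :=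
  integral_add_right_eq_self f s

theorem integral_torus_mono {f g : Torus → ℝ} (hf : Continuous f) (hg : Continuous g)
    (h : ∀ t, f t ≤ g t) : ∫ t, f t ∂torusMeasure ≤ ∫ t, g t ∂torusMeasure :=
  integral_mono hf.integrable_torus hg.integrable_torus h

theorem integral_tcos : ∫ t, tcos t ∂torusMeasure = 0 := by
  have h := integral_torus_add tcos ((Real.pi : ℝ) : Torus)
  simp only [tcos_add_pi, integral_neg] at h
  linarith

theorem integral_tcos_sq : ∫ t, tcos t ^ 2 ∂torusMeasure = 1 / 2 := by
  have h := integral_torus_add (fun t => tcos t ^ 2) ((Real.pi / 2 : ℝ) : Torus)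
  have h2 : ∀ t : Torus, tcos (t + ((Real.pi / 2 : ℝ) : Torus)) ^ 2 = 1 - tcos t ^ 2 := by
    intro t
    obtain ⟨x, rfl, -⟩ := Torus.exists_coe_eq_norm_eq t
    rw [← AddCircle.coe_add, tcos_coe, tcos_coe, Real.cos_add_pi_div_two]
    linarith [Real.sin_sq_add_cos_sq x]
  simp only [h2] at h
  rw [integral_sub (f := fun _ => (1 : ℝ)) (g := fun t => tcos t ^ 2) (integrable_const _)
    (continuous_tcos.pow 2).integrable_torus] at h
  simp at h
  linarith

theorem Torus.exists_nsmul_eq {n : ℕ} (hn : 0 < n) (θ : Torus) :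
    ∃ s : Torus, n • s = θ ∧ ‖s‖ ≤ 2 * Real.pi / n := by
  obtain ⟨x, rfl, hx⟩ := Torus.exists_coe_eq_norm_eq θ
  have hn' : (0 : ℝ) < n := by exact_mod_cast hn
  refine ⟨((x / n : ℝ) : Torus), ?_, ?_⟩
  · rw [← AddCircle.coe_nsmul]
    congr 1
    simp
    field_simp
  · refine (Torus.norm_coe_le_abs _).trans ?_
    rw [abs_div, abs_of_pos hn', ← hx]
    gcongr
    refine (AddCircle.norm_le_half_period _ Real.two_pi_pos.ne').trans ?_
    rw [abs_of_pos Real.two_pi_pos]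
    linarith [Real.pi_pos]

/-! ### Decorrelation of slow and fast factors -/

/-- If translations of length at most `2π / n` move `f` by at most `B` in `L¹`, then `f` and
`φ (n ·)` are nearly uncorrelated. For each phase `θ` there is a short translation `s` with
`n • s = θ`; translating by it and then averaging over `θ` replaces `φ (n ·)` by its mean. -/
theorem abs_integral_mul_nsmul_sub_le {f φ : Torus → ℝ} (hf : Continuous f) (hφ : Continuous φ)
    {M B : ℝ} (hM : ∀ x, |φ x| ≤ M) {n : ℕ} (hn : 0 < n)
    (hB : ∀ s : Torus, ‖s‖ ≤ 2 * Real.pi / n → ∫ t, |f (t + s) - f t| ∂torusMeasure ≤ B) :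
    |∫ t, f t * φ (n • t) ∂torusMeasure
      - (∫ t, f t ∂torusMeasure) * ∫ t, φ t ∂torusMeasure| ≤ M * B := by
  have hM0 : 0 ≤ M := (abs_nonneg _).trans (hM 0)
  have key : ∀ θ : Torus, |∫ t, f t * φ (n • t) ∂torusMeasure
      - ∫ t, f t * φ (n • t + θ) ∂torusMeasure| ≤ M * B := by
    intro θ
    obtain ⟨s, hs, hs'⟩ := Torus.exists_nsmul_eq hn θ
    rw [← integral_torus_add (fun t => f t * φ (n • t)) s, ← integral_sub
      (Continuous.integrable_torus (by fun_prop)) (Continuous.integrable_torus (by fun_prop))]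
    refine (abs_integral_le_integral_abs).trans ?_
    calc ∫ t, |f (t + s) * φ (n • (t + s)) - f t * φ (n • t + θ)| ∂torusMeasure
        ≤ ∫ t, M * |f (t + s) - f t| ∂torusMeasure := by
          refine integral_torus_mono (by fun_prop) (by fun_prop) fun t => ?_
          rw [nsmul_add, hs, ← sub_mul, abs_mul, mul_comm]
          exact mul_le_mul_of_nonneg_right (hM _) (abs_nonneg _)
      _ = M * ∫ t, |f (t + s) - f t| ∂torusMeasure := integral_const_mul _ _
      _ ≤ M * B := mul_le_mul_of_nonneg_left (hB s hs') hM0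
  have hcont : Continuous (Function.uncurry fun (θ t : Torus) => f t * φ (n • t + θ)) := by
    unfold Function.uncurry; fun_prop
  have hint : Integrable (Function.uncurry fun (θ t : Torus) => f t * φ (n • t + θ))
      (torusMeasure.prod torusMeasure) :=
    hcont.integrable_of_hasCompactSupport (HasCompactSupport.of_compactSpace _)
  have hswap : ∫ θ, ∫ t, f t * φ (n • t + θ) ∂torusMeasure ∂torusMeasure
      = (∫ t, f t ∂torusMeasure) * ∫ t, φ t ∂torusMeasure := by
    rw [integral_integral_swap hint, ← integral_mul_const]
    congr 1
    ext t
    rw [integral_const_mul]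
    congr 1
    have := integral_torus_add φ (n • t)
    simpa only [add_comm] using this
  have hconst : ∫ t, f t * φ (n • t) ∂torusMeasure
      = ∫ _θ : Torus, (∫ t, f t * φ (n • t) ∂torusMeasure) ∂torusMeasure := by simp
  have hint' : Integrable (fun θ => ∫ t, f t * φ (n • t + θ) ∂torusMeasure) torusMeasure :=
    hint.integral_prod_left
  rw [← hswap, hconst, ← integral_sub (integrable_const _) hint']
  refine (abs_integral_le_integral_abs).trans ?_
  calc ∫ θ : Torus, |(∫ t, f t * φ (n • t) ∂torusMeasure)
          - ∫ t, f t * φ (n • t + θ) ∂torusMeasure| ∂torusMeasure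
      ≤ ∫ _θ : Torus, M * B ∂torusMeasure :=
        integral_mono_of_nonneg (Filter.Eventually.of_forall fun _ => abs_nonneg _)
          (integrable_const _) (Filter.Eventually.of_forall key)
    _ = M * B := by simp

/-! ### Products of functions with lacunary frequencies -/

/-- The frequencies `n 1, n 2, …` are positive and grow at least by the factor `d`. -/
def Lacunary (n : ℕ → ℕ) (d : ℝ) : Prop :=
  (∀ j, 1 ≤ j → 0 < n j) ∧ ∀ j, 1 ≤ j → d * n j ≤ n (j + 1)

theorem Lacunary.pow_mul_le {n : ℕ → ℕ} {d : ℝ} (h : Lacunary n d) (hd : 0 ≤ d) {j : ℕ}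
    (hj : 1 ≤ j) (r : ℕ) : d ^ r * n j ≤ n (j + r) := by
  induction r with
  | zero => simp
  | succ r ih =>
    calc d ^ (r + 1) * n j = d * (d ^ r * n j) := by ring
      _ ≤ d * n (j + r) := mul_le_mul_of_nonneg_left ih hd
      _ ≤ n (j + (r + 1)) := h.2 (j + r) (by omega)

theorem Lacunary.pow_mul_le' {n : ℕ → ℕ} {d : ℝ} (h : Lacunary n d) (hd : 0 ≤ d) {j k : ℕ}
    (hj : 1 ≤ j) (hjk : j ≤ k) : d ^ (k - j) * n j ≤ n k := by
  have := h.pow_mul_le hd hj (k - j)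
  rwa [Nat.add_sub_cancel' hjk] at this

/-- A translation that is short on the scale of the frequency `n k` moves the phase of a lower
frequency `n j` only by an amount that is geometrically small in `k - j`. -/
theorem Lacunary.norm_nsmul_le {n : ℕ → ℕ} {d : ℝ} (h : Lacunary n d) (hd : 0 < d) {j k : ℕ}
    (hj : 1 ≤ j) (hjk : j ≤ k) {s : Torus} (hs : ‖s‖ ≤ 2 * Real.pi / n k) :
    ‖n j • s‖ ≤ 2 * Real.pi / d ^ (k - j) := by
  have hk : (0 : ℝ) < n k := by exact_mod_cast h.1 k (hj.trans hjk)
  have hdp : 0 < d ^ (k - j) := pow_pos hd _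
  refine (_root_.norm_nsmul_le).trans ?_
  calc (n j : ℝ) * ‖s‖ ≤ n j * (2 * Real.pi / n k) := by gcongr
    _ = (n j * d ^ (k - j) / n k) * (2 * Real.pi / d ^ (k - j)) := by field_simp
    _ ≤ 1 * (2 * Real.pi / d ^ (k - j)) := by
        gcongr
        rw [div_le_one hk, mul_comm]
        exact h.pow_mul_le' hd.le hj hjk
    _ = _ := one_mul _

/-- The product `∏_{j=1}^k φ_j(n_j t)`. -/
noncomputable def lacProd (n : ℕ → ℕ) (φ : ℕ → Torus → ℝ) (k : ℕ) (t : Torus) : ℝ :=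
  ∏ j ∈ Finset.Icc 1 k, φ j (n j • t)

theorem lacProd_zero (n : ℕ → ℕ) (φ : ℕ → Torus → ℝ) (t : Torus) : lacProd n φ 0 t = 1 := by
  simp [lacProd]

theorem lacProd_succ (n : ℕ → ℕ) (φ : ℕ → Torus → ℝ) (k : ℕ) (t : Torus) :
    lacProd n φ (k + 1) t = lacProd n φ k t * φ (k + 1) (n (k + 1) • t) :=
  Finset.prod_Icc_succ_top (by omega) _

theorem lacProd_congr {n : ℕ → ℕ} {φ ψ : ℕ → Torus → ℝ} {k : ℕ}
    (h : ∀ j, 1 ≤ j → j ≤ k → φ j = ψ j) (t : Torus) : lacProd n φ k t = lacProd n ψ k t :=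
  Finset.prod_congr rfl fun j hj => by
    rw [h j (Finset.mem_Icc.1 hj).1 (Finset.mem_Icc.1 hj).2]

/-- Factors admissible for the decorrelation estimates: nonnegative, bounded by `M`, Lipschitz with
constant `L`, and with mean at least `μ`. -/
structure Admissible (M L μ : ℝ) (φ : Torus → ℝ) : Prop where
  nonneg : ∀ x, 0 ≤ φ x
  le : ∀ x, φ x ≤ M
  lip : ∀ x y, |φ x - φ y| ≤ L * ‖x - y‖
  mean : μ ≤ ∫ x, φ x ∂torusMeasure

theorem Admissible.continuous {M L μ : ℝ} {φ : Torus → ℝ} (h : Admissible M L μ φ) :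
    Continuous φ := continuous_of_abs_sub_le h.lip

theorem Admissible.translate {M L μ : ℝ} {φ : Torus → ℝ} (h : Admissible M L μ φ) (c : Torus) :
    Admissible M L μ (fun x => φ (x + c)) where
  nonneg x := h.nonneg _
  le x := h.le _
  lip x y := by simpa using h.lip (x + c) (y + c)
  mean := by rw [integral_torus_add]; exact h.mean

theorem admissible_one {M L μ : ℝ} (hM : 1 ≤ M) (hL : 0 ≤ L) (hμ : μ ≤ 1) :
    Admissible M L μ (fun _ => 1) where
  nonneg _ := zero_le_one
  le _ := hM
  lip x y := by simpa using mul_nonneg hL (norm_nonneg _)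
  mean := by simpa using hμ

theorem continuous_lacProd {n : ℕ → ℕ} {φ : ℕ → Torus → ℝ} (h : ∀ j, Continuous (φ j)) (k : ℕ) :
    Continuous (lacProd n φ k) :=
  continuous_finsetProd _ fun j _ => (h j).comp (continuous_const_smul _)

theorem lacProd_nonneg {n : ℕ → ℕ} {φ : ℕ → Torus → ℝ} (h : ∀ j x, 0 ≤ φ j x) (k : ℕ)
    (t : Torus) : 0 ≤ lacProd n φ k t := Finset.prod_nonneg fun j _ => h j _

/-- The factors that remain when the `j`-th factor is taken out of a product and the later
factors are translated by `s`. -/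
noncomputable def mixAt (n : ℕ → ℕ) (φ : ℕ → Torus → ℝ) (s : Torus) (j q : ℕ) (x : Torus) : ℝ :=
  if q < j then φ q x else if q = j then 1 else φ q (x + n q • s)

theorem mixAt_of_lt {n : ℕ → ℕ} {φ : ℕ → Torus → ℝ} {s : Torus} {j q : ℕ} (h : q < j) :
    mixAt n φ s j q = φ q := by ext x; simp [mixAt, h]

theorem mixAt_self {n : ℕ → ℕ} {φ : ℕ → Torus → ℝ} {s : Torus} {j : ℕ} :
    mixAt n φ s j j = fun _ => 1 := by ext x; simp [mixAt]

theorem mixAt_of_gt {n : ℕ → ℕ} {φ : ℕ → Torus → ℝ} {s : Torus} {j q : ℕ} (h : j < q) :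
    mixAt n φ s j q = fun x => φ q (x + n q • s) := by
  ext x; simp [mixAt, h.not_gt, h.ne']

theorem Admissible.mixAt {M L μ : ℝ} {n : ℕ → ℕ} {φ : ℕ → Torus → ℝ} (hM : 1 ≤ M) (hL : 0 ≤ L)
    (hμ : μ ≤ 1) (h : ∀ j, Admissible M L μ (φ j)) (s : Torus) (j q : ℕ) :
    Admissible M L μ (mixAt n φ s j q) := by
  rcases lt_trichotomy q j with hq | rfl | hq
  · rw [mixAt_of_lt hq]; exact h q
  · rw [mixAt_self]; exact admissible_one hM hL hμ
  · rw [mixAt_of_gt hq]; exact (h q).translate _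

theorem integral_mixAt_of_ne {n : ℕ → ℕ} {φ : ℕ → Torus → ℝ} {s : Torus} {j q : ℕ} (h : q ≠ j) :
    ∫ x, mixAt n φ s j q x ∂torusMeasure = ∫ x, φ q x ∂torusMeasure := by
  rcases h.lt_or_gt with hq | hq
  · rw [mixAt_of_lt hq]
  · rw [mixAt_of_gt hq]; exact integral_torus_add _ _

/-- Telescoping bound for the effect of a translation on a product. -/
theorem abs_lacProd_add_sub_le {n : ℕ → ℕ} {φ : ℕ → Torus → ℝ} {L : ℕ → ℝ}
    (h0 : ∀ j x, 0 ≤ φ j x) (hL : ∀ j x y, |φ j x - φ j y| ≤ L j * ‖x - y‖) (s : Torus) (k : ℕ)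
    (t : Torus) :
    |lacProd n φ k (t + s) - lacProd n φ k t| ≤
      ∑ j ∈ Finset.Icc 1 k, L j * ‖n j • s‖ * lacProd n (mixAt n φ s j) k t := by
  induction k with
  | zero => simp [lacProd_zero]
  | succ k ih =>
    rw [Finset.sum_Icc_succ_top (by omega), lacProd_succ, lacProd_succ]
    have hlast : lacProd n (mixAt n φ s (k + 1)) (k + 1) t = lacProd n φ k t := by
      rw [lacProd_succ, mixAt_self, mul_one]
      exact lacProd_congr (fun j _ hj => mixAt_of_lt (by omega)) t
    have hstep : ∑ j ∈ Finset.Icc 1 k, L j * ‖n j • s‖ * lacProd n (mixAt n φ s j) (k + 1) t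
        = (∑ j ∈ Finset.Icc 1 k, L j * ‖n j • s‖ * lacProd n (mixAt n φ s j) k t)
          * φ (k + 1) (n (k + 1) • (t + s)) := by
      rw [Finset.sum_mul]
      refine Finset.sum_congr rfl fun j hj => ?_
      rw [lacProd_succ, mixAt_of_gt (Nat.lt_succ_of_le (Finset.mem_Icc.1 hj).2), nsmul_add]
      ring
    rw [hlast, hstep]
    set A := lacProd n φ k (t + s)
    set B := lacProd n φ k t
    have hB : 0 ≤ B := lacProd_nonneg h0 k t
    have hlip := hL (k + 1) (n (k + 1) • (t + s)) (n (k + 1) • t)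
    rw [nsmul_add, add_sub_cancel_left, ← nsmul_add] at hlip
    set a := φ (k + 1) (n (k + 1) • (t + s))
    have ha : 0 ≤ a := h0 _ _
    set b := φ (k + 1) (n (k + 1) • t)
    calc |A * a - B * b| = |(A - B) * a + B * (a - b)| := by ring_nf
      _ ≤ |A - B| * a + B * |a - b| := by
          refine (abs_add_le _ _).trans ?_
          rw [abs_mul, abs_mul, abs_of_nonneg ha, abs_of_nonneg hB]
      _ ≤ _ := by
          rw [mul_comm B]
          gcongr

theorem lacProd_mixAt_le {n : ℕ → ℕ} {φ : ℕ → Torus → ℝ} {M : ℝ} (h0 : ∀ j x, 0 ≤ φ j x)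
    (hM : ∀ j x, φ j x ≤ M) (s : Torus) {j k : ℕ} (hj : 1 ≤ j) (hjk : j ≤ k) (t : Torus) :
    lacProd n (mixAt n φ s j) k t ≤ M ^ (k - j) * lacProd n φ (j - 1) t := by
  induction k, hjk using Nat.le_induction with
  | base =>
    obtain ⟨i, rfl⟩ : ∃ i, j = i + 1 := ⟨j - 1, by omega⟩
    rw [lacProd_succ, mixAt_self]
    simp only [mul_one, Nat.sub_self, pow_zero, one_mul, Nat.add_sub_cancel]
    exact (lacProd_congr (fun q _ hq => mixAt_of_lt (by omega)) t).le
  | succ k hjk ih =>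
    have hM0 : 0 ≤ M := (h0 0 0).trans (hM 0 0)
    rw [lacProd_succ, mixAt_of_gt (by omega), Nat.succ_sub hjk, pow_succ]
    have := lacProd_nonneg h0 (j - 1) t (n := n)
    calc _ ≤ M ^ (k - j) * lacProd n φ (j - 1) t * M :=
          mul_le_mul ih (hM _ _) (h0 _ _) (by positivity)
      _ = _ := by ring

/-- The bound for the `L¹` modulus of continuity of `lacProd n φ k` that results from
`abs_lacProd_add_sub_le` when the factors after the `j`-th one are bounded by `M`. -/
theorem integral_abs_lacProd_add_sub_le {n : ℕ → ℕ} {φ : ℕ → Torus → ℝ} {M L μ : ℝ}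
    (hL : 0 ≤ L) (h : ∀ j, Admissible M L μ (φ j)) (s : Torus) (k : ℕ) :
    ∫ t, |lacProd n φ k (t + s) - lacProd n φ k t| ∂torusMeasure ≤
      ∑ j ∈ Finset.Icc 1 k,
        L * ‖n j • s‖ * (M ^ (k - j) * ∫ t, lacProd n φ (j - 1) t ∂torusMeasure) := by
  have hc : ∀ k, Continuous (lacProd n φ k) := continuous_lacProd fun j => (h j).continuous
  calc _ ≤ ∫ t, ∑ j ∈ Finset.Icc 1 k,
        L * ‖n j • s‖ * (M ^ (k - j) * lacProd n φ (j - 1) t) ∂torusMeasure := by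
        refine integral_torus_mono (by have := hc k; fun_prop) (by fun_prop) fun t => ?_
        refine (abs_lacProd_add_sub_le (fun j => (h j).nonneg) (fun j => (h j).lip) s k t).trans ?_
        refine Finset.sum_le_sum fun j hj => ?_
        rw [Finset.mem_Icc] at hj
        exact mul_le_mul_of_nonneg_left (lacProd_mixAt_le (fun j => (h j).nonneg)
          (fun j => (h j).le) s hj.1 hj.2 t) (by positivity)
    _ = _ := by
        rw [integral_finsetSum _ fun j _ => Continuous.integrable_torus (by fun_prop)]
        simp only [integral_const_mul]

/-- The parameter `d` is large compared with the bounds `M`, `L`, `μ` on the factors. -/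
structure LargeRatio (M L μ d : ℝ) : Prop where
  pos : 0 < d
  ratio : 4 * M ≤ μ * d
  error : M * (8 * Real.pi * L / μ) / d ≤ μ / 2

/-- The modulus of continuity is dominated by its last term: in passing from `j` to `j - 1` the
bound on `‖n j • s‖` gains the factor `1 / d`, while the other quantities lose at most
`2 * M / μ`. -/
theorem sum_modulus_le {n : ℕ → ℕ} {M L μ d : ℝ} (hM : 1 ≤ M) (hL : 0 ≤ L) (hμ0 : 0 < μ)
    (hd : LargeRatio M L μ d) (hn : Lacunary n d) {k : ℕ} {a : ℕ → ℝ}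
    (ha : ∀ j, j < k → a j ≤ 2 / μ * a (j + 1)) (ha0 : ∀ j, 0 ≤ a j) {s : Torus}
    (hs : ‖s‖ ≤ 2 * Real.pi / n (k + 1)) :
    ∑ j ∈ Finset.Icc 1 k, L * ‖n j • s‖ * (M ^ (k - j) * a (j - 1))
      ≤ 8 * Real.pi * L / μ / d * a k := by
  have hd0 := hd.pos
  have hM0 : 0 < M := by linarith
  have hak := ha0 k
  have hback : ∀ r, r ≤ k → a (k - r) ≤ (2 / μ) ^ r * a k := by
    intro r
    induction r with
    | zero => simp
    | succ r ih =>
      intro hr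
      have h1 := ha (k - (r + 1)) (by omega)
      rw [show k - (r + 1) + 1 = k - r by omega] at h1
      calc _ ≤ 2 / μ * a (k - r) := h1
        _ ≤ 2 / μ * ((2 / μ) ^ r * a k) := by
            gcongr; exact ih (by omega)
        _ = _ := by ring
  have hx : 2 * M / (μ * d) ≤ 1 / 2 := by
    rw [div_le_div_iff₀ (by positivity) (by norm_num)]
    linarith [hd.ratio]
  have hterm : ∀ j ∈ Finset.Icc 1 k, L * ‖n j • s‖ * (M ^ (k - j) * a (j - 1))
      ≤ 4 * Real.pi * L / μ / d * a k * (1 / 2) ^ (k - j) := by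
    intro j hj
    rw [Finset.mem_Icc] at hj
    have h1 := hn.norm_nsmul_le hd0 hj.1 (by omega : j ≤ k + 1) hs
    have h2 := hback (k - (j - 1)) (by omega)
    rw [show k - (k - (j - 1)) = j - 1 by omega, show k - (j - 1) = k - j + 1 by omega] at h2
    rw [show k + 1 - j = k - j + 1 by omega] at h1
    calc L * ‖n j • s‖ * (M ^ (k - j) * a (j - 1))
        ≤ L * (2 * Real.pi / d ^ (k - j + 1)) * (M ^ (k - j) * ((2 / μ) ^ (k - j + 1) * a k)) := by
          have := ha0 (j - 1)
          exact mul_le_mul (by gcongr) (by gcongr) (by positivity) (by positivity)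
      _ = 4 * Real.pi * L / μ / d * a k * (2 * M / (μ * d)) ^ (k - j) := by
          simp only [div_pow, mul_pow, pow_succ]
          field_simp
          ring
      _ ≤ _ := by
          have := ha0 k
          gcongr
  refine (Finset.sum_le_sum hterm).trans ?_
  rw [← Finset.mul_sum]
  have hgeom : ∑ j ∈ Finset.Icc 1 k, (1 / 2 : ℝ) ^ (k - j) ≤ 2 := by
    have : ∑ j ∈ Finset.Icc 1 k, (1 / 2 : ℝ) ^ (k - j) = ∑ i ∈ Finset.range k, (1 / 2 : ℝ) ^ i := by
      refine Finset.sum_nbij' (fun j => k - j) (fun i => k - i) ?_ ?_ ?_ ?_ ?_ <;>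
        simp <;> omega
    rw [this]
    have := sum_geometric_two_le k
    simpa using this
  calc _ ≤ 4 * Real.pi * L / μ / d * a k * 2 := by
        have := ha0 k
        gcongr
    _ = _ := by ring

/-- Consecutive factors of a lacunary product are nearly uncorrelated. -/
theorem abs_integral_lacProd_succ_sub_le {n : ℕ → ℕ} {φ : ℕ → Torus → ℝ} {M L μ d : ℝ}
    (hM : 1 ≤ M) (hL : 0 ≤ L) (hμ0 : 0 < μ) (hd : LargeRatio M L μ d) (hn : Lacunary n d)
    (h : ∀ j, Admissible M L μ (φ j)) (k : ℕ) :
    |∫ t, lacProd n φ (k + 1) t ∂torusMeasure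
      - (∫ t, lacProd n φ k t ∂torusMeasure) * ∫ x, φ (k + 1) x ∂torusMeasure|
      ≤ M * (8 * Real.pi * L / μ) / d * ∫ t, lacProd n φ k t ∂torusMeasure := by
  have hc : ∀ k, Continuous (lacProd n φ k) := continuous_lacProd fun j => (h j).continuous
  have ha0 : ∀ k, 0 ≤ ∫ t, lacProd n φ k t ∂torusMeasure := fun k =>
    integral_nonneg fun t => lacProd_nonneg (fun j => (h j).nonneg) k t
  induction k using Nat.strong_induction_on with
  | _ k ih =>
    have ha : ∀ j, j < k → ∫ t, lacProd n φ j t ∂torusMeasure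
        ≤ 2 / μ * ∫ t, lacProd n φ (j + 1) t ∂torusMeasure := by
      intro j hj
      have h1 := (abs_le.1 (ih j hj)).1
      have h2 := mul_le_mul_of_nonneg_left (h (j + 1)).mean (ha0 j)
      have h3 := mul_le_mul_of_nonneg_right hd.error (ha0 j)
      rw [div_mul_eq_mul_div, le_div_iff₀ hμ0]
      linarith
    have hstep := abs_integral_mul_nsmul_sub_le (hc k) (h (k + 1)).continuous (M := M)
      (fun x => by rw [abs_of_nonneg ((h _).nonneg x)]; exact (h _).le x) (hn.1 (k + 1) (by omega))
      (fun s hs => (integral_abs_lacProd_add_sub_le hL h s k).trans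
        (sum_modulus_le hM hL hμ0 hd hn ha ha0 hs))
    simp only [lacProd_succ]
    refine hstep.trans (le_of_eq ?_)
    ring

theorem integral_lacProd_le_succ {n : ℕ → ℕ} {φ : ℕ → Torus → ℝ} {M L μ d : ℝ}
    (hM : 1 ≤ M) (hL : 0 ≤ L) (hμ0 : 0 < μ) (hd : LargeRatio M L μ d) (hn : Lacunary n d)
    (h : ∀ j, Admissible M L μ (φ j)) (k : ℕ) :
    ∫ t, lacProd n φ k t ∂torusMeasure
      ≤ 2 / μ * ∫ t, lacProd n φ (k + 1) t ∂torusMeasure := by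
  have ha0 : 0 ≤ ∫ t, lacProd n φ k t ∂torusMeasure :=
    integral_nonneg fun t => lacProd_nonneg (fun j => (h j).nonneg) k t
  have h1 := (abs_le.1 (abs_integral_lacProd_succ_sub_le hM hL hμ0 hd hn h k)).1
  have h2 := mul_le_mul_of_nonneg_left (h (k + 1)).mean ha0
  have h3 := mul_le_mul_of_nonneg_right hd.error ha0
  rw [div_mul_eq_mul_div, le_div_iff₀ hμ0]
  linarith

theorem sum_modulus_lacProd_le {n : ℕ → ℕ} {φ : ℕ → Torus → ℝ} {M L μ d : ℝ}
    (hM : 1 ≤ M) (hL : 0 ≤ L) (hμ0 : 0 < μ) (hd : LargeRatio M L μ d) (hn : Lacunary n d)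
    (h : ∀ j, Admissible M L μ (φ j)) (k : ℕ) {s : Torus} (hs : ‖s‖ ≤ 2 * Real.pi / n (k + 1)) :
    ∑ j ∈ Finset.Icc 1 k, L * ‖n j • s‖ *
        (M ^ (k - j) * ∫ t, lacProd n φ (j - 1) t ∂torusMeasure)
      ≤ 8 * Real.pi * L / μ / d * ∫ t, lacProd n φ k t ∂torusMeasure :=
  sum_modulus_le (a := fun k => ∫ t, lacProd n φ k t ∂torusMeasure) hM hL hμ0 hd hn
    (fun j _ => integral_lacProd_le_succ hM hL hμ0 hd hn h j)
    (fun k => integral_nonneg fun t => lacProd_nonneg (fun j => (h j).nonneg) k t) hs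

/-- Upper bound for the integral of a lacunary product whose last factors have small means. -/
theorem integral_lacProd_le_pow {n : ℕ → ℕ} {φ : ℕ → Torus → ℝ} {M L μ d δ m : ℝ}
    (hM : 1 ≤ M) (hL : 0 ≤ L) (hμ0 : 0 < μ) (hd : LargeRatio M L μ d) (hn : Lacunary n d)
    (h : ∀ j, Admissible M L μ (φ j)) (hδ : M * (8 * Real.pi * L / μ) / d ≤ δ) {l k : ℕ}
    (hlk : l ≤ k) (hm : ∀ j, l < j → j ≤ k → ∫ x, φ j x ∂torusMeasure ≤ m) :
    ∫ t, lacProd n φ k t ∂torusMeasure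
      ≤ (m + δ) ^ (k - l) * ∫ t, lacProd n φ l t ∂torusMeasure := by
  induction k, hlk using Nat.le_induction with
  | base => simp
  | succ k hlk ih =>
    have ha0 : 0 ≤ ∫ t, lacProd n φ k t ∂torusMeasure :=
      integral_nonneg fun t => lacProd_nonneg (fun j => (h j).nonneg) k t
    have h1 := (abs_le.1 (abs_integral_lacProd_succ_sub_le hM hL hμ0 hd hn h k)).2
    have h2 := mul_le_mul_of_nonneg_left (hm (k + 1) (by omega) le_rfl) ha0
    have h3 := mul_le_mul_of_nonneg_right hδ ha0
    have hm0 : 0 ≤ m := hμ0.le.trans ((h (k + 1)).mean.trans (hm (k + 1) (by omega) le_rfl))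
    have hδ0 : 0 ≤ δ := by
      refine le_trans ?_ hδ
      have := hd.pos
      positivity
    have h4 := mul_le_mul_of_nonneg_left (ih fun j hj hj' => hm j hj (by omega))
      (add_nonneg hm0 hδ0)
    rw [Nat.succ_sub hlk, pow_succ]
    linarith

/-- Lower bound for the integral of a lacunary product whose last factors have large means. -/
theorem pow_le_integral_lacProd {n : ℕ → ℕ} {φ : ℕ → Torus → ℝ} {M L μ d δ m : ℝ}
    (hM : 1 ≤ M) (hL : 0 ≤ L) (hμ0 : 0 < μ) (hd : LargeRatio M L μ d) (hn : Lacunary n d)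
    (h : ∀ j, Admissible M L μ (φ j)) (hδ : M * (8 * Real.pi * L / μ) / d ≤ δ) (hδm : δ ≤ m)
    {l k : ℕ} (hlk : l ≤ k) (hm : ∀ j, l < j → j ≤ k → m ≤ ∫ x, φ j x ∂torusMeasure) :
    (m - δ) ^ (k - l) * ∫ t, lacProd n φ l t ∂torusMeasure
      ≤ ∫ t, lacProd n φ k t ∂torusMeasure := by
  induction k, hlk using Nat.le_induction with
  | base => simp
  | succ k hlk ih =>
    have ha0 : 0 ≤ ∫ t, lacProd n φ k t ∂torusMeasure :=
      integral_nonneg fun t => lacProd_nonneg (fun j => (h j).nonneg) k t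
    have h1 := (abs_le.1 (abs_integral_lacProd_succ_sub_le hM hL hμ0 hd hn h k)).1
    have h2 := mul_le_mul_of_nonneg_left (hm (k + 1) (by omega) le_rfl) ha0
    have h3 := mul_le_mul_of_nonneg_right hδ ha0
    have h4 := mul_le_mul_of_nonneg_left (ih fun j hj hj' => hm j hj (by omega))
      (sub_nonneg.2 hδm)
    rw [Nat.succ_sub hlk, pow_succ]
    linarith

/-! ### Almost half-period translations -/

/-- A real number can be moved slightly so as to become an approximate common period of
finitely many lacunary frequencies beyond the `a`-th one. -/
theorem Lacunary.exists_almost_period {n : ℕ → ℕ} {d : ℝ} (hn : Lacunary n d) (hd : 2 ≤ d)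
    (r : ℕ) (a : ℕ) (x : ℝ) :
    ∃ s : ℝ, |s - x| ≤ 2 * Real.pi / n (a + 1) ∧
      ∀ j, a < j → j ≤ a + r → ‖n j • (s : Torus)‖ ≤ 2 * Real.pi / d := by
  have hd0 : 0 < d := by linarith
  induction r generalizing a x with
  | zero => exact ⟨x, by simp; positivity, fun j h1 h2 => by omega⟩
  | succ r ih =>
    have hN : (0 : ℝ) < n (a + 1) := by exact_mod_cast hn.1 (a + 1) (by omega)
    have hN' : (0 : ℝ) < n (a + 1 + 1) := by exact_mod_cast hn.1 (a + 1 + 1) (by omega)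
    set z : ℤ := round (n (a + 1) * x / (2 * Real.pi)) with hz
    set y : ℝ := z * (2 * Real.pi) / n (a + 1) with hy
    have hyx : |y - x| ≤ Real.pi / n (a + 1) := by
      have h1 := abs_sub_round (n (a + 1) * x / (2 * Real.pi))
      rw [← hz] at h1
      have h2 : y - x = -((n (a + 1) * x / (2 * Real.pi) - z) * (2 * Real.pi / n (a + 1))) := by
        rw [hy]; field_simp; ring
      rw [h2, abs_neg, abs_mul, abs_of_pos (by positivity : 0 < 2 * Real.pi / (n (a + 1) : ℝ))]
      calc _ ≤ 1 / 2 * (2 * Real.pi / n (a + 1)) := by gcongr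
        _ = _ := by ring
    obtain ⟨s, hs1, hs2⟩ := ih (a + 1) y
    have hratio : 2 * Real.pi / n (a + 1 + 1) ≤ 2 * Real.pi / d / n (a + 1) := by
      rw [div_div]
      have := hn.2 (a + 1) (by omega)
      gcongr
    refine ⟨s, ?_, fun j hj1 hj2 => ?_⟩
    · have h3 : 2 * Real.pi / d / n (a + 1) ≤ Real.pi / n (a + 1) := by
        gcongr
        rw [div_le_iff₀ hd0]
        nlinarith [Real.pi_pos]
      calc |s - x| = |(s - y) + (y - x)| := by ring_nf
        _ ≤ |s - y| + |y - x| := abs_add_le _ _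
        _ ≤ Real.pi / n (a + 1) + Real.pi / n (a + 1) := by linarith
        _ = _ := by ring
    · rcases eq_or_lt_of_le (Nat.succ_le_of_lt hj1) with rfl | hj3
      · have h4 : n (a + 1) • (s : Torus) = ((n (a + 1) * (s - y) : ℝ) : Torus) := by
          have h5 : (n (a + 1) * s : ℝ) = n (a + 1) * (s - y) + z * (2 * Real.pi) := by
            rw [hy]; field_simp; ring
          have h6 : ((z * (2 * Real.pi) : ℝ) : Torus) = 0 := by
            rw [AddCircle.coe_eq_zero_iff]; exact ⟨z, by simp⟩
          rw [← AddCircle.coe_nsmul, nsmul_eq_mul, h5, AddCircle.coe_add, h6, add_zero]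
        simp only [Nat.succ_eq_add_one]
        rw [h4]
        refine (Torus.norm_coe_le_abs _).trans ?_
        rw [abs_mul, abs_of_pos hN]
        calc n (a + 1) * |s - y| ≤ n (a + 1) * (2 * Real.pi / d / n (a + 1)) := by
              gcongr; exact hs1.trans hratio
          _ = _ := by field_simp
      · exact hs2 j (by omega) (by omega)

/-- There is a short translation that moves the phase of the frequency `n a` almost by half a period
and the phases of the other frequencies up to `n K` almost not at all. -/
theorem Lacunary.exists_almost_half_period {n : ℕ → ℕ} {d : ℝ} (hn : Lacunary n d) (hd : 2 ≤ d)
    {a : ℕ} (ha : 1 ≤ a) (K : ℕ) :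
    ∃ s : Torus, ‖s‖ ≤ 2 * Real.pi / n a ∧
      ‖n a • s - ((Real.pi : ℝ) : Torus)‖ ≤ 2 * Real.pi / d ∧
      ∀ j, 1 ≤ j → j ≤ K → j ≠ a → ‖n j • s‖ ≤ 2 * Real.pi / d := by
  have hd0 : 0 < d := by linarith
  have hN : (0 : ℝ) < n a := by exact_mod_cast hn.1 a ha
  have hN' : (0 : ℝ) < n (a + 1) := by exact_mod_cast hn.1 (a + 1) (by omega)
  obtain ⟨s, hs1, hs2⟩ := hn.exists_almost_period hd K a (Real.pi / n a)
  have hratio : 2 * Real.pi / n (a + 1) ≤ 2 * Real.pi / d / n a := by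
    rw [div_div]
    have := hn.2 a ha
    gcongr
  have hnorm : ‖(s : Torus)‖ ≤ 2 * Real.pi / n a := by
    have h3 : 2 * Real.pi / d / n a ≤ Real.pi / n a := by
      gcongr
      rw [div_le_iff₀ hd0]
      nlinarith [Real.pi_pos]
    calc ‖(s : Torus)‖ ≤ |s| := Torus.norm_coe_le_abs s
      _ = |(s - Real.pi / n a) + Real.pi / n a| := by ring_nf
      _ ≤ |s - Real.pi / n a| + |Real.pi / n a| := abs_add_le _ _
      _ ≤ Real.pi / n a + Real.pi / n a := by
          rw [abs_of_pos (by positivity : 0 < Real.pi / (n a : ℝ))]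
          linarith
      _ = _ := by ring
  refine ⟨s, hnorm, ?_, fun j hj1 hj2 hj3 => ?_⟩
  · have h4 : n a • (s : Torus) - ((Real.pi : ℝ) : Torus)
        = ((n a * (s - Real.pi / n a) : ℝ) : Torus) := by
      rw [← AddCircle.coe_nsmul, ← AddCircle.coe_sub]
      congr 1
      rw [nsmul_eq_mul]
      field_simp
    rw [h4]
    refine (Torus.norm_coe_le_abs _).trans ?_
    rw [abs_mul, abs_of_pos hN]
    calc n a * |s - Real.pi / n a| ≤ n a * (2 * Real.pi / d / n a) := by
          gcongr; exact hs1.trans hratio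
      _ = _ := by field_simp
  · rcases hj3.lt_or_gt with hlt | hgt
    · refine (hn.norm_nsmul_le hd0 hj1 hlt.le hnorm).trans ?_
      gcongr
      exact le_self_pow₀ (by linarith) (by omega)
    · exact hs2 j hgt (by omega)

/-! ### Powers of `1 + cos` -/

/-- The function `1 + cos` on the torus, the single factor of a Riesz product. -/
noncomputable def onePlusCos (t : Torus) : ℝ := 1 + tcos t

theorem onePlusCos_nonneg (t : Torus) : 0 ≤ onePlusCos t := by
  unfold onePlusCos; linarith [(abs_le.1 (abs_tcos_le_one t)).1]

theorem onePlusCos_le_two (t : Torus) : onePlusCos t ≤ 2 := by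
  unfold onePlusCos; linarith [(abs_le.1 (abs_tcos_le_one t)).2]

theorem continuous_onePlusCos : Continuous onePlusCos := continuous_const.add continuous_tcos

theorem continuous_onePlusCos_rpow {e : ℝ} (he : 0 ≤ e) :
    Continuous fun t => onePlusCos t ^ e :=
  continuous_onePlusCos.rpow_const fun _ => Or.inr he

theorem sqrt_one_add_cos (a : ℝ) : √(1 + Real.cos a) = √2 * |Real.cos (a / 2)| := by
  rw [← Real.sqrt_sq_eq_abs, ← Real.sqrt_mul (by norm_num), Real.cos_sq]
  congr 1
  ring_nf

theorem abs_sqrt_onePlusCos_sub_le (x y : Torus) :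
    |√(onePlusCos x) - √(onePlusCos y)| ≤ ‖x - y‖ := by
  obtain ⟨a, rfl, -⟩ := Torus.exists_coe_eq_norm_eq y
  obtain ⟨b, hb, hb'⟩ := Torus.exists_coe_eq_norm_eq (x - (a : Torus))
  have hx : x = ((b + a : ℝ) : Torus) := by rw [AddCircle.coe_add, hb]; abel
  rw [hb', hx, onePlusCos, onePlusCos, tcos_coe, tcos_coe, sqrt_one_add_cos, sqrt_one_add_cos,
    ← mul_sub, abs_mul, abs_of_nonneg (Real.sqrt_nonneg 2)]
  have h1 : |(|Real.cos ((b + a) / 2)| - |Real.cos (a / 2)|)| ≤ |b| / 2 := by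
    refine (abs_abs_sub_abs_le_abs_sub _ _).trans ?_
    have h := Real.lipschitzWith_cos.dist_le_mul ((b + a) / 2) (a / 2)
    rw [Real.dist_eq, Real.dist_eq, NNReal.coe_one, one_mul] at h
    refine h.trans (le_of_eq ?_)
    rw [← abs_two, ← abs_div, abs_two]
    ring_nf
  have h2 : √2 ≤ 2 := Real.sqrt_le_iff.2 (by norm_num)
  calc √2 * _ ≤ 2 * (|b| / 2) := mul_le_mul h2 h1 (abs_nonneg _) (by norm_num)
    _ = |b| := by ring

theorem rpow_sub_rpow_le {x y r : ℝ} (hy : 0 ≤ y) (hyx : y ≤ x) (hr : 1 ≤ r) :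
    x ^ r - y ^ r ≤ r * x ^ (r - 1) * (x - y) := by
  rcases eq_or_lt_of_le (hy.trans hyx) with h0 | hx
  · subst h0
    have : y = 0 := le_antisymm hyx hy
    subst this
    simp
  · have h1 := one_add_mul_self_le_rpow_one_add (s := y / x - 1)
      (by linarith [div_nonneg hy hx.le]) hr
    rw [add_sub_cancel, Real.div_rpow hy hx.le, le_div_iff₀ (Real.rpow_pos_of_pos hx r)] at h1
    have h2 : x ^ r = x ^ (r - 1) * x := by
      rw [← Real.rpow_add_one hx.ne', sub_add_cancel]
    have h3 : (1 + r * (y / x - 1)) * x ^ r = x ^ r + r * x ^ (r - 1) * (y - x) := by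
      rw [h2]; field_simp
    linarith

theorem abs_rpow_sub_rpow_le {x y r B : ℝ} (hx : 0 ≤ x) (hy : 0 ≤ y) (hxB : x ≤ B) (hyB : y ≤ B)
    (hr : 1 ≤ r) : |x ^ r - y ^ r| ≤ r * B ^ (r - 1) * |x - y| := by
  wlog hyx : y ≤ x generalizing x y
  · rw [abs_sub_comm, abs_sub_comm x]
    exact this hy hx hyB hxB (le_of_not_ge hyx)
  rw [abs_of_nonneg (sub_nonneg.2 hyx),
    abs_of_nonneg (sub_nonneg.2 (Real.rpow_le_rpow hy hyx (by linarith)))]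
  refine (rpow_sub_rpow_le hy hyx hr).trans ?_
  have := sub_nonneg.2 hyx
  have := Real.rpow_le_rpow hx hxB (by linarith : 0 ≤ r - 1)
  gcongr

theorem abs_onePlusCos_rpow_sub_le {p e : ℝ} (he : 1 / 2 ≤ e) (hep : e ≤ p) (x y : Torus) :
    |onePlusCos x ^ e - onePlusCos y ^ e| ≤ 2 * p * 2 ^ p * ‖x - y‖ := by
  have hs : ∀ t, onePlusCos t ^ e = √(onePlusCos t) ^ (2 * e) := fun t => by
    rw [Real.sqrt_eq_rpow, ← Real.rpow_mul (onePlusCos_nonneg t)]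
    congr 1; ring
  have hb : ∀ t, √(onePlusCos t) ≤ √2 := fun t => Real.sqrt_le_sqrt (onePlusCos_le_two t)
  rw [hs, hs]
  refine (abs_rpow_sub_rpow_le (Real.sqrt_nonneg _) (Real.sqrt_nonneg _) (hb x) (hb y)
    (by linarith)).trans ?_
  have h1 : √2 ^ (2 * e - 1) ≤ 2 ^ p := by
    rw [Real.sqrt_eq_rpow, ← Real.rpow_mul (by norm_num)]
    exact Real.rpow_le_rpow_of_exponent_le (by norm_num) (by linarith)
  have h2 := abs_sqrt_onePlusCos_sub_le x y
  have h3 : (0 : ℝ) ≤ √2 ^ (2 * e - 1) := by positivity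
  have hp0 : 0 < p := by linarith
  gcongr

theorem integral_onePlusCos : ∫ t, onePlusCos t ∂torusMeasure = 1 := by
  unfold onePlusCos
  rw [integral_add (integrable_const _) continuous_tcos.integrable_torus, integral_tcos]
  simp

theorem one_le_integral_onePlusCos_rpow {e : ℝ} (he : 1 ≤ e) :
    1 ≤ ∫ t, onePlusCos t ^ e ∂torusMeasure := by
  have h1 : ∫ t, (1 + e * tcos t) ∂torusMeasure = 1 := by
    rw [integral_add (integrable_const _) (continuous_tcos.const_mul e).integrable_torus,
      integral_const_mul, integral_tcos]
    simp
  rw [← h1]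
  refine integral_torus_mono (continuous_const.add (continuous_tcos.const_mul e))
    (continuous_onePlusCos_rpow (by linarith)) fun t => ?_
  exact one_add_mul_self_le_rpow_one_add (abs_le.1 (abs_tcos_le_one t)).1 he

theorem half_le_integral_onePlusCos_rpow {e : ℝ} (he : 1 / 2 ≤ e) :
    1 / 2 ≤ ∫ t, onePlusCos t ^ e ∂torusMeasure := by
  rcases le_total 1 e with h | h
  · linarith [one_le_integral_onePlusCos_rpow h]
  · have h1 : ∫ t, onePlusCos t / 2 ∂torusMeasure = 1 / 2 := by
      rw [integral_div, integral_onePlusCos]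
    rw [← h1]
    refine integral_torus_mono (continuous_onePlusCos.div_const _)
      (continuous_onePlusCos_rpow (by linarith)) fun t => ?_
    have h0 := onePlusCos_nonneg t
    have h2 : onePlusCos t = onePlusCos t ^ e * onePlusCos t ^ (1 - e) := by
      rw [← Real.rpow_add_of_nonneg h0 (by linarith) (by linarith)]; simp
    have h3 : onePlusCos t ^ (1 - e) ≤ 2 := by
      calc _ ≤ (2 : ℝ) ^ (1 - e) := Real.rpow_le_rpow h0 (onePlusCos_le_two t) (by linarith)
        _ ≤ 2 ^ (1 : ℝ) := Real.rpow_le_rpow_of_exponent_le (by norm_num) (by linarith)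
        _ = 2 := Real.rpow_one 2
    have h4 := mul_le_mul_of_nonneg_left h3 (Real.rpow_nonneg h0 e)
    linarith

/-- Admissibility with the constants that serve for all powers of `1 + cos` up to the `p`-th. -/
abbrev PowAdmissible (p : ℝ) (φ : Torus → ℝ) : Prop :=
  Admissible (2 ^ p) (2 * p * 2 ^ p) (1 / 2) φ

theorem powAdmissible_rpow {p e : ℝ} (he : 1 / 2 ≤ e) (hep : e ≤ p) :
    PowAdmissible p fun t => onePlusCos t ^ e where
  nonneg t := Real.rpow_nonneg (onePlusCos_nonneg t) e
  le t := (Real.rpow_le_rpow (onePlusCos_nonneg t) (onePlusCos_le_two t) (by linarith)).trans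
    (Real.rpow_le_rpow_of_exponent_le (by norm_num) hep)
  lip := abs_onePlusCos_rpow_sub_le he hep
  mean := half_le_integral_onePlusCos_rpow he

theorem one_le_two_rpow {p : ℝ} (hp : 1 ≤ p) : (1 : ℝ) ≤ 2 ^ p :=
  Real.one_le_rpow (by norm_num) (by linarith)

theorem powAdmissible_one {p : ℝ} (hp : 1 ≤ p) : PowAdmissible p fun _ => 1 :=
  admissible_one (one_le_two_rpow hp) (by positivity) (by norm_num)

theorem powAdmissible_tcos_sq {p : ℝ} (hp : 1 ≤ p) : PowAdmissible p fun t => tcos t ^ 2 where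
  nonneg t := sq_nonneg _
  le t := ((sq_le_one_iff_abs_le_one _).2 (abs_tcos_le_one t)).trans (one_le_two_rpow hp)
  lip x y := by
    have h1 : |tcos x + tcos y| ≤ 2 := (abs_add_le _ _).trans
      (by linarith [abs_tcos_le_one x, abs_tcos_le_one y])
    have h2 := abs_tcos_sub_le x y
    have h3 := one_le_two_rpow hp
    have h4 : (2 : ℝ) ≤ 2 * p * 2 ^ p := by nlinarith
    rw [sq_sub_sq, abs_mul]
    exact mul_le_mul (h1.trans h4) h2 (abs_nonneg _) (by linarith)
  mean := integral_tcos_sq.ge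

theorem integral_sqrt_onePlusCos_le :
    ∫ t, onePlusCos t ^ (1 / 2 : ℝ) ∂torusMeasure ≤ 31 / 32 := by
  have h1 : ∫ t, (1 + (1 / 2 * tcos t - 1 / 16 * tcos t ^ 2)) ∂torusMeasure = 31 / 32 := by
    rw [integral_add (integrable_const _) (Continuous.integrable_torus (by
        have := continuous_tcos; fun_prop)),
      integral_sub (continuous_tcos.const_mul _).integrable_torus
        (Continuous.integrable_torus (by have := continuous_tcos; fun_prop)),
      integral_const_mul, integral_const_mul, integral_tcos, integral_tcos_sq]
    simp
    norm_num
  rw [← h1]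
  refine integral_torus_mono (continuous_onePlusCos_rpow (by norm_num))
    (by have := continuous_tcos; fun_prop) fun t => ?_
  rw [← Real.sqrt_eq_rpow, onePlusCos]
  obtain ⟨h2, h3⟩ := abs_le.1 (abs_tcos_le_one t)
  refine Real.sqrt_le_iff.2 ⟨by nlinarith, ?_⟩
  nlinarith [sq_nonneg (tcos t ^ 2), mul_nonneg (sq_nonneg (tcos t)) (by linarith :
    0 ≤ 1 - tcos t)]

/-- The moments of `1 + cos` increase strictly; for small exponents this uses that the mean is `1`
while the mean of the square root is less than `1`. -/
theorem integral_onePlusCos_rpow_lt {p q : ℝ} (hp : 1 ≤ p) (hq : 1 / 2 ≤ q) (hqp : q < p) :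
    ∫ t, onePlusCos t ^ q ∂torusMeasure < ∫ t, onePlusCos t ^ p ∂torusMeasure := by
  set a := (p - q) / (p - 1 / 2) with ha
  have hpos : 0 < p - 1 / 2 := by linarith
  have ha0 : 0 < a := div_pos (by linarith) hpos
  have ha1 : a ≤ 1 := (div_le_one hpos).2 (by linarith)
  have hexp : q = 1 / 2 * a + p * (1 - a) := by
    have h := div_mul_cancel₀ (p - q) hpos.ne'
    rw [← ha] at h
    linarith
  have h1 : ∫ t, onePlusCos t ^ q ∂torusMeasure ≤
      ∫ t, (a * onePlusCos t ^ (1 / 2 : ℝ) + (1 - a) * onePlusCos t ^ p) ∂torusMeasure := by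
    have := continuous_onePlusCos_rpow (e := 1 / 2) (by norm_num)
    have := continuous_onePlusCos_rpow (e := p) (by linarith)
    refine integral_torus_mono (continuous_onePlusCos_rpow (by linarith)) (by fun_prop) fun t => ?_
    have h0 := onePlusCos_nonneg t
    have h2 := Real.geom_mean_le_arith_mean2_weighted ha0.le (by linarith : 0 ≤ 1 - a)
      (Real.rpow_nonneg h0 (1 / 2)) (Real.rpow_nonneg h0 p) (by ring)
    rw [← Real.rpow_mul h0, ← Real.rpow_mul h0, ← Real.rpow_add_of_nonneg h0 (by positivity)
      (mul_nonneg (by linarith) (by linarith)), ← hexp] at h2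
    exact h2
  rw [integral_add (((continuous_onePlusCos_rpow (by norm_num)).const_mul a).integrable_torus)
    (((continuous_onePlusCos_rpow (by linarith)).const_mul _).integrable_torus),
    integral_const_mul, integral_const_mul] at h1
  have h2 := integral_sqrt_onePlusCos_le
  have h3 := one_le_integral_onePlusCos_rpow hp
  nlinarith

/-! ### Moments of Riesz products -/

theorem rieszProduct_eq_prod (n : ℕ → ℕ) (k : ℕ) (t : Torus) :
    rieszProduct n k t = ∏ j ∈ Finset.Icc 1 k, onePlusCos (n j • t) := rfl

/-- The product `∏_{l < j ≤ k} (1 + cos (n_j t))` of the last factors of a Riesz product. -/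
noncomputable def rieszTail (n : ℕ → ℕ) (l k : ℕ) (t : Torus) : ℝ :=
  ∏ j ∈ Finset.Ioc l k, onePlusCos (n j • t)

theorem rieszProduct_nonneg (n : ℕ → ℕ) (k : ℕ) (t : Torus) : 0 ≤ rieszProduct n k t :=
  Finset.prod_nonneg fun _ _ => onePlusCos_nonneg _

theorem rieszTail_nonneg (n : ℕ → ℕ) (l k : ℕ) (t : Torus) : 0 ≤ rieszTail n l k t :=
  Finset.prod_nonneg fun _ _ => onePlusCos_nonneg _

theorem rieszProduct_zero (n : ℕ → ℕ) (t : Torus) : rieszProduct n 0 t = 1 := by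
  simp [rieszProduct]

theorem rieszTail_of_le (n : ℕ → ℕ) {l k : ℕ} (h : k ≤ l) (t : Torus) :
    rieszTail n l k t = 1 := by
  simp [rieszTail, Finset.Ioc_eq_empty_of_le h]

theorem rieszProduct_succ (n : ℕ → ℕ) (k : ℕ) (t : Torus) :
    rieszProduct n (k + 1) t = rieszProduct n k t * onePlusCos (n (k + 1) • t) :=
  Finset.prod_Icc_succ_top (by omega) _

theorem rieszTail_succ (n : ℕ → ℕ) {l k : ℕ} (h : l ≤ k) (t : Torus) :
    rieszTail n l (k + 1) t = rieszTail n l k t * onePlusCos (n (k + 1) • t) :=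
  Finset.prod_Ioc_succ_top h _

theorem rieszProduct_mul_rieszTail (n : ℕ → ℕ) {l k : ℕ} (h : l ≤ k) (t : Torus) :
    rieszProduct n l t * rieszTail n l k t = rieszProduct n k t := by
  induction k, h using Nat.le_induction with
  | base => rw [rieszTail_of_le n le_rfl, mul_one]
  | succ k h ih => rw [rieszTail_succ n h, rieszProduct_succ, ← mul_assoc, ih]

theorem continuous_rieszProduct (n : ℕ → ℕ) (k : ℕ) : Continuous (rieszProduct n k) :=
  continuous_finsetProd _ fun _ _ => continuous_onePlusCos.comp (continuous_const_smul _)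

theorem continuous_rieszTail (n : ℕ → ℕ) (l k : ℕ) : Continuous (rieszTail n l k) :=
  continuous_finsetProd _ fun _ _ => continuous_onePlusCos.comp (continuous_const_smul _)

theorem continuous_rieszProduct_rpow (n : ℕ → ℕ) (k : ℕ) {p : ℝ} (hp : 0 ≤ p) :
    Continuous fun t => rieszProduct n k t ^ p :=
  (continuous_rieszProduct n k).rpow_const fun _ => Or.inr hp

theorem continuous_rieszProduct_mul_rieszTail (n : ℕ → ℕ) (r l k : ℕ) {p q : ℝ} (hp : 0 ≤ p)
    (hq : 0 ≤ q) : Continuous fun t => rieszProduct n r t ^ p * rieszTail n l k t ^ q :=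
  (continuous_rieszProduct_rpow n r hp).mul
    ((continuous_rieszTail n l k).rpow_const fun _ => Or.inr hq)

/-- The factors of `R_l ^ p * (R_k / R_l) ^ q` as a lacunary product. -/
noncomputable def twoPowers (p q : ℝ) (l j : ℕ) (x : Torus) : ℝ :=
  if j ≤ l then onePlusCos x ^ p else onePlusCos x ^ q

theorem powAdmissible_twoPowers {p q : ℝ} (hp : 1 ≤ p) (hq : 1 / 2 ≤ q) (hqp : q ≤ p) (l j : ℕ) :
    PowAdmissible p (twoPowers p q l j) := by
  by_cases h : j ≤ l
  · have : twoPowers p q l j = fun x => onePlusCos x ^ p := by ext; simp [twoPowers, h]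
    rw [this]; exact powAdmissible_rpow (by linarith) le_rfl
  · have : twoPowers p q l j = fun x => onePlusCos x ^ q := by ext; simp [twoPowers, h]
    rw [this]; exact powAdmissible_rpow hq hqp

theorem lacProd_twoPowers_of_le (n : ℕ → ℕ) (p q : ℝ) {l k : ℕ} (h : k ≤ l) (t : Torus) :
    lacProd n (twoPowers p q l) k t = rieszProduct n k t ^ p := by
  rw [rieszProduct_eq_prod, ← Real.finsetProd_rpow _ _ fun _ _ => onePlusCos_nonneg _]
  refine Finset.prod_congr rfl fun j hj => ?_
  simp [twoPowers, (Finset.mem_Icc.1 hj).2.trans h]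

theorem lacProd_twoPowers (n : ℕ → ℕ) (p q : ℝ) {l k : ℕ} (h : l ≤ k) (t : Torus) :
    lacProd n (twoPowers p q l) k t = rieszProduct n l t ^ p * rieszTail n l k t ^ q := by
  induction k, h using Nat.le_induction with
  | base => simp [lacProd_twoPowers_of_le n p q le_rfl, rieszTail_of_le n le_rfl]
  | succ k h ih =>
    rw [lacProd_succ, ih, rieszTail_succ n h,
      Real.mul_rpow (rieszTail_nonneg n l k t) (onePlusCos_nonneg _)]
    simp [twoPowers, h.not_gt, mul_assoc]

/-- The ratio `d` is so large that consecutive factors of products with exponents up to `p` are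
uncorrelated up to the relative error `δ`. -/
structure GoodRatio (p δ d : ℝ) : Prop where
  large : LargeRatio (2 ^ p) (2 * p * 2 ^ p) (1 / 2) d
  error : 2 ^ p * (8 * Real.pi * (2 * p * 2 ^ p) / (1 / 2)) / d ≤ δ

theorem eventually_goodRatio {p δ : ℝ} (hδ : 0 < δ) : ∀ᶠ d in atTop, GoodRatio p δ d := by
  have hlim : ∀ ε : ℝ, 0 < ε →
      ∀ᶠ d in atTop, 2 ^ p * (8 * Real.pi * (2 * p * 2 ^ p) / (1 / 2)) / d ≤ ε := fun ε hε =>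
    (tendsto_const_nhds.div_atTop tendsto_id).eventually_le_const hε
  filter_upwards [hlim δ hδ, hlim (1 / 2 / 2) (by norm_num), eventually_ge_atTop 2,
    eventually_ge_atTop (8 * (2 : ℝ) ^ p)] with d h1 h2 h3 h4
  exact ⟨⟨by linarith, by linarith, h2⟩, h1⟩

theorem integral_rieszProduct_rpow_nonneg (n : ℕ → ℕ) (k : ℕ) (p : ℝ) :
    0 ≤ ∫ t, rieszProduct n k t ^ p ∂torusMeasure :=
  integral_nonneg fun t => Real.rpow_nonneg (rieszProduct_nonneg n k t) p

section
variable {n : ℕ → ℕ} {p δ d : ℝ}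

theorem integral_twoPowers_le (hp : 1 ≤ p) (hd : GoodRatio p δ d) (hn : Lacunary n d) {q : ℝ}
    (hq : 1 / 2 ≤ q) (hqp : q ≤ p) {l k : ℕ} (hlk : l ≤ k) :
    ∫ t, rieszProduct n l t ^ p * rieszTail n l k t ^ q ∂torusMeasure
      ≤ ((∫ t, onePlusCos t ^ q ∂torusMeasure) + δ) ^ (k - l)
        * ∫ t, rieszProduct n l t ^ p ∂torusMeasure := by
  have h := integral_lacProd_le_pow (one_le_two_rpow hp) (by positivity) (by norm_num) hd.large hn
    (powAdmissible_twoPowers hp hq hqp l) hd.error hlk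
    (m := ∫ t, onePlusCos t ^ q ∂torusMeasure)
    (fun j hj _ => le_of_eq (by simp [twoPowers, hj.not_ge]))
  simpa only [lacProd_twoPowers n p q hlk, lacProd_twoPowers n p q le_rfl,
    rieszTail_of_le n le_rfl, Real.one_rpow, mul_one] using h

theorem pow_mul_integral_rieszProduct_le (hp : 1 ≤ p) (hd : GoodRatio p δ d) (hn : Lacunary n d)
    {m : ℝ} (hδ : δ ≤ m) (hm : m ≤ ∫ t, onePlusCos t ^ p ∂torusMeasure) {l k : ℕ} (hlk : l ≤ k) :
    (m - δ) ^ (k - l) * ∫ t, rieszProduct n l t ^ p ∂torusMeasure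
      ≤ ∫ t, rieszProduct n k t ^ p ∂torusMeasure := by
  have h := pow_le_integral_lacProd (one_le_two_rpow hp) (by positivity) (by norm_num) hd.large hn
    (powAdmissible_twoPowers hp (by linarith) le_rfl k) hd.error hδ hlk (m := m)
    (fun j _ hj => hm.trans (le_of_eq (by simp [twoPowers, hj])))
  simpa only [lacProd_twoPowers_of_le n p p hlk, lacProd_twoPowers_of_le n p p le_rfl] using h

theorem integral_rieszProduct_mul_sqrt_tail_le (hp : 1 ≤ p) (hd : GoodRatio p δ d)
    (hδ : δ ≤ 1 / 64) (hδ0 : 0 ≤ δ) (hn : Lacunary n d) {l k : ℕ} (hlk : l ≤ k) :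
    ∫ t, rieszProduct n l t ^ p * rieszTail n l k t ^ (1 / 2 : ℝ) ∂torusMeasure
      ≤ (63 / 64) ^ (k - l) * ∫ t, rieszProduct n l t ^ p ∂torusMeasure := by
  refine (integral_twoPowers_le hp hd hn le_rfl (by linarith) hlk).trans ?_
  have h1 := integral_sqrt_onePlusCos_le
  have h2 := half_le_integral_onePlusCos_rpow (le_refl (1 / 2 : ℝ))
  have h3 := integral_rieszProduct_rpow_nonneg n l p
  gcongr
  linarith

theorem integral_rieszProduct_le_two_mul (hp : 1 ≤ p) (hd : GoodRatio p δ d)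
    (hδ : δ ≤ 1 / 2) (hn : Lacunary n d) (k : ℕ) :
    ∫ t, rieszProduct n k t ^ p ∂torusMeasure
      ≤ 2 * ∫ t, rieszProduct n (k + 1) t ^ p ∂torusMeasure := by
  have h := pow_mul_integral_rieszProduct_le hp hd hn (m := 1) (by linarith)
    (one_le_integral_onePlusCos_rpow hp) (Nat.le_succ k)
  have h3 := integral_rieszProduct_rpow_nonneg n k p
  rw [Nat.succ_eq_add_one, Nat.add_sub_cancel_left, pow_one] at h
  nlinarith

theorem integral_rieszProduct_le_pow_mul (n : ℕ → ℕ) (hp : 1 ≤ p) {l k : ℕ} (hlk : l ≤ k) :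
    ∫ t, rieszProduct n k t ^ p ∂torusMeasure
      ≤ (2 ^ p) ^ (k - l) * ∫ t, rieszProduct n l t ^ p ∂torusMeasure := by
  induction k, hlk using Nat.le_induction with
  | base => simp
  | succ k hlk ih =>
    have h1 : ∫ t, rieszProduct n (k + 1) t ^ p ∂torusMeasure
        ≤ 2 ^ p * ∫ t, rieszProduct n k t ^ p ∂torusMeasure := by
      rw [← integral_const_mul]
      refine integral_torus_mono (continuous_rieszProduct_rpow n _ (by linarith))
        ((continuous_rieszProduct_rpow n _ (by linarith)).const_mul _) fun t => ?_
      rw [rieszProduct_succ, Real.mul_rpow (rieszProduct_nonneg n k t) (onePlusCos_nonneg _),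
        mul_comm]
      exact mul_le_mul_of_nonneg_right (Real.rpow_le_rpow (onePlusCos_nonneg _)
        (onePlusCos_le_two _) (by linarith)) (Real.rpow_nonneg (rieszProduct_nonneg n k t) p)
    rw [Nat.succ_sub hlk, pow_succ]
    calc _ ≤ _ := h1
      _ ≤ 2 ^ p * ((2 ^ p) ^ (k - l) * ∫ t, rieszProduct n l t ^ p ∂torusMeasure) := by gcongr
      _ = _ := by ring

end

/-- Lowering the exponent of the last factors of `R_k ^ p` makes the integral smaller by a factor
that is geometrically small in the number of these factors. -/
theorem exists_integral_lower_power_le {p q : ℝ} (hp : 1 ≤ p) (hq : 1 / 2 ≤ q) (hqp : q < p) :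
    ∃ ρ : ℝ, 0 < ρ ∧ ρ < 1 ∧ ∀ᶠ d in atTop, ∀ n, Lacunary n d → ∀ l k, l ≤ k →
      ∫ t, rieszProduct n l t ^ p * rieszTail n l k t ^ q ∂torusMeasure
        ≤ ρ ^ (k - l) * ∫ t, rieszProduct n k t ^ p ∂torusMeasure := by
  set a := ∫ t, onePlusCos t ^ q ∂torusMeasure
  set b := ∫ t, onePlusCos t ^ p ∂torusMeasure
  have hab : a < b := integral_onePlusCos_rpow_lt hp hq hqp
  have ha : 1 / 2 ≤ a := half_le_integral_onePlusCos_rpow hq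
  set δ := (b - a) / 4 with hδ
  have hδ0 : 0 < δ := by linarith
  refine ⟨(a + δ) / (b - δ), by apply div_pos <;> linarith, ?_, ?_⟩
  · rw [div_lt_one (by linarith)]; linarith
  filter_upwards [eventually_goodRatio (p := p) hδ0] with d hd n hn l k hlk
  have hpos : 0 < b - δ := by linarith
  have h1 := integral_twoPowers_le hp hd hn hq hqp.le hlk
  have h2 := pow_mul_integral_rieszProduct_le hp hd hn (m := b) (by linarith) le_rfl hlk
  refine h1.trans ?_
  rw [div_pow, div_mul_eq_mul_div, le_div_iff₀ (pow_pos hpos _), mul_assoc]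
  refine mul_le_mul_of_nonneg_left ?_ (pow_nonneg (by linarith) _)
  rw [mul_comm]; exact h2

/-! ### The upper bound -/

theorem sum_pow_injOn_le {ι : Type*} {ρ : ℝ} (h0 : 0 ≤ ρ) (h1 : ρ < 1) (s : Finset ι) (g : ι → ℕ)
    (hg : Set.InjOn g s) : ∑ i ∈ s, ρ ^ g i ≤ (1 - ρ)⁻¹ := by
  classical
  rw [← Finset.sum_image (f := fun i => ρ ^ i) hg, ← tsum_geometric_of_lt_one h0 h1]
  exact (summable_geometric_of_lt_one h0 h1).sum_le_tsum _ fun _ _ => pow_nonneg h0 _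

theorem sum_pow_dist_le {ρ : ℝ} (h0 : 0 ≤ ρ) (h1 : ρ < 1) (s : Finset ℕ) (k : ℕ) :
    ∑ l ∈ s, ρ ^ ((k - l) + (l - k)) ≤ 2 * (1 - ρ)⁻¹ := by
  rw [← Finset.sum_filter_add_sum_filter_not s (· ≤ k)]
  have ha := sum_pow_injOn_le h0 h1 (s.filter (· ≤ k)) (fun l => (k - l) + (l - k)) (by
    intro a ha b hb hab
    simp at ha hb hab
    omega)
  have hb := sum_pow_injOn_le h0 h1 (s.filter (¬ · ≤ k)) (fun l => (k - l) + (l - k)) (by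
    intro a ha b hb hab
    simp at ha hb hab
    omega)
  linarith

theorem sum_sum_pow_dist_le {ρ : ℝ} (h0 : 0 ≤ ρ) (h1 : ρ < 1) (s : Finset ℕ) {w : ℕ → ℝ}
    (hw : ∀ k, 0 ≤ w k) :
    ∑ k ∈ s, ∑ l ∈ s, ρ ^ ((k - l) + (l - k)) * (w k + w l) ≤ 4 * (1 - ρ)⁻¹ * ∑ k ∈ s, w k := by
  have hone : ∑ k ∈ s, ∑ l ∈ s, ρ ^ ((k - l) + (l - k)) * w k
      ≤ 2 * (1 - ρ)⁻¹ * ∑ k ∈ s, w k := by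
    rw [Finset.mul_sum]
    refine Finset.sum_le_sum fun k _ => ?_
    rw [← Finset.sum_mul]
    exact mul_le_mul_of_nonneg_right (sum_pow_dist_le h0 h1 s k) (hw k)
  have htwo : ∑ k ∈ s, ∑ l ∈ s, ρ ^ ((k - l) + (l - k)) * w l
      ≤ 2 * (1 - ρ)⁻¹ * ∑ k ∈ s, w k := by
    rw [Finset.sum_comm]
    simpa only [add_comm] using hone
  simp only [mul_add, Finset.sum_add_distrib]
  linarith

/-- Discrete form of `S ^ p = ∫ p S ^ (p - 1) dS`. -/
theorem rpow_sum_le_mul_sum {p : ℝ} (hp : 1 ≤ p) {x : ℕ → ℝ} (hx : ∀ k, 0 ≤ x k) (N : ℕ) :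
    (∑ k ∈ Finset.range N, x k) ^ p
      ≤ p * ∑ k ∈ Finset.range N, x k * (∑ l ∈ Finset.range (k + 1), x l) ^ (p - 1) := by
  induction N with
  | zero => simp [Real.zero_rpow (by linarith : p ≠ 0)]
  | succ N ih =>
    have h := rpow_sub_rpow_le (Finset.sum_nonneg fun k _ => hx k)
      (by rw [Finset.sum_range_succ]; linarith [hx N] :
        ∑ k ∈ Finset.range N, x k ≤ ∑ k ∈ Finset.range (N + 1), x k) hp
    rw [Finset.sum_range_succ (fun k => x k * _), mul_add]
    have h2 : ∑ k ∈ Finset.range (N + 1), x k - ∑ k ∈ Finset.range N, x k = x N := by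
      rw [Finset.sum_range_succ]; ring
    rw [h2] at h
    linarith

/-- A power of a sum is bounded by the sum of the powers with slowly growing weights. -/
theorem exists_rpow_sum_le {q φ : ℝ} (hq : 0 < q) (hφ : 1 < φ) :
    ∃ C : ℝ, 0 < C ∧ ∀ x : ℕ → ℝ, (∀ k, 0 ≤ x k) → ∀ k : ℕ,
      (∑ l ∈ Finset.range (k + 1), x l) ^ q
        ≤ C * ∑ l ∈ Finset.range (k + 1), φ ^ (k - l) * x l ^ q := by
  have hφ0 : 0 < φ := by linarith
  set θ := φ ^ (-q⁻¹) with hθ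
  have hθ0 : 0 < θ := Real.rpow_pos_of_pos hφ0 _
  have hθ1 : θ < 1 := Real.rpow_lt_one_of_one_lt_of_neg hφ (by simpa using hq)
  have hθq : θ ^ q = φ⁻¹ := by
    rw [hθ, ← Real.rpow_mul hφ0.le, neg_mul, inv_mul_cancel₀ hq.ne', Real.rpow_neg_one]
  have hinv : 0 < (1 - θ)⁻¹ := inv_pos.2 (by linarith)
  refine ⟨(1 - θ)⁻¹ ^ q, Real.rpow_pos_of_pos hinv q, fun x hx k => ?_⟩
  set A := ∑ l ∈ Finset.range (k + 1), φ ^ (k - l) * x l ^ q with hA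
  have hterm0 : ∀ l ∈ Finset.range (k + 1), 0 ≤ φ ^ (k - l) * x l ^ q := fun l _ =>
    mul_nonneg (pow_nonneg hφ0.le _) (Real.rpow_nonneg (hx l) q)
  have hA0 : 0 ≤ A := Finset.sum_nonneg hterm0
  set B := A ^ q⁻¹ with hB
  have hB0 : 0 ≤ B := Real.rpow_nonneg hA0 _
  have hBq : B ^ q = A := Real.rpow_inv_rpow hA0 hq.ne'
  have hxl : ∀ l ∈ Finset.range (k + 1), x l ≤ B * θ ^ (k - l) := by
    intro l hl
    rw [← Real.rpow_le_rpow_iff (hx l) (by positivity) hq, Real.mul_rpow hB0 (by positivity), hBq,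
      ← Real.rpow_pow_comm hθ0.le, hθq, inv_pow,
      ← div_eq_mul_inv, le_div_iff₀ (by positivity), mul_comm]
    exact Finset.single_le_sum (f := fun l => φ ^ (k - l) * x l ^ q) hterm0 hl
  have hsum : ∑ l ∈ Finset.range (k + 1), x l ≤ (1 - θ)⁻¹ * B := by
    calc _ ≤ ∑ l ∈ Finset.range (k + 1), B * θ ^ (k - l) := Finset.sum_le_sum hxl
      _ = B * ∑ l ∈ Finset.range (k + 1), θ ^ (k - l) := by rw [Finset.mul_sum]
      _ ≤ B * (1 - θ)⁻¹ := by
          gcongr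
          refine sum_pow_injOn_le hθ0.le hθ1 _ _ ?_
          intro a ha b hb hab
          simp at ha hb hab
          omega
      _ = _ := mul_comm _ _
  calc _ ≤ ((1 - θ)⁻¹ * B) ^ q :=
        Real.rpow_le_rpow (Finset.sum_nonneg fun l _ => hx l) hsum hq.le
    _ = _ := by rw [Real.mul_rpow hinv.le hB0, hBq]

theorem rpow_sub_one_mul_self {p x : ℝ} (hp : 1 ≤ p) (hx : 0 ≤ x) : x ^ (p - 1) * x = x ^ p := by
  conv_lhs => rw [← Real.rpow_one x, ← Real.rpow_mul hx, one_mul]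
  rw [← Real.rpow_add_of_nonneg hx (by linarith) (by norm_num), sub_add_cancel]

/-- A mixed term, with `r` the quotient of the two Riesz products, splits into two terms in which the
exponents of `r` differ from those in the integrals `∫ R_k ^ p` and so yield decay. -/
theorem mul_rpow_mul_le {p b c r : ℝ} (hp : 1 ≤ p) (hb : 0 ≤ b) (hc : 0 ≤ c) (hr : 0 ≤ r) :
    c * b ^ (p - 1) * r ≤ c ^ p * r ^ ((p + 1) / 2) + b ^ p * r ^ (1 / 2 : ℝ) := by
  have hs : 0 ≤ √r := Real.sqrt_nonneg r
  have hss : √r * √r = r := Real.mul_self_sqrt hr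
  rw [← Real.sqrt_eq_rpow]
  rcases le_total (c * √r) b with h | h
  · have h1 : c * b ^ (p - 1) * r ≤ b ^ p * √r := by
      calc c * b ^ (p - 1) * r = c * b ^ (p - 1) * (√r * √r) := by rw [hss]
        _ = b ^ (p - 1) * (c * √r) * √r := by ring
        _ ≤ b ^ (p - 1) * b * √r := by gcongr
        _ = _ := by rw [rpow_sub_one_mul_self hp hb]
    have h2 : 0 ≤ c ^ p * r ^ ((p + 1) / 2) := by positivity
    linarith
  · have h1 : c * b ^ (p - 1) * r ≤ c ^ p * r ^ ((p + 1) / 2) := by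
      have h3 : r ^ ((p + 1) / 2) = √r ^ (p - 1) * r := by
        rw [Real.sqrt_eq_rpow, ← Real.rpow_mul hr]
        conv_rhs => rw [← Real.rpow_one r, ← Real.rpow_mul hr, one_mul]
        rw [← Real.rpow_add_of_nonneg hr (by linarith) (by norm_num)]
        congr 1; ring
      calc c * b ^ (p - 1) * r ≤ c * (c * √r) ^ (p - 1) * r := by
            have := Real.rpow_le_rpow hb h (by linarith : 0 ≤ p - 1)
            gcongr
        _ = _ := by rw [Real.mul_rpow hc hs, h3, ← rpow_sub_one_mul_self hp hc]; ring
    have h2 : 0 ≤ b ^ p * √r := by positivity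
    linarith

theorem exists_integral_mul_rpow_le {p : ℝ} (hp : 1 < p) :
    ∃ ρ : ℝ, 0 < ρ ∧ ρ < 1 ∧ ∀ᶠ d in atTop, ∀ n, Lacunary n d → ∀ l k, l ≤ k →
      ∀ b c : ℝ, 0 ≤ b → 0 ≤ c →
      ∫ t, c * rieszProduct n k t * (b * rieszProduct n l t) ^ (p - 1) ∂torusMeasure
        ≤ ρ ^ (k - l) * (c ^ p * ∫ t, rieszProduct n k t ^ p ∂torusMeasure
          + b ^ p * ∫ t, rieszProduct n l t ^ p ∂torusMeasure) := by
  obtain ⟨ρ, hρ0, hρ1, hev⟩ := exists_integral_lower_power_le hp.le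
    (by linarith : 1 / 2 ≤ (p + 1) / 2) (by linarith)
  refine ⟨max ρ (63 / 64), lt_max_of_lt_left hρ0, max_lt hρ1 (by norm_num), ?_⟩
  filter_upwards [hev, eventually_goodRatio (p := p) (by norm_num : (0 : ℝ) < 1 / 64)]
    with d hd1 hd2 n hn l k hlk b c hb hc
  have h1 := hd1 n hn l k hlk
  have h2 := integral_rieszProduct_mul_sqrt_tail_le hp.le hd2 le_rfl (by norm_num) hn hlk
  have hcont1 := continuous_rieszProduct_mul_rieszTail n l l k (by linarith : 0 ≤ p)
    (by linarith : 0 ≤ (p + 1) / 2)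
  have hcont2 := continuous_rieszProduct_mul_rieszTail n l l k (by linarith : 0 ≤ p)
    (by norm_num : (0 : ℝ) ≤ 1 / 2)
  have hI1 := integral_rieszProduct_rpow_nonneg n k p
  have hI2 := integral_rieszProduct_rpow_nonneg n l p
  calc _ ≤ ∫ t, (c ^ p * (rieszProduct n l t ^ p * rieszTail n l k t ^ ((p + 1) / 2))
        + b ^ p * (rieszProduct n l t ^ p * rieszTail n l k t ^ (1 / 2 : ℝ))) ∂torusMeasure := by
        refine integral_torus_mono ?_ (by fun_prop) fun t => ?_
        · exact (continuous_const.mul (continuous_rieszProduct n k)).mul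
            ((continuous_const.mul (continuous_rieszProduct n l)).rpow_const
              fun _ => Or.inr (by linarith))
        · have hR := rieszProduct_nonneg n l t
          have := mul_le_mul_of_nonneg_left
            (mul_rpow_mul_le hp.le hb hc (rieszTail_nonneg n l k t)) (Real.rpow_nonneg hR p)
          rw [← rieszProduct_mul_rieszTail n hlk t, Real.mul_rpow hb hR]
          refine (le_of_eq ?_).trans (this.trans (le_of_eq (by ring)))
          rw [← rpow_sub_one_mul_self hp.le hR]; ring
    _ = c ^ p * (∫ t, rieszProduct n l t ^ p * rieszTail n l k t ^ ((p + 1) / 2) ∂torusMeasure)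
        + b ^ p * ∫ t, rieszProduct n l t ^ p * rieszTail n l k t ^ (1 / 2 : ℝ) ∂torusMeasure := by
        rw [integral_add (hcont1.const_mul _).integrable_torus
          (hcont2.const_mul _).integrable_torus, integral_const_mul, integral_const_mul]
    _ ≤ c ^ p * (max ρ (63 / 64) ^ (k - l) * ∫ t, rieszProduct n k t ^ p ∂torusMeasure)
        + b ^ p * (max ρ (63 / 64) ^ (k - l) * ∫ t, rieszProduct n l t ^ p ∂torusMeasure) := by
        gcongr
        · refine h1.trans ?_
          gcongr
          exact le_max_left _ _
        · refine h2.trans ?_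
          gcongr
          exact le_max_right _ _
    _ = _ := by ring

/-- The upper bound for nonnegative scalar coefficients. -/
theorem exists_integral_rpow_sum_le {p : ℝ} (hp : 1 ≤ p) :
    ∃ C : ℝ, 0 < C ∧ ∀ᶠ d in atTop, ∀ n, Lacunary n d → ∀ a : ℕ → ℝ, (∀ k, 0 ≤ a k) → ∀ N : ℕ,
      ∫ t, (∑ k ∈ Finset.range N, a k * rieszProduct n k t) ^ p ∂torusMeasure
        ≤ C * ∑ k ∈ Finset.range N, a k ^ p * ∫ t, rieszProduct n k t ^ p ∂torusMeasure := by
  rcases eq_or_lt_of_le hp with rfl | hp1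
  · refine ⟨1, one_pos, Eventually.of_forall fun d n _ a _ N => le_of_eq ?_⟩
    simp only [Real.rpow_one, one_mul]
    rw [integral_finsetSum _ fun k _ =>
      ((continuous_rieszProduct n k).const_mul _).integrable_torus]
    simp only [integral_const_mul]
  obtain ⟨ρ, hρ0, hρ1, hev⟩ := exists_integral_mul_rpow_le hp1
  set φ := (1 + ρ) / (2 * ρ) with hφ
  have hφ1 : 1 < φ := by rw [hφ, lt_div_iff₀ (by linarith)]; linarith
  have hφρ : φ * ρ = (1 + ρ) / 2 := by rw [hφ]; field_simp
  obtain ⟨C, hC0, hC⟩ := exists_rpow_sum_le (by linarith : 0 < p - 1) hφ1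
  have hσ1 : (1 + ρ) / 2 < 1 := by linarith
  have hσ0 : 0 ≤ (1 + ρ) / 2 := by linarith
  refine ⟨p * (C * (4 * (1 - (1 + ρ) / 2)⁻¹)), ?_, ?_⟩
  · have := inv_pos.2 (by linarith : 0 < 1 - (1 + ρ) / 2)
    have : 0 < p := by linarith
    positivity
  filter_upwards [hev] with d hd n hn a ha N
  set w : ℕ → ℝ := fun k => a k ^ p * ∫ t, rieszProduct n k t ^ p ∂torusMeasure with hw
  have hw0 : ∀ k, 0 ≤ w k := fun k =>
    mul_nonneg (Real.rpow_nonneg (ha k) p) (integral_rieszProduct_rpow_nonneg n k p)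
  have hx0 : ∀ t k, 0 ≤ a k * rieszProduct n k t := fun t k =>
    mul_nonneg (ha k) (rieszProduct_nonneg n k t)
  have hcx : ∀ k, Continuous fun t => a k * rieszProduct n k t := fun k =>
    (continuous_rieszProduct n k).const_mul _
  have hcpair : ∀ k l, Continuous fun t => a k * rieszProduct n k t *
      (a l * rieszProduct n l t) ^ (p - 1) := fun k l =>
    (hcx k).mul ((hcx l).rpow_const fun _ => Or.inr (by linarith))
  have hcS : Continuous fun t => ∑ k ∈ Finset.range N, a k * rieszProduct n k t :=
    continuous_finsetSum _ fun k _ => hcx k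
  calc ∫ t, (∑ k ∈ Finset.range N, a k * rieszProduct n k t) ^ p ∂torusMeasure
      ≤ ∫ t, p * (C * ∑ k ∈ Finset.range N, ∑ l ∈ Finset.range (k + 1), φ ^ (k - l) *
          (a k * rieszProduct n k t * (a l * rieszProduct n l t) ^ (p - 1))) ∂torusMeasure := by
        refine integral_torus_mono (hcS.rpow_const fun _ => Or.inr (by linarith))
          (by fun_prop) fun t => ?_
        refine (rpow_sum_le_mul_sum hp (hx0 t) N).trans ?_
        refine mul_le_mul_of_nonneg_left ?_ (by linarith)
        rw [Finset.mul_sum]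
        refine Finset.sum_le_sum fun k _ => ?_
        refine (mul_le_mul_of_nonneg_left (hC _ (hx0 t) k) (hx0 t k)).trans (le_of_eq ?_)
        rw [Finset.mul_sum, Finset.mul_sum, Finset.mul_sum]
        exact Finset.sum_congr rfl fun l _ => by ring
    _ = p * (C * ∑ k ∈ Finset.range N, ∑ l ∈ Finset.range (k + 1), φ ^ (k - l) *
          ∫ t, a k * rieszProduct n k t * (a l * rieszProduct n l t) ^ (p - 1) ∂torusMeasure) := by
        rw [integral_const_mul, integral_const_mul, integral_finsetSum _ fun k _ =>
          (continuous_finsetSum _ fun l _ => (hcpair k l).const_mul _).integrable_torus]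
        congr 2
        refine Finset.sum_congr rfl fun k _ => ?_
        rw [integral_finsetSum _ fun l _ => ((hcpair k l).const_mul _).integrable_torus]
        simp only [integral_const_mul]
    _ ≤ p * (C * ∑ k ∈ Finset.range N, ∑ l ∈ Finset.range N,
          ((1 + ρ) / 2) ^ ((k - l) + (l - k)) * (w k + w l)) := by
        have hp0 : 0 ≤ p := by linarith
        gcongr with k hk
        have hsub : Finset.range (k + 1) ⊆ Finset.range N := by
          rw [Finset.mem_range] at hk
          exact Finset.range_subset_range.2 hk
        refine le_trans (Finset.sum_le_sum fun l hl => ?_)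
          (Finset.sum_le_sum_of_subset_of_nonneg hsub fun l _ _ =>
            mul_nonneg (pow_nonneg hσ0 _) (add_nonneg (hw0 k) (hw0 l)))
        have hlk : l ≤ k := by rw [Finset.mem_range] at hl; omega
        rw [Nat.sub_eq_zero_of_le hlk, add_zero, ← hφρ, mul_pow, mul_assoc]
        exact mul_le_mul_of_nonneg_left (hd n hn l k hlk (a l) (a k) (ha l) (ha k))
          (pow_nonneg (by linarith) _)
    _ ≤ p * (C * (4 * (1 - (1 + ρ) / 2)⁻¹ * ∑ k ∈ Finset.range N, w k)) := by
        have hp0 : 0 ≤ p := by linarith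
        gcongr
        exact sum_sum_pow_dist_le hσ0 hσ1 _ hw0
    _ = _ := by ring

/-! ### The comparison functions -/

/-- The functions `V_l = R_r ^ p * (R_l / R_r) ^ (1 / 2)`, for `l ≤ r` with the cancellation carried
out, and for `l > r` with the factors of index `r + 1` and `r + 2` removed. -/
noncomputable def comparison (p : ℝ) (n : ℕ → ℕ) (r l : ℕ) (t : Torus) : ℝ :=
  if l ≤ r then rieszProduct n l t ^ p * rieszTail n l r t ^ (p - 1 / 2)
  else rieszProduct n r t ^ p * rieszTail n (r + 2) l t ^ (1 / 2 : ℝ)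

theorem comparison_of_le {p : ℝ} {n : ℕ → ℕ} {r l : ℕ} (h : l ≤ r) :
    comparison p n r l = fun t => rieszProduct n l t ^ p * rieszTail n l r t ^ (p - 1 / 2) := by
  ext t; simp [comparison, h]

theorem comparison_of_gt {p : ℝ} {n : ℕ → ℕ} {r l : ℕ} (h : r < l) :
    comparison p n r l
      = fun t => rieszProduct n r t ^ p * rieszTail n (r + 2) l t ^ (1 / 2 : ℝ) := by
  ext t; simp [comparison, h.not_ge]

theorem comparison_self (p : ℝ) (n : ℕ → ℕ) (r : ℕ) :
    comparison p n r r = fun t => rieszProduct n r t ^ p := by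
  ext t; simp [comparison, rieszTail_of_le n le_rfl]

theorem comparison_succ (p : ℝ) (n : ℕ → ℕ) (r : ℕ) :
    comparison p n r (r + 1) = fun t => rieszProduct n r t ^ p := by
  ext t; simp [comparison, rieszTail_of_le n (Nat.le_succ (r + 1))]

theorem comparison_nonneg (p : ℝ) (n : ℕ → ℕ) (r l : ℕ) (t : Torus) :
    0 ≤ comparison p n r l t := by
  unfold comparison
  have h1 := rieszProduct_nonneg n l t
  have h2 := rieszProduct_nonneg n r t
  have h3 := rieszTail_nonneg n l r t
  have h4 := rieszTail_nonneg n (r + 2) l t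
  split_ifs <;> positivity

theorem continuous_comparison {p : ℝ} (hp : 1 ≤ p) (n : ℕ → ℕ) (r l : ℕ) :
    Continuous (comparison p n r l) := by
  rcases le_or_gt l r with h | h
  · rw [comparison_of_le h]
    exact continuous_rieszProduct_mul_rieszTail n l l r (by linarith) (by linarith)
  · rw [comparison_of_gt h]
    exact continuous_rieszProduct_mul_rieszTail n r (r + 2) l (by linarith) (by norm_num)

/-- The factors of `R_r ^ p * (∏_{r + 2 < j} (1 + cos (n_j t))) ^ (1 / 2)` as a lacunary
product. -/
noncomputable def gapPowers (p : ℝ) (r j : ℕ) (x : Torus) : ℝ :=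
  if j ≤ r then onePlusCos x ^ p else if j ≤ r + 2 then 1 else onePlusCos x ^ (1 / 2 : ℝ)

theorem gapPowers_of_le {p : ℝ} {r j : ℕ} (h : j ≤ r) :
    gapPowers p r j = fun x => onePlusCos x ^ p := by
  ext x; simp [gapPowers, h]

theorem gapPowers_of_mem {p : ℝ} {r j : ℕ} (h1 : r < j) (h2 : j ≤ r + 2) :
    gapPowers p r j = fun _ => 1 := by
  ext x; simp [gapPowers, h1.not_ge, h2]

theorem gapPowers_of_gt {p : ℝ} {r j : ℕ} (h : r + 2 < j) :
    gapPowers p r j = fun x => onePlusCos x ^ (1 / 2 : ℝ) := by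
  ext x; rw [gapPowers, if_neg (by omega), if_neg (by omega)]

theorem powAdmissible_gapPowers {p : ℝ} (hp : 1 ≤ p) (r j : ℕ) :
    PowAdmissible p (gapPowers p r j) := by
  rcases le_or_gt j r with h | h
  · rw [gapPowers_of_le h]; exact powAdmissible_rpow (by linarith) le_rfl
  rcases le_or_gt j (r + 2) with h' | h'
  · rw [gapPowers_of_mem h h']; exact powAdmissible_one hp
  · rw [gapPowers_of_gt h']; exact powAdmissible_rpow le_rfl (by linarith)

theorem lacProd_gapPowers_of_le {p : ℝ} {n : ℕ → ℕ} {r k : ℕ} (h : k ≤ r) (t : Torus) :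
    lacProd n (gapPowers p r) k t = rieszProduct n k t ^ p := by
  rw [rieszProduct_eq_prod, ← Real.finsetProd_rpow _ _ fun _ _ => onePlusCos_nonneg _]
  refine Finset.prod_congr rfl fun j hj => ?_
  rw [gapPowers_of_le ((Finset.mem_Icc.1 hj).2.trans h)]

theorem lacProd_gapPowers_add_two {p : ℝ} {n : ℕ → ℕ} {r : ℕ} (t : Torus) :
    lacProd n (gapPowers p r) (r + 2) t = rieszProduct n r t ^ p := by
  rw [lacProd_succ, lacProd_succ, gapPowers_of_mem (by omega) (by omega),
    gapPowers_of_mem (by omega) (by omega), lacProd_gapPowers_of_le le_rfl]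
  simp

theorem lacProd_gapPowers {p : ℝ} {n : ℕ → ℕ} {r l : ℕ} (h : r + 2 ≤ l) :
    lacProd n (gapPowers p r) l = comparison p n r l := by
  ext t
  rw [comparison_of_gt (by omega)]
  induction l, h using Nat.le_induction with
  | base => simp [lacProd_gapPowers_add_two, rieszTail_of_le n le_rfl]
  | succ k h ih =>
    rw [lacProd_succ, ih]
    dsimp only
    rw [rieszTail_succ n h, Real.mul_rpow (rieszTail_nonneg n (r + 2) k t) (onePlusCos_nonneg _),
      gapPowers_of_gt (by omega), mul_assoc]

theorem integral_gapPowers_le {p : ℝ} {r j : ℕ} (h : r + 2 < j) :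
    ∫ x, gapPowers p r j x ∂torusMeasure ≤ 31 / 32 := by
  rw [gapPowers_of_gt h]; exact integral_sqrt_onePlusCos_le

section
variable {n : ℕ → ℕ} {p δ d : ℝ}

theorem integral_comparison_le_of_gt (hp : 1 ≤ p) (hd : GoodRatio p δ d) (hδ : δ ≤ 1 / 64)
    (hδ0 : 0 ≤ δ) (hn : Lacunary n d) {r l : ℕ} (h : r < l) :
    ∫ t, comparison p n r l t ∂torusMeasure
      ≤ (63 / 64) ^ (l - (r + 2)) * ∫ t, rieszProduct n r t ^ p ∂torusMeasure := by
  rcases eq_or_lt_of_le (Nat.succ_le_of_lt h) with rfl | h2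
  · rw [Nat.succ_eq_add_one, comparison_succ]
    simp
  have h1 := integral_lacProd_le_pow (one_le_two_rpow hp) (by positivity) (by norm_num) hd.large hn
    (powAdmissible_gapPowers hp r) hd.error (by omega : r + 2 ≤ l)
    (m := 31 / 32) (fun j hj _ => integral_gapPowers_le hj)
  rw [lacProd_gapPowers (by omega)] at h1
  simp only [lacProd_gapPowers_add_two] at h1
  refine h1.trans ?_
  have h3 := integral_rieszProduct_rpow_nonneg n r p
  gcongr
  linarith

theorem integral_abs_comparison_sub_le_of_le (hp : 1 ≤ p) (hd : GoodRatio p δ d)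
    (hn : Lacunary n d) {r l : ℕ} (h : l ≤ r) {s : Torus} (hs : ‖s‖ ≤ 2 * Real.pi / n (r + 1)) :
    ∫ t, |comparison p n r l (t + s) - comparison p n r l t| ∂torusMeasure
      ≤ 8 * Real.pi * (2 * p * 2 ^ p) / (1 / 2) / d * ∫ t, comparison p n r l t ∂torusMeasure := by
  have hadm := powAdmissible_twoPowers hp (by linarith : 1 / 2 ≤ p - 1 / 2) (by linarith) l
  have h1 := (integral_abs_lacProd_add_sub_le (by positivity) hadm s r (n := n)).trans
    (sum_modulus_lacProd_le (one_le_two_rpow hp) (by positivity) (by norm_num) hd.large hn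
      hadm r hs)
  have h2 : lacProd n (twoPowers p (p - 1 / 2) l) r = comparison p n r l := by
    ext t
    rw [lacProd_twoPowers n _ _ h, comparison_of_le h]
  rwa [h2] at h1

/-- A translation moves `V_l`, `l > r + 2`, only little in `L¹`, because the removal of one factor
and the translation of the later ones do not affect the geometric decay of the integral. -/
theorem integral_abs_comparison_sub_le_of_gt (hp : 1 ≤ p) (hd : GoodRatio p δ d) (hδ : δ ≤ 1 / 64)
    (hδ0 : 0 ≤ δ) (hn : Lacunary n d) {r l : ℕ} (h : r + 2 ≤ l) {s : Torus}
    (hs : ‖s‖ ≤ 2 * Real.pi / n (r + 1))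
    (hsj : ∀ j, r + 2 < j → j ≤ l → ‖n j • s‖ ≤ 2 * Real.pi / d) :
    ∫ t, |comparison p n r l (t + s) - comparison p n r l t| ∂torusMeasure
      ≤ 8 * Real.pi * (2 * p * 2 ^ p) / (1 / 2) / d *
        (((63 / 64) ^ (l - (r + 2)) + (l - (r + 2) : ℕ) * (63 / 64) ^ (l - (r + 2) - 1))
          * ∫ t, rieszProduct n r t ^ p ∂torusMeasure) := by
  have hM := one_le_two_rpow hp
  set L : ℝ := 2 * p * 2 ^ p with hL
  have hL0 : 0 ≤ L := by positivity
  set M : ℝ := 2 ^ p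
  set φ := gapPowers p r with hφ
  set I := ∫ t, rieszProduct n r t ^ p ∂torusMeasure with hI
  have hI0 : 0 ≤ I := integral_rieszProduct_rpow_nonneg n r p
  have hd0 : 0 < d := hd.large.pos
  have hadm : ∀ j, PowAdmissible p (φ j) := powAdmissible_gapPowers hp r
  have hmix : ∀ j q, PowAdmissible p (mixAt n φ s j q) :=
    Admissible.mixAt hM hL0 (by norm_num) hadm s
  have hcmix : ∀ j k, Continuous (lacProd n (mixAt n φ s j) k) := fun j k =>
    continuous_lacProd (fun q => (hmix j q).continuous) k
  -- the constant factors do not contribute to the telescoping sum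
  set L' : ℕ → ℝ := fun j => if j ≤ r then L else if j ≤ r + 2 then 0 else L with hL'
  have hlip : ∀ j x y, |φ j x - φ j y| ≤ L' j * ‖x - y‖ := by
    intro j x y
    rcases le_or_gt j r with h1 | h1
    · simpa [hL', h1] using (hadm j).lip x y
    rcases le_or_gt j (r + 2) with h2 | h2
    · simp [hL', h1.not_ge, h2, hφ, gapPowers_of_mem h1 h2]
    · simpa [hL', h1.not_ge, h2.not_ge] using (hadm j).lip x y
  have hdecay : ∀ j a b, r + 2 ≤ a → a ≤ b → (j ≤ a ∨ b < j) →
      ∫ t, lacProd n (mixAt n φ s j) b t ∂torusMeasure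
        ≤ (63 / 64) ^ (b - a) * ∫ t, lacProd n (mixAt n φ s j) a t ∂torusMeasure := by
    intro j a b ha hab hj
    refine (integral_lacProd_le_pow hM hL0 (by norm_num) hd.large hn (hmix j) hd.error hab
      (m := 31 / 32) fun q hq hq' => ?_).trans ?_
    · rw [integral_mixAt_of_ne (by omega)]
      exact integral_gapPowers_le (by omega)
    · have : 0 ≤ ∫ t, lacProd n (mixAt n φ s j) a t ∂torusMeasure :=
        integral_nonneg fun t => lacProd_nonneg (fun q => (hmix j q).nonneg) _ t
      gcongr
      linarith
  -- factors of low index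
  have hlow : ∀ j, 1 ≤ j → j ≤ r →
      ∫ t, lacProd n (mixAt n φ s j) l t ∂torusMeasure ≤ (63 / 64) ^ (l - (r + 2)) *
        (M ^ (r - j) * ∫ t, lacProd n φ (j - 1) t ∂torusMeasure) := by
    intro j hj hjr
    refine (hdecay j (r + 2) l le_rfl h (Or.inl (by omega))).trans ?_
    gcongr
    rw [← integral_const_mul]
    refine integral_torus_mono (hcmix j _) ((continuous_lacProd (fun q =>
      (hadm q).continuous) _).const_mul _) fun t => ?_
    rw [lacProd_succ, lacProd_succ, mixAt_of_gt (by omega), mixAt_of_gt (by omega),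
      hφ, gapPowers_of_mem (by omega) (by omega), gapPowers_of_mem (by omega) (by omega)]
    simp only [mul_one]
    exact lacProd_mixAt_le (fun q => (hadm q).nonneg) (fun q => (hadm q).le) s hj hjr t
  -- factors of high index
  have hhigh : ∀ j, r + 2 < j → j ≤ l →
      ∫ t, lacProd n (mixAt n φ s j) l t ∂torusMeasure ≤ (63 / 64) ^ (l - (r + 2) - 1) * I := by
    intro j hj hjl
    have h1 := hdecay j j l hj.le hjl (Or.inl le_rfl)
    have h2 := hdecay j (r + 2) (j - 1) le_rfl (by omega) (Or.inr (by omega))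
    have h3 : ∀ t, lacProd n (mixAt n φ s j) j t = lacProd n (mixAt n φ s j) (j - 1) t := by
      intro t
      obtain ⟨i, rfl⟩ : ∃ i, j = i + 1 := ⟨j - 1, by omega⟩
      rw [lacProd_succ, mixAt_self]
      simp
    have h4 : ∀ t, lacProd n (mixAt n φ s j) (r + 2) t = rieszProduct n r t ^ p := by
      intro t
      rw [← lacProd_gapPowers_add_two]
      exact lacProd_congr (fun q _ hq => mixAt_of_lt (by omega)) t
    simp only [h3] at h1
    simp only [h4] at h2
    refine h1.trans ?_
    calc _ ≤ (63 / 64 : ℝ) ^ (l - j) * ((63 / 64) ^ (j - 1 - (r + 2)) * I) := by gcongr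
      _ = _ := by
        rw [← mul_assoc, ← pow_add]
        congr 2
        omega
  rw [← lacProd_gapPowers h]
  calc ∫ t, |lacProd n φ l (t + s) - lacProd n φ l t| ∂torusMeasure
      ≤ ∫ t, ∑ j ∈ Finset.Icc 1 l, L' j * ‖n j • s‖ * lacProd n (mixAt n φ s j) l t
          ∂torusMeasure := by
        have hc : Continuous (lacProd n φ l) := continuous_lacProd (fun q => (hadm q).continuous) l
        have := fun j => hcmix j l
        exact integral_torus_mono (by fun_prop) (by fun_prop) fun t =>
          abs_lacProd_add_sub_le (fun q => (hadm q).nonneg) hlip s l t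
    _ = ∑ j ∈ Finset.Icc 1 l, L' j * ‖n j • s‖ *
          ∫ t, lacProd n (mixAt n φ s j) l t ∂torusMeasure := by
        rw [integral_finsetSum _ fun j _ => ((hcmix j l).const_mul _).integrable_torus]
        simp only [integral_const_mul]
    _ = (∑ j ∈ Finset.Ioc 0 r, L' j * ‖n j • s‖ *
          ∫ t, lacProd n (mixAt n φ s j) l t ∂torusMeasure)
        + (∑ j ∈ Finset.Ioc r (r + 2), L' j * ‖n j • s‖ *
          ∫ t, lacProd n (mixAt n φ s j) l t ∂torusMeasure)
        + ∑ j ∈ Finset.Ioc (r + 2) l, L' j * ‖n j • s‖ *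
          ∫ t, lacProd n (mixAt n φ s j) l t ∂torusMeasure := by
        rw [Finset.sum_Ioc_consecutive _ (by omega) (by omega),
          Finset.sum_Ioc_consecutive _ (by omega) h]
        rfl
    _ ≤ (63 / 64) ^ (l - (r + 2)) * (8 * Real.pi * L / (1 / 2) / d * I) + 0
        + ((l - (r + 2) : ℕ) : ℝ) * (8 * Real.pi * L / (1 / 2) / d
          * ((63 / 64) ^ (l - (r + 2) - 1) * I)) := by
        refine add_le_add (add_le_add ?_ ?_) ?_
        · have hsum := sum_modulus_lacProd_le hM hL0 (by norm_num) hd.large hn hadm r hs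
          simp only [hφ, lacProd_gapPowers_of_le (le_refl r)] at hsum
          refine le_trans ?_ (mul_le_mul_of_nonneg_left hsum (by positivity))
          rw [Finset.mul_sum]
          refine Finset.sum_le_sum fun j hj => ?_
          rw [Finset.mem_Ioc] at hj
          have h1 := hlow j hj.1 hj.2
          simp only [hL', hj.2, if_true]
          calc _ ≤ L * ‖n j • s‖ * ((63 / 64) ^ (l - (r + 2)) *
                (M ^ (r - j) * ∫ t, lacProd n φ (j - 1) t ∂torusMeasure)) := by gcongr
            _ = _ := by ring
        · refine (Finset.sum_eq_zero fun j hj => ?_).le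
          rw [Finset.mem_Ioc] at hj
          simp [hL', hj.1.not_ge, hj.2]
        · have hcard : ((l - (r + 2) : ℕ) : ℝ) = (Finset.Ioc (r + 2) l).card := by simp
          rw [hcard, ← nsmul_eq_mul]
          refine Finset.sum_le_card_nsmul _ _ _ fun j hj => ?_
          rw [Finset.mem_Ioc] at hj
          have h1 := hhigh j hj.1 hj.2
          have h2 := hsj j hj.1 hj.2
          have h4 : L' j = L := by simp only [hL']; rw [if_neg (by omega), if_neg (by omega)]
          have h5 : 0 ≤ ∫ t, lacProd n (mixAt n φ s j) l t ∂torusMeasure :=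
            integral_nonneg fun t => lacProd_nonneg (fun q => (hmix j q).nonneg) _ t
          rw [h4]
          have h3 : L * (2 * Real.pi / d) ≤ 8 * Real.pi * L / (1 / 2) / d := by
            rw [mul_div_assoc', div_div]
            rw [div_le_div_iff₀ hd0 (by positivity)]
            have : 0 ≤ L * Real.pi * d := by positivity
            nlinarith
          calc _ ≤ L * (2 * Real.pi / d) * ((63 / 64) ^ (l - (r + 2) - 1) * I) := by gcongr
            _ ≤ _ := by gcongr
    _ = _ := by ring

end

theorem nat_mul_pow_le (m : ℕ) :
    (63 / 64 : ℝ) ^ m + m * (63 / 64) ^ (m - 1) ≤ 129 * (127 / 128) ^ m := by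
  have h1 : (63 / 64 : ℝ) ^ m ≤ (127 / 128) ^ m :=
    pow_le_pow_left₀ (by norm_num) (by norm_num) m
  have h2 : (m : ℝ) * (63 / 64) ^ (m - 1) ≤ 128 * (127 / 128) ^ m := by
    rcases Nat.eq_zero_or_pos m with rfl | hm
    · simp
    obtain ⟨k, rfl⟩ : ∃ k, m = k + 1 := ⟨m - 1, by omega⟩
    have h3 := one_add_mul_le_pow (by norm_num : (-2 : ℝ) ≤ 1 / 126) (k + 1)
    have h4 : (127 / 128 : ℝ) ^ (k + 1) = (1 + 1 / 126) ^ (k + 1) * (63 / 64) ^ (k + 1) := by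
      rw [← mul_pow]; norm_num
    have h5 : (0 : ℝ) < (63 / 64) ^ k := by positivity
    rw [h4, Nat.add_sub_cancel, pow_succ (63 / 64 : ℝ) k]
    nlinarith [mul_le_mul_of_nonneg_right h3 h5.le]
  linarith

/-- The translation `s` is short on the scale of `n (r + 1)` and moves the phases of the
frequencies `n (r + 3), …, n K` only by `2π / d`. -/
def IsSmallShift (n : ℕ → ℕ) (d : ℝ) (r K : ℕ) (s : Torus) : Prop :=
  ‖s‖ ≤ 2 * Real.pi / n (r + 1) ∧ ∀ j, r + 2 < j → j ≤ K → ‖n j • s‖ ≤ 2 * Real.pi / d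

/-- The comparison functions decay geometrically in `L¹` away from the index `r + 1`, and small
translations move them little. -/
theorem exists_comparison_bounds {p : ℝ} (hp : 1 ≤ p) :
    ∃ ρ C : ℝ, 1 / 2 ≤ ρ ∧ ρ < 1 ∧ 0 < C ∧ ∀ᶠ d in atTop, ∀ n, Lacunary n d → ∀ r l,
      ∫ t, comparison p n r l t ∂torusMeasure
        ≤ C * ρ ^ ((r + 1 - l) + (l - (r + 1))) * ∫ t, rieszProduct n r t ^ p ∂torusMeasure ∧
      ∀ K, l ≤ K → ∀ s, IsSmallShift n d r K s →
        ∫ t, |comparison p n r l (t + s) - comparison p n r l t| ∂torusMeasure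
          ≤ C / d * ρ ^ ((r + 1 - l) + (l - (r + 1)))
            * ∫ t, rieszProduct n r t ^ p ∂torusMeasure := by
  obtain ⟨ρ₀, hρ0, hρ1, hev⟩ := exists_integral_lower_power_le hp
    (by linarith : 1 / 2 ≤ p - 1 / 2) (by linarith)
  set ρ := max ρ₀ (127 / 128) with hρ
  have hρ2 : 127 / 128 ≤ ρ := le_max_right _ _
  have hρ3 : ρ < 1 := max_lt hρ1 (by norm_num)
  set A : ℝ := 8 * Real.pi * (2 * p * 2 ^ p) / (1 / 2) with hA
  have hA0 : 0 ≤ A := by positivity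
  refine ⟨ρ, 2 + 258 * A, by linarith, hρ3, by positivity, ?_⟩
  filter_upwards [hev, eventually_goodRatio (p := p) (by norm_num : (0 : ℝ) < 1 / 64)]
    with d hd1 hd n hn r l
  set I := ∫ t, rieszProduct n r t ^ p ∂torusMeasure with hI
  have hI0 : 0 ≤ I := integral_rieszProduct_rpow_nonneg n r p
  have hd0 : 0 < d := hd.large.pos
  have hpow : ∀ m, ρ ^ m ≤ 2 * ρ ^ (m + 1) := fun m => by
    have : 0 ≤ ρ ^ m := by positivity
    rw [pow_succ]
    nlinarith
  -- the integrals, with the constant `2`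
  have hint : ∫ t, comparison p n r l t ∂torusMeasure
      ≤ 2 * ρ ^ ((r + 1 - l) + (l - (r + 1))) * I := by
    rcases le_or_gt l r with h | h
    · rw [comparison_of_le h]
      refine (hd1 n hn l r h).trans ?_
      gcongr
      rw [show r + 1 - l + (l - (r + 1)) = (r - l) + 1 by omega]
      refine le_trans ?_ (hpow _)
      gcongr
      exact le_max_left _ _
    · refine (integral_comparison_le_of_gt hp hd le_rfl (by norm_num) hn h).trans ?_
      gcongr
      have h1 : (63 / 64 : ℝ) ^ (l - (r + 2)) ≤ ρ ^ (l - (r + 2)) := by gcongr; linarith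
      refine h1.trans ?_
      rcases eq_or_lt_of_le (Nat.succ_le_of_lt h) with rfl | h2
      · simp
      · rw [show r + 1 - l + (l - (r + 1)) = (l - (r + 2)) + 1 by omega]
        exact hpow _
  refine ⟨hint.trans ?_, fun K hK s hs => ?_⟩
  · gcongr
    linarith
  have hle : ∀ l', l' ≤ r →
      ∫ t, comparison p n r l' t ∂torusMeasure ≤ 2 * ρ ^ ((r + 1 - l) + (l - (r + 1))) * I →
      ∫ t, |comparison p n r l' (t + s) - comparison p n r l' t| ∂torusMeasure
        ≤ (2 + 258 * A) / d * ρ ^ ((r + 1 - l) + (l - (r + 1))) * I := by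
    intro l' hl' hint'
    refine (integral_abs_comparison_sub_le_of_le hp hd hn hl' hs.1).trans ?_
    calc A / d * ∫ t, comparison p n r l' t ∂torusMeasure
        ≤ A / d * (2 * ρ ^ ((r + 1 - l) + (l - (r + 1))) * I) := by gcongr
      _ = 2 * A / d * ρ ^ ((r + 1 - l) + (l - (r + 1))) * I := by ring
      _ ≤ _ := by gcongr; linarith
  rcases le_or_gt l r with h | h
  · exact hle l h hint
  rcases eq_or_lt_of_le (Nat.succ_le_of_lt h) with rfl | h2
  · have h3 := hle r le_rfl (by
      rw [Nat.succ_eq_add_one, comparison_succ] at hint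
      rw [comparison_self]; exact hint)
    rw [Nat.succ_eq_add_one, comparison_succ]
    rwa [comparison_self] at h3
  · refine (integral_abs_comparison_sub_le_of_gt hp hd le_rfl (by norm_num) hn h2 hs.1
      fun j hj hj' => hs.2 j hj (hj'.trans hK)).trans ?_
    have h3 := nat_mul_pow_le (l - (r + 2))
    have h4 : (127 / 128 : ℝ) ^ (l - (r + 2)) ≤ ρ ^ (l - (r + 2)) := by gcongr
    have h5 := hpow (l - (r + 2))
    rw [show r + 1 - l + (l - (r + 1)) = (l - (r + 2)) + 1 by omega]
    calc _ ≤ A / d * ((258 * ρ ^ (l - (r + 2) + 1)) * I) := by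
          gcongr
          linarith
      _ = 258 * A / d * ρ ^ (l - (r + 2) + 1) * I := by ring
      _ ≤ _ := by gcongr; linarith

/-- The denominator of the localization weight `R_r ^ p / (R_r ^ p + ε ∑ V_l)`. -/
noncomputable def denom (p ε : ℝ) (n : ℕ → ℕ) (N r : ℕ) (t : Torus) : ℝ :=
  rieszProduct n r t ^ p + ε * ∑ l ∈ Finset.range (N + 1), comparison p n r l t

theorem continuous_denom {p : ℝ} (hp : 1 ≤ p) (ε : ℝ) (n : ℕ → ℕ) (N r : ℕ) :
    Continuous (denom p ε n N r) :=
  (continuous_rieszProduct_rpow n r (by linarith)).add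
    (continuous_const.mul (continuous_finsetSum _ fun l _ => continuous_comparison hp n r l))

theorem mul_comparison_le_denom {p ε : ℝ} (hε : 0 ≤ ε) (n : ℕ → ℕ) {N l : ℕ} (r : ℕ) (hl : l ≤ N)
    (t : Torus) : ε * comparison p n r l t ≤ denom p ε n N r t := by
  have h1 := Finset.single_le_sum (f := fun l => comparison p n r l t)
    (fun l _ => comparison_nonneg p n r l t) (Finset.mem_range.2 (Nat.lt_succ_of_le hl))
  have h2 := Real.rpow_nonneg (rieszProduct_nonneg n r t) p
  have h3 := mul_le_mul_of_nonneg_left h1 hε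
  unfold denom
  linarith

theorem rpow_le_denom {p ε : ℝ} (hε : 0 ≤ ε) (n : ℕ → ℕ) (N r : ℕ) (t : Torus) :
    rieszProduct n r t ^ p ≤ denom p ε n N r t := by
  have := mul_nonneg hε (Finset.sum_nonneg fun l (_ : l ∈ Finset.range (N + 1)) =>
    comparison_nonneg p n r l t)
  unfold denom
  linarith

theorem denom_nonneg {p ε : ℝ} (hε : 0 ≤ ε) (n : ℕ → ℕ) (N r : ℕ) (t : Torus) :
    0 ≤ denom p ε n N r t :=
  (Real.rpow_nonneg (rieszProduct_nonneg n r t) p).trans (rpow_le_denom hε n N r t)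

/-! ### Integrals against odd functions of one phase -/

/-- Lipschitz bound for the function `v ^ 2 / D` on the cone `0 ≤ ε v ≤ D`; the value at the
vertex is the junk value `0`. -/
theorem abs_sq_div_sub_sq_div_le {ε v D v' D' : ℝ} (hε : 0 < ε) (hv : 0 ≤ v) (hvD : ε * v ≤ D)
    (hv' : 0 ≤ v') (hvD' : ε * v' ≤ D') :
    |v ^ 2 / D - v' ^ 2 / D'| ≤ 2 / ε * |v - v'| + 1 / ε ^ 2 * |D - D'| := by
  have key : ∀ v D : ℝ, 0 ≤ v → ε * v ≤ D →
      v = v / D * D ∧ 0 ≤ v / D ∧ v / D ≤ 1 / ε ∧ v ^ 2 / D = v * (v / D) := by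
    intro v D hv hvD
    have hD : 0 ≤ D := (mul_nonneg hε.le hv).trans hvD
    refine ⟨?_, div_nonneg hv hD, ?_, by ring⟩
    · rcases eq_or_lt_of_le hD with h | h
      · have : v = 0 := by
          rw [← h] at hvD
          exact le_antisymm (nonpos_of_mul_nonpos_right hvD hε) hv
        simp [this]
      · field_simp
    · rcases eq_or_lt_of_le hD with h | h
      · rw [← h, div_zero]; positivity
      · rw [div_le_div_iff₀ h hε]; linarith
  obtain ⟨h1, h2, h3, h4⟩ := key v D hv hvD
  obtain ⟨h1', h2', h3', h4'⟩ := key v' D' hv' hvD'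
  set x := v / D
  set x' := v' / D'
  have hid : v ^ 2 / D - v' ^ 2 / D' = (v - v') * (x + x') - x * x' * (D - D') := by
    have e1 : x * x' * (D - D') = x' * v - x * v' := by
      calc _ = x' * (x * D) - x * (x' * D') := by ring
        _ = _ := by rw [← h1, ← h1']
    rw [e1, h4, h4']; ring
  rw [hid]
  refine (abs_sub _ _).trans ?_
  rw [abs_mul, abs_mul, abs_of_nonneg (add_nonneg h2 h2'), abs_of_nonneg (mul_nonneg h2 h2')]
  have e2 : x + x' ≤ 2 / ε := by
    have : 2 / ε = 1 / ε + 1 / ε := by ring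
    linarith
  have e3 : x * x' ≤ 1 / ε ^ 2 := by
    calc x * x' ≤ 1 / ε * (1 / ε) := mul_le_mul h3 h3' h2' (by positivity)
      _ = _ := by ring
  rw [mul_comm]
  exact add_le_add (mul_le_mul_of_nonneg_right e2 (abs_nonneg _))
    (mul_le_mul_of_nonneg_right e3 (abs_nonneg _))

theorem sq_div_le {ε v D : ℝ} (hε : 0 < ε) (hv : 0 ≤ v) (hvD : ε * v ≤ D) :
    v ^ 2 / D ≤ v / ε := by
  rcases eq_or_lt_of_le ((mul_nonneg hε.le hv).trans hvD) with h | h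
  · rw [← h, div_zero]; positivity
  · rw [div_le_div_iff₀ h hε]
    nlinarith

theorem integrable_sq_div_mul {V D κ : Torus → ℝ} {ε : ℝ} (hε : 0 < ε)
    (hV : Continuous V) (hD : Continuous D) (hκ : Continuous κ) (hV0 : ∀ t, 0 ≤ V t)
    (hVD : ∀ t, ε * V t ≤ D t) : Integrable (fun t => V t ^ 2 / D t * κ t) torusMeasure := by
  refine Integrable.mono' (g := fun t => V t / ε * |κ t|)
    (Continuous.integrable_torus (by fun_prop)) ?_ (Eventually.of_forall fun t => ?_)
  · exact (((hV.measurable.pow_const 2).div hD.measurable).mul hκ.measurable).aestronglyMeasurable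
  · have h1 : 0 ≤ V t ^ 2 / D t :=
      div_nonneg (sq_nonneg _) ((mul_nonneg hε.le (hV0 t)).trans (hVD t))
    rw [Real.norm_eq_abs, abs_mul, abs_of_nonneg h1]
    exact mul_le_mul_of_nonneg_right (sq_div_le hε (hV0 t) (hVD t)) (abs_nonneg _)

/-- If a translation almost reverses the sign of `κ` and moves `V` and `D` little, then the integral
of `V ^ 2 / D * κ` is small. -/
theorem abs_integral_sq_div_mul_le {V D κ : Torus → ℝ} {ε K σ : ℝ} (hε : 0 < ε)
    (hV : Continuous V) (hD : Continuous D) (hκ : Continuous κ) (hV0 : ∀ t, 0 ≤ V t)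
    (hVD : ∀ t, ε * V t ≤ D t) (hK : ∀ t, |κ t| ≤ K) (s : Torus)
    (hσ : ∀ t, |κ (t + s) + κ t| ≤ σ) :
    |∫ t, V t ^ 2 / D t * κ t ∂torusMeasure| ≤
      K * (2 / ε * ∫ t, |V (t + s) - V t| ∂torusMeasure
        + 1 / ε ^ 2 * ∫ t, |D (t + s) - D t| ∂torusMeasure)
      + σ / ε * ∫ t, V t ∂torusMeasure := by
  set F : Torus → ℝ := fun t => V t ^ 2 / D t * κ t with hF
  have hFi : Integrable F torusMeasure := integrable_sq_div_mul hε hV hD hκ hV0 hVD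
  have hFi' : Integrable (fun t => F (t + s)) torusMeasure := hFi.comp_add_right s
  have h2 : 2 * ∫ t, F t ∂torusMeasure = ∫ t, (F (t + s) + F t) ∂torusMeasure := by
    rw [integral_add hFi' hFi, integral_torus_add F s]; ring
  have h3 : |∫ t, (F (t + s) + F t) ∂torusMeasure| ≤
      ∫ t, (K * (2 / ε * |V (t + s) - V t| + 1 / ε ^ 2 * |D (t + s) - D t|)
        + σ / ε * V t) ∂torusMeasure := by
    refine abs_integral_le_integral_abs.trans ?_
    refine integral_mono (hFi'.add hFi).abs (Continuous.integrable_torus (by fun_prop)) fun t => ?_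
    have hK0 : 0 ≤ K := (abs_nonneg _).trans (hK t)
    have e1 : F (t + s) + F t = (V (t + s) ^ 2 / D (t + s) - V t ^ 2 / D t) * κ (t + s)
        + V t ^ 2 / D t * (κ (t + s) + κ t) := by simp only [hF]; ring
    have e2 : 0 ≤ V t ^ 2 / D t :=
      div_nonneg (sq_nonneg _) ((mul_nonneg hε.le (hV0 t)).trans (hVD t))
    have e3 := abs_sq_div_sub_sq_div_le hε (hV0 (t + s)) (hVD (t + s)) (hV0 t) (hVD t)
    have e4 := sq_div_le hε (hV0 t) (hVD t)
    have e5 : 0 ≤ V t / ε := div_nonneg (hV0 t) hε.le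
    dsimp only
    rw [e1]
    refine (abs_add_le _ _).trans ?_
    rw [abs_mul, abs_mul, abs_of_nonneg e2]
    refine add_le_add ?_ ?_
    · rw [mul_comm]
      exact mul_le_mul (hK _) e3 (abs_nonneg _) hK0
    · calc _ ≤ V t / ε * σ := mul_le_mul e4 (hσ t) (abs_nonneg _) e5
        _ = _ := by ring
  have h4 : |∫ t, F t ∂torusMeasure| ≤ |∫ t, (F (t + s) + F t) ∂torusMeasure| := by
    rw [← h2, abs_mul, abs_two]
    linarith [abs_nonneg (∫ t, F t ∂torusMeasure)]
  refine h4.trans (h3.trans (le_of_eq ?_))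
  rw [integral_add (Continuous.integrable_torus (by fun_prop))
    (Continuous.integrable_torus (by fun_prop)), integral_const_mul, integral_const_mul,
    integral_add (Continuous.integrable_torus (by fun_prop))
    (Continuous.integrable_torus (by fun_prop)), integral_const_mul, integral_const_mul]

theorem abs_mul_add_mul_le {A A' B B' h : ℝ} (hA : |A| ≤ 2) (hB : |B'| ≤ 2) (hAA : |A' - A| ≤ 4 * h)
    (hBB : |B' + B| ≤ 4 * h) : |A' * B' + A * B| ≤ 16 * h := by
  have hh : 0 ≤ 4 * h := (abs_nonneg _).trans hAA
  calc |A' * B' + A * B| = |(A' - A) * B' + A * (B' + B)| := by ring_nf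
    _ ≤ |A' - A| * |B'| + |A| * |B' + B| := by
        rw [← abs_mul, ← abs_mul]; exact abs_add_le _ _
    _ ≤ 4 * h * 2 + 2 * (4 * h) := add_le_add (mul_le_mul hAA hB (abs_nonneg _) hh)
        (mul_le_mul hA hBB (abs_nonneg _) (by norm_num))
    _ = _ := by ring

theorem abs_trig_factors_le {c c' : ℝ} (hc : |c| ≤ 1) (hc' : |c'| ≤ 1) :
    |c' ^ 2 - c'| ≤ 2 ∧ |c + c ^ 2| ≤ 2 ∧ |c' ^ 3 - c'| ≤ 2 ∧ |c ^ 2| ≤ 2 := by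
  rw [abs_le] at hc hc'
  refine ⟨?_, ?_, ?_, ?_⟩ <;> rw [abs_le] <;> constructor <;> nlinarith [sq_nonneg c',
    sq_nonneg c, mul_nonneg (sq_nonneg c') (by linarith : 0 ≤ 1 - c'),
    mul_nonneg (sq_nonneg c') (by linarith : 0 ≤ 1 + c')]

theorem abs_poly_sub_le {x y h : ℝ} (hx : |x| ≤ 1) (hy : |y| ≤ 1) (hxy : |x - y| ≤ h) :
    |(x ^ 2 - x) - (y ^ 2 - y)| ≤ 4 * h ∧ |(x + x ^ 2) - (y + y ^ 2)| ≤ 4 * h ∧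
      |(x ^ 3 - x) - (y ^ 3 - y)| ≤ 4 * h ∧ |x ^ 2 - y ^ 2| ≤ 4 * h := by
  have key : ∀ q : ℝ, |q| ≤ 4 → |(x - y) * q| ≤ 4 * h := fun q hq => by
    rw [abs_mul, mul_comm 4 h]
    exact mul_le_mul hxy hq (abs_nonneg _) ((abs_nonneg _).trans hxy)
  rw [abs_le] at hx hy
  refine ⟨?_, ?_, ?_, ?_⟩
  · rw [show (x ^ 2 - x) - (y ^ 2 - y) = (x - y) * (x + y - 1) by ring]
    exact key _ (abs_le.2 ⟨by linarith, by linarith⟩)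
  · rw [show (x + x ^ 2) - (y + y ^ 2) = (x - y) * (x + y + 1) by ring]
    exact key _ (abs_le.2 ⟨by linarith, by linarith⟩)
  · rw [show (x ^ 3 - x) - (y ^ 3 - y) = (x - y) * (x ^ 2 + x * y + y ^ 2 - 1) by ring]
    exact key _ (abs_le.2 ⟨by nlinarith [sq_nonneg (x + y), sq_nonneg x, sq_nonneg y],
      by nlinarith⟩)
  · rw [show x ^ 2 - y ^ 2 = (x - y) * (x + y) by ring]
    exact key _ (abs_le.2 ⟨by linarith, by linarith⟩)

theorem abs_tcos_nsmul_add_add_le {n : ℕ} {s : Torus} {h : ℝ}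
    (hs : ‖n • s - ((Real.pi : ℝ) : Torus)‖ ≤ h) (t : Torus) :
    |tcos (n • (t + s)) + tcos (n • t)| ≤ h := by
  have h1 := abs_tcos_sub_le (n • (t + s)) (n • t + ((Real.pi : ℝ) : Torus))
  rw [tcos_add_pi, sub_neg_eq_add, nsmul_add, add_sub_add_left_eq_sub, ← nsmul_add] at h1
  exact h1.trans hs

theorem abs_tcos_nsmul_add_sub_le {n : ℕ} {s : Torus} {h : ℝ} (hs : ‖n • s‖ ≤ h) (t : Torus) :
    |tcos (n • (t + s)) - tcos (n • t)| ≤ h := by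
  have h1 := abs_tcos_sub_le (n • (t + s)) (n • t)
  rw [nsmul_add, add_sub_cancel_left, ← nsmul_add] at h1
  exact h1.trans hs

/-- `κ` is bounded, and some small translation reverses its sign up to an error of order `1 / d`. -/
def IsAlmostOdd (n : ℕ → ℕ) (d : ℝ) (r K : ℕ) (κ : Torus → ℝ) : Prop :=
  Continuous κ ∧ (∀ t, |κ t| ≤ 4) ∧
    ∃ s, IsSmallShift n d r K s ∧ ∀ t, |κ (t + s) + κ t| ≤ 16 * (2 * Real.pi / d)

theorem continuous_tcos_nsmul (n : ℕ) : Continuous fun t : Torus => tcos (n • t) :=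
  continuous_tcos.comp (continuous_const_smul n)

theorem isAlmostOdd_of_mul {n : ℕ → ℕ} {d : ℝ} {r K : ℕ} {A B : Torus → ℝ} (hA : Continuous A)
    (hB : Continuous B) (hA2 : ∀ t, |A t| ≤ 2) (hB2 : ∀ t, |B t| ≤ 2) {s : Torus}
    (hs : IsSmallShift n d r K s) (hAs : ∀ t, |A (t + s) - A t| ≤ 4 * (2 * Real.pi / d))
    (hBs : ∀ t, |B (t + s) + B t| ≤ 4 * (2 * Real.pi / d)) :
    IsAlmostOdd n d r K fun t => A t * B t := by
  refine ⟨hA.mul hB, fun t => ?_, s, hs, fun t => ?_⟩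
  · rw [abs_mul]
    calc |A t| * |B t| ≤ 2 * 2 := mul_le_mul (hA2 t) (hB2 t) (abs_nonneg _) (by norm_num)
      _ = 4 := by norm_num
  · exact abs_mul_add_mul_le (hA2 t) (hB2 (t + s)) (hAs t) (hBs t)

theorem isAlmostOdd_factors {n : ℕ → ℕ} {d : ℝ} (hn : Lacunary n d) (hd : 2 ≤ d) (r K : ℕ) :
    IsAlmostOdd n d r K (fun t => (tcos (n (r + 2) • t) ^ 2 - tcos (n (r + 2) • t)) *
      tcos (n (r + 1) • t)) ∧
    IsAlmostOdd n d r K (fun t => (tcos (n (r + 1) • t) + tcos (n (r + 1) • t) ^ 2) *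
      (tcos (n (r + 2) • t) ^ 3 - tcos (n (r + 2) • t))) ∧
    IsAlmostOdd n d r K (fun t => tcos (n (r + 1) • t) ^ 2 * tcos (n (r + 2) • t)) := by
  have hd0 : 0 < d := by linarith
  have hh : 0 ≤ 2 * Real.pi / d := by positivity
  have hc := fun j => continuous_tcos_nsmul (n j)
  have hb : ∀ j (t : Torus), |tcos (n j • t)| ≤ 1 := fun j t => abs_tcos_le_one _
  have hle : ∀ x : ℝ, |x| ≤ 2 * Real.pi / d → |x| ≤ 4 * (2 * Real.pi / d) := fun x hx => by
    linarith
  have hb2 : ∀ j (t : Torus), |tcos (n j • t)| ≤ 2 := fun j t => (hb j t).trans (by norm_num)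
  have hc1 := hc (r + 1)
  have hc2 := hc (r + 2)
  obtain ⟨s, hs1, hs2, hs3⟩ := hn.exists_almost_half_period hd (by omega : 1 ≤ r + 1) (K + r + 2)
  have hsmall : IsSmallShift n d r K s :=
    ⟨hs1, fun j hj hj' => hs3 j (by omega) (by omega) (by omega)⟩
  obtain ⟨u, hu1, hu2, hu3⟩ := hn.exists_almost_half_period hd (by omega : 1 ≤ r + 2) (K + r + 2)
  have husmall : IsSmallShift n d r K u := by
    refine ⟨hu1.trans ?_, fun j hj hj' => hu3 j (by omega) (by omega) (by omega)⟩
    have h1 := hn.2 (r + 1) (by omega)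
    have h2 : (0 : ℝ) < n (r + 1) := by exact_mod_cast hn.1 (r + 1) (by omega)
    exact div_le_div_of_nonneg_left (by positivity) h2
      ((le_mul_of_one_le_left h2.le (by linarith)).trans h1)
  have hs4 := hs3 (r + 2) (by omega) (by omega) (by omega)
  have hu4 := hu3 (r + 1) (by omega) (by omega) (by omega)
  refine ⟨?_, ?_, ?_⟩
  · refine isAlmostOdd_of_mul (by fun_prop) hc1
      (fun t => (abs_trig_factors_le (hb (r + 1) t) (hb (r + 2) t)).1) (hb2 (r + 1)) hsmall
      (fun t => ?_) fun t => hle _ (abs_tcos_nsmul_add_add_le hs2 t)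
    exact (abs_poly_sub_le (hb _ _) (hb _ _) (abs_tcos_nsmul_add_sub_le hs4 t)).1
  · refine isAlmostOdd_of_mul (by fun_prop) (by fun_prop)
      (fun t => (abs_trig_factors_le (hb (r + 1) t) (hb (r + 2) t)).2.1)
      (fun t => (abs_trig_factors_le (hb (r + 1) t) (hb (r + 2) t)).2.2.1) husmall
      (fun t => ?_) fun t => ?_
    · exact (abs_poly_sub_le (hb _ _) (hb _ _) (abs_tcos_nsmul_add_sub_le hu4 t)).2.1
    · have h1 := abs_tcos_nsmul_add_add_le hu2 t
      have h2 := (abs_poly_sub_le (hb (r + 2) (t + u)) (y := -tcos (n (r + 2) • t))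
        (h := 2 * Real.pi / d) (by rw [abs_neg]; exact hb _ _) (by rwa [sub_neg_eq_add])).2.2.1
      refine le_trans (le_of_eq ?_) h2
      congr 1; ring
  · refine isAlmostOdd_of_mul (by fun_prop) hc2
      (fun t => (abs_trig_factors_le (hb (r + 1) t) (hb (r + 2) t)).2.2.2) (hb2 (r + 2)) husmall
      (fun t => ?_) fun t => hle _ (abs_tcos_nsmul_add_add_le hu2 t)
    exact (abs_poly_sub_le (hb _ _) (hb _ _) (abs_tcos_nsmul_add_sub_le hu4 t)).2.2.2

/-- The functions `V_l ^ 2 / D` are almost orthogonal to the almost odd functions. -/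
theorem exists_abs_integral_odd_le {p ε : ℝ} (hp : 1 ≤ p) (hε : 0 < ε) :
    ∃ C : ℝ, 0 < C ∧ ∀ᶠ d in atTop, ∀ n, Lacunary n d → ∀ N r l, r ≤ N → l ≤ N →
      ∀ κ, IsAlmostOdd n d r N κ →
      |∫ t, comparison p n r l t ^ 2 / denom p ε n N r t * κ t ∂torusMeasure|
        ≤ C / d * ∫ t, rieszProduct n r t ^ p ∂torusMeasure := by
  obtain ⟨ρ, C, hρ2, hρ1, hC, hev⟩ := exists_comparison_bounds hp
  have hinv : 0 < (1 - ρ)⁻¹ := inv_pos.2 (by linarith)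
  refine ⟨4 * (2 / ε * C + 1 / ε ^ 2 * (C + ε * (C * (2 * (1 - ρ)⁻¹)))) + 32 * Real.pi / ε * C,
    by positivity, ?_⟩
  filter_upwards [hev, eventually_gt_atTop 0] with d hd hd0 n hn N r l hr hl κ hκ
  obtain ⟨hκc, hκ4, s, hs, hκs⟩ := hκ
  set I := ∫ t, rieszProduct n r t ^ p ∂torusMeasure with hI
  have hI0 : 0 ≤ I := integral_rieszProduct_rpow_nonneg n r p
  have hρ0 : 0 ≤ ρ := by linarith
  have hpow1 : ∀ m, ρ ^ m ≤ 1 := fun m => pow_le_one₀ hρ0 hρ1.le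
  have hcV := fun l => continuous_comparison hp n r l
  have h1 : ∀ l ≤ N, ∫ t, |comparison p n r l (t + s) - comparison p n r l t| ∂torusMeasure
      ≤ C / d * I := by
    intro l hl
    refine ((hd n hn r l).2 N hl s hs).trans ?_
    have := hpow1 ((r + 1 - l) + (l - (r + 1)))
    calc _ ≤ C / d * 1 * I := by gcongr
      _ = _ := by ring
  have h2 : ∫ t, comparison p n r l t ∂torusMeasure ≤ C * I := by
    refine (hd n hn r l).1.trans ?_
    have := hpow1 ((r + 1 - l) + (l - (r + 1)))
    calc _ ≤ C * 1 * I := by gcongr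
      _ = _ := by ring
  have h3 : ∫ t, |denom p ε n N r (t + s) - denom p ε n N r t| ∂torusMeasure
      ≤ C / d * I + ε * (C / d * (2 * (1 - ρ)⁻¹) * I) := by
    calc _ ≤ ∫ t, (|comparison p n r r (t + s) - comparison p n r r t|
          + ε * ∑ l ∈ Finset.range (N + 1),
            |comparison p n r l (t + s) - comparison p n r l t|) ∂torusMeasure := by
          have := continuous_denom hp ε n N r
          refine integral_torus_mono (by fun_prop) (by fun_prop) fun t => ?_
          rw [comparison_self, denom, denom]
          have e1 : ∀ a b x y : ℝ, a + ε * x - (b + ε * y) = (a - b) + ε * (x - y) :=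
            fun _ _ _ _ => by ring
          rw [e1, ← Finset.sum_sub_distrib]
          refine (abs_add_le _ _).trans ?_
          rw [abs_mul, abs_of_pos hε]
          gcongr
          exact Finset.abs_sum_le_sum_abs _ _
      _ = (∫ t, |comparison p n r r (t + s) - comparison p n r r t| ∂torusMeasure)
          + ε * ∑ l ∈ Finset.range (N + 1),
            ∫ t, |comparison p n r l (t + s) - comparison p n r l t| ∂torusMeasure := by
          rw [integral_add (Continuous.integrable_torus (by fun_prop))
            (Continuous.integrable_torus (by fun_prop)), integral_const_mul,
            integral_finsetSum _ fun l _ => Continuous.integrable_torus (by fun_prop)]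
      _ ≤ C / d * I + ε * ∑ l ∈ Finset.range (N + 1),
            C / d * ρ ^ ((r + 1 - l) + (l - (r + 1))) * I := by
          gcongr with l hl
          · exact h1 r hr
          · exact (hd n hn r l).2 N (Nat.lt_succ_iff.1 (Finset.mem_range.1 hl)) s hs
      _ = C / d * I + ε * (C / d * (∑ l ∈ Finset.range (N + 1),
            ρ ^ ((r + 1 - l) + (l - (r + 1)))) * I) := by
          rw [Finset.mul_sum (a := C / d), Finset.sum_mul]
      _ ≤ _ := by
          gcongr
          exact sum_pow_dist_le hρ0 hρ1 _ _
  refine (abs_integral_sq_div_mul_le hε (hcV l) (continuous_denom hp ε n N r) hκc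
    (comparison_nonneg p n r l) (mul_comparison_le_denom hε.le n r hl) hκ4 s hκs).trans ?_
  calc _ ≤ 4 * (2 / ε * (C / d * I) + 1 / ε ^ 2 * (C / d * I
          + ε * (C / d * (2 * (1 - ρ)⁻¹) * I))) + 16 * (2 * Real.pi / d) / ε * (C * I) := by
        have := h1 l hl
        gcongr
    _ = _ := by ring

theorem integral_rpow_mul_tcos_sq_ge {n : ℕ → ℕ} {p δ d : ℝ} (hp : 1 ≤ p) (hd : GoodRatio p δ d)
    (hδ : δ ≤ 1 / 64) (hn : Lacunary n d) (r : ℕ) :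
    3 / 16 * ∫ t, rieszProduct n r t ^ p ∂torusMeasure
      ≤ ∫ t, rieszProduct n r t ^ p * (tcos (n (r + 1) • t) ^ 2 * tcos (n (r + 2) • t) ^ 2)
          ∂torusMeasure := by
  set φ : ℕ → Torus → ℝ := fun j x => if j ≤ r then onePlusCos x ^ p else tcos x ^ 2 with hφ
  have hle : ∀ j, j ≤ r → φ j = fun x => onePlusCos x ^ p := fun j hj => by ext; simp [hφ, hj]
  have hgt : ∀ j, r < j → φ j = fun x => tcos x ^ 2 := fun j hj => by
    ext; simp [hφ, hj.not_ge]
  have hadm : ∀ j, PowAdmissible p (φ j) := fun j => by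
    rcases le_or_gt j r with h | h
    · rw [hle j h]; exact powAdmissible_rpow (by linarith) le_rfl
    · rw [hgt j h]; exact powAdmissible_tcos_sq hp
  have hprod : ∀ t, lacProd n φ r t = rieszProduct n r t ^ p := fun t => by
    rw [rieszProduct_eq_prod, ← Real.finsetProd_rpow _ _ fun _ _ => onePlusCos_nonneg _]
    exact Finset.prod_congr rfl fun j hj => by rw [hle j (Finset.mem_Icc.1 hj).2]
  have h := pow_le_integral_lacProd (one_le_two_rpow hp) (by positivity) (by norm_num) hd.large hn
    hadm hd.error (by linarith : δ ≤ 1 / 2) (by omega : r ≤ r + 2)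
    (fun j _ _ => (hadm j).mean)
  simp only [lacProd_succ, hprod, hgt (r + 1) (by omega), hgt (r + 1 + 1) (by omega),
    mul_assoc] at h
  refine le_trans ?_ h
  have hI := integral_rieszProduct_rpow_nonneg n r p
  gcongr
  rw [Nat.add_sub_cancel_left]
  nlinarith

/-! ### The test functions -/

theorem comparison_sq_of_le {p : ℝ} (hp : 1 ≤ p) (n : ℕ → ℕ) {r l : ℕ} (h : l ≤ r) (t : Torus) :
    comparison p n r l t ^ 2
      = rieszProduct n r t ^ (p - 1) * rieszProduct n r t ^ p * rieszProduct n l t := by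
  rw [comparison_of_le h, ← rieszProduct_mul_rieszTail n h t]
  have hR := rieszProduct_nonneg n l t
  have hT := rieszTail_nonneg n l r t
  set R := rieszProduct n l t
  set T := rieszTail n l r t
  have e1 : T ^ (p - 1) * T ^ p = T ^ (p - 1 / 2) * T ^ (p - 1 / 2) := by
    rw [← Real.rpow_add_of_nonneg hT (by linarith) (by linarith),
      ← Real.rpow_add_of_nonneg hT (by linarith) (by linarith)]
    congr 1; ring
  rw [Real.mul_rpow hR hT, Real.mul_rpow hR hT]
  symm
  calc _ = (R ^ (p - 1) * R) * R ^ p * (T ^ (p - 1) * T ^ p) := by ring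
    _ = _ := by rw [rpow_sub_one_mul_self hp hR, e1]; ring

theorem comparison_sq_of_gt {p : ℝ} (hp : 1 ≤ p) (n : ℕ → ℕ) {r l : ℕ} (h : r < l) (t : Torus) :
    comparison p n r l t ^ 2 = rieszProduct n r t ^ (p - 1) * rieszProduct n r t ^ p
      * (rieszProduct n r t * rieszTail n (r + 2) l t) := by
  rw [comparison_of_gt h]
  dsimp only
  have hR := rieszProduct_nonneg n r t
  have hT := rieszTail_nonneg n (r + 2) l t
  rw [← Real.sqrt_eq_rpow, mul_pow, Real.sq_sqrt hT, ← rpow_sub_one_mul_self hp hR]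
  ring

/-- The test function that isolates the term of index `r + 1`: the two trigonometric factors are
orthogonal to the Riesz products of lower and of higher index respectively, and the quotient
localizes to the set where `R_r` is nearly the largest of all Riesz products. -/
noncomputable def testFun (p ε : ℝ) (n : ℕ → ℕ) (N r : ℕ) (t : Torus) : ℝ :=
  rieszProduct n r t ^ (p - 1) * (rieszProduct n r t ^ p / denom p ε n N r t) *
    ((tcos (n (r + 2) • t) ^ 2 - tcos (n (r + 2) • t)) * tcos (n (r + 1) • t))

theorem testFun_mul_of_le {p : ℝ} (hp : 1 ≤ p) (ε : ℝ) (n : ℕ → ℕ) (N : ℕ) {r l : ℕ} (h : l ≤ r)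
    (t : Torus) :
    testFun p ε n N r t * rieszProduct n l t = comparison p n r l t ^ 2 / denom p ε n N r t *
      ((tcos (n (r + 2) • t) ^ 2 - tcos (n (r + 2) • t)) * tcos (n (r + 1) • t)) := by
  rw [testFun, comparison_sq_of_le hp n h]; ring

theorem testFun_mul_of_gt {p : ℝ} (hp : 1 ≤ p) (ε : ℝ) (n : ℕ → ℕ) (N : ℕ) {r l : ℕ}
    (h : r + 2 ≤ l) (t : Torus) :
    testFun p ε n N r t * rieszProduct n l t = comparison p n r l t ^ 2 / denom p ε n N r t *
      ((tcos (n (r + 1) • t) + tcos (n (r + 1) • t) ^ 2) *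
        (tcos (n (r + 2) • t) ^ 3 - tcos (n (r + 2) • t))) := by
  rw [testFun, comparison_sq_of_gt hp n (by omega), ← rieszProduct_mul_rieszTail n h t,
    rieszProduct_succ, rieszProduct_succ, onePlusCos, onePlusCos]
  ring

theorem testFun_mul_succ {p : ℝ} (hp : 1 ≤ p) (ε : ℝ) (n : ℕ → ℕ) (N r : ℕ) (t : Torus) :
    testFun p ε n N r t * rieszProduct n (r + 1) t
      = comparison p n r r t ^ 2 / denom p ε n N r t *
          (tcos (n (r + 1) • t) ^ 2 * tcos (n (r + 2) • t) ^ 2)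
        + comparison p n r r t ^ 2 / denom p ε n N r t *
          ((tcos (n (r + 2) • t) ^ 2 - tcos (n (r + 2) • t)) * tcos (n (r + 1) • t))
        - comparison p n r r t ^ 2 / denom p ε n N r t *
          (tcos (n (r + 1) • t) ^ 2 * tcos (n (r + 2) • t)) := by
  have h := testFun_mul_of_le hp ε n N (le_refl r) t
  rw [rieszProduct_succ, ← mul_assoc, h, onePlusCos]
  ring

/-- The weight `R_r ^ p / D` of the test function. -/
noncomputable def locWeight (p ε : ℝ) (n : ℕ → ℕ) (N r : ℕ) (t : Torus) : ℝ :=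
  rieszProduct n r t ^ p / denom p ε n N r t

theorem locWeight_nonneg {p ε : ℝ} (hε : 0 ≤ ε) (n : ℕ → ℕ) (N r : ℕ) (t : Torus) :
    0 ≤ locWeight p ε n N r t :=
  div_nonneg (Real.rpow_nonneg (rieszProduct_nonneg n r t) p) (denom_nonneg hε n N r t)

theorem locWeight_le_one {p ε : ℝ} (hε : 0 ≤ ε) (n : ℕ → ℕ) (N r : ℕ) (t : Torus) :
    locWeight p ε n N r t ≤ 1 :=
  div_le_one_of_le₀ (rpow_le_denom hε n N r t) (denom_nonneg hε n N r t)

theorem measurable_locWeight {p : ℝ} (hp : 1 ≤ p) (ε : ℝ) (n : ℕ → ℕ) (N r : ℕ) :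
    Measurable (locWeight p ε n N r) :=
  (continuous_rieszProduct_rpow n r (by linarith)).measurable.div
    (continuous_denom hp ε n N r).measurable

/-- A lower bound for the denominator is an upper bound for the weight; where the denominator
vanishes, so does the weight. -/
theorem locWeight_mul_le {p ε : ℝ} (hε : 0 ≤ ε) (n : ℕ → ℕ) (N r : ℕ) (t : Torus) {x y : ℝ}
    (hy : 0 ≤ y) (h : rieszProduct n r t ^ p * x ≤ y * denom p ε n N r t) :
    locWeight p ε n N r t * x ≤ y := by
  rcases eq_or_lt_of_le (denom_nonneg (p := p) hε n N r t) with h0 | h0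
  · rw [locWeight, ← h0, div_zero, zero_mul]; exact hy
  · rw [locWeight, div_mul_eq_mul_div, div_le_iff₀ h0]; exact h

theorem abs_testFun_le {p ε : ℝ} (hε : 0 ≤ ε) (n : ℕ → ℕ) (N r : ℕ) (t : Torus) :
    |testFun p ε n N r t| ≤ 2 * (rieszProduct n r t ^ (p - 1) * locWeight p ε n N r t) := by
  have h1 := (abs_trig_factors_le (abs_tcos_le_one (n (r + 1) • t))
    (abs_tcos_le_one (n (r + 2) • t))).1
  have h2 := abs_tcos_le_one (n (r + 1) • t)
  have h3 := mul_nonneg (Real.rpow_nonneg (rieszProduct_nonneg n r t) (p - 1))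
    (locWeight_nonneg (p := p) hε n N r t)
  have h4 : |(tcos (n (r + 2) • t) ^ 2 - tcos (n (r + 2) • t)) * tcos (n (r + 1) • t)| ≤ 2 := by
    rw [abs_mul]
    nlinarith [abs_nonneg (tcos (n (r + 2) • t) ^ 2 - tcos (n (r + 2) • t))]
  rw [testFun, abs_mul, ← locWeight, abs_of_nonneg h3]
  nlinarith

theorem integrable_testFun_mul {p ε : ℝ} (hp : 1 ≤ p) (hε : 0 ≤ ε) (n : ℕ → ℕ) (N r : ℕ)
    {F : Torus → ℝ} (hF : Continuous F) :
    Integrable (fun t => testFun p ε n N r t * F t) torusMeasure := by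
  have hR := continuous_rieszProduct_rpow n r (by linarith : 0 ≤ p - 1)
  have hc1 := continuous_tcos_nsmul (n (r + 1))
  have hc2 := continuous_tcos_nsmul (n (r + 2))
  refine Integrable.mono' (g := fun t => 2 * (rieszProduct n r t ^ (p - 1) * 1) * |F t|)
    (Continuous.integrable_torus (by fun_prop)) ?_ (Eventually.of_forall fun t => ?_)
  · refine Measurable.aestronglyMeasurable (Measurable.mul ?_ hF.measurable)
    exact (hR.measurable.mul (measurable_locWeight hp ε n N r)).mul
      (Continuous.measurable (by fun_prop))
  · rw [Real.norm_eq_abs, abs_mul]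
    have h1 := abs_testFun_le (p := p) hε n N r t
    have h2 := locWeight_le_one (p := p) hε n N r t
    have h3 := Real.rpow_nonneg (rieszProduct_nonneg n r t) (p - 1)
    refine mul_le_mul_of_nonneg_right (h1.trans ?_) (abs_nonneg _)
    gcongr

/-- Pointwise, the weights overlap boundedly: `R_r` can be nearly the largest of the Riesz products
for boundedly many `r` only. -/
theorem sum_locWeight_le {p ε : ℝ} (hp : 1 ≤ p) (hε : 0 < ε) (n : ℕ → ℕ) (N : ℕ) (t : Torus) :
    ∑ r ∈ Finset.range N, locWeight p ε n N r t ≤ 2 / ε := by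
  have hsq : ∀ r l, √(rieszProduct n l t) * rieszProduct n r t ^ p
      ≤ 2 * √(rieszProduct n r t) * comparison p n r l t := by
    intro r l
    have hRr := rieszProduct_nonneg n r t
    have hRl := rieszProduct_nonneg n l t
    have hb := comparison_nonneg p n r l t
    have hRp := Real.rpow_nonneg hRr p
    have hRp1 := Real.rpow_nonneg hRr (p - 1)
    have h1 := onePlusCos_nonneg (n (r + 1) • t)
    have h2 := onePlusCos_nonneg (n (r + 2) • t)
    have h1' := onePlusCos_le_two (n (r + 1) • t)
    have h2' := onePlusCos_le_two (n (r + 2) • t)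
    have key : rieszProduct n r t ^ (p - 1) * rieszProduct n r t ^ p * rieszProduct n l t
        ≤ 4 * comparison p n r l t ^ 2 := by
      rcases le_or_gt l r with h | h
      · rw [comparison_sq_of_le hp n h]
        nlinarith [mul_nonneg (mul_nonneg hRp1 hRp) hRl]
      · rw [comparison_sq_of_gt hp n h]
        have hT := rieszTail_nonneg n (r + 2) l t
        have h3 : rieszProduct n l t ≤ 4 * (rieszProduct n r t * rieszTail n (r + 2) l t) := by
          rcases eq_or_lt_of_le (Nat.succ_le_of_lt h) with rfl | h4
          · rw [Nat.succ_eq_add_one, rieszProduct_succ, rieszTail_of_le n (by omega)]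
            nlinarith
          · rw [← rieszProduct_mul_rieszTail n (show r + 2 ≤ l from h4) t, rieszProduct_succ,
              rieszProduct_succ]
            have h5 : onePlusCos (n (r + 1) • t) * onePlusCos (n (r + 2) • t) ≤ 4 := by nlinarith
            have h6 := mul_le_mul_of_nonneg_left h5 (mul_nonneg hRr hT)
            rw [show r + 1 + 1 = r + 2 from rfl]
            linarith
        have h7 := mul_le_mul_of_nonneg_left h3 (mul_nonneg hRp1 hRp)
        linarith
    refine le_of_sq_le_sq ?_ (by positivity)
    rw [mul_pow, mul_pow, mul_pow, Real.sq_sqrt hRr, Real.sq_sqrt hRl]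
    have h8 := mul_le_mul_of_nonneg_left key hRr
    have h9 := rpow_sub_one_mul_self hp hRr
    calc _ = rieszProduct n r t ^ (p - 1) * rieszProduct n r t * rieszProduct n r t ^ p
          * rieszProduct n l t := by rw [h9]; ring
      _ ≤ _ := by linarith
  set S := ∑ l ∈ Finset.range (N + 1), √(rieszProduct n l t) with hS
  have hS1 : 1 ≤ S := by
    have := Finset.single_le_sum (f := fun l => √(rieszProduct n l t))
      (fun l _ => Real.sqrt_nonneg _) (Finset.mem_range.2 (Nat.succ_pos N))
    simpa [rieszProduct_zero] using this
  have hterm : ∀ r, locWeight p ε n N r t * S ≤ 2 / ε * √(rieszProduct n r t) := by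
    intro r
    refine locWeight_mul_le hε.le n N r t (by positivity) ?_
    have h1 : rieszProduct n r t ^ p * S
        ≤ 2 * √(rieszProduct n r t) * ∑ l ∈ Finset.range (N + 1), comparison p n r l t := by
      rw [hS, Finset.mul_sum, Finset.mul_sum]
      exact Finset.sum_le_sum fun l _ => by rw [mul_comm]; exact hsq r l
    have h2 : ε * ∑ l ∈ Finset.range (N + 1), comparison p n r l t ≤ denom p ε n N r t := by
      have := Real.rpow_nonneg (rieszProduct_nonneg n r t) p
      unfold denom; linarith
    refine h1.trans ?_
    calc _ = 2 / ε * √(rieszProduct n r t)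
          * (ε * ∑ l ∈ Finset.range (N + 1), comparison p n r l t) := by field_simp
      _ ≤ _ := by gcongr
  have hsum : (∑ r ∈ Finset.range N, locWeight p ε n N r t) * S ≤ 2 / ε * S := by
    rw [Finset.sum_mul]
    refine (Finset.sum_le_sum fun r _ => hterm r).trans ?_
    rw [← Finset.mul_sum]
    gcongr
    rw [hS, Finset.sum_range_succ]
    linarith [Real.sqrt_nonneg (rieszProduct n N t)]
  exact le_of_mul_le_mul_right hsum (by linarith)

/-! ### Pairings of the test functions with the Riesz products -/

/-- For small `ε` the test function sees the term that it is meant to isolate. -/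
theorem exists_integral_testFun_mul_succ_ge {p : ℝ} (hp : 1 ≤ p) :
    ∃ ε : ℝ, 0 < ε ∧ ε ≤ 1 ∧ ∀ᶠ d in atTop, ∀ n, Lacunary n d → ∀ N r, r + 1 ≤ N →
      1 / 16 * ∫ t, rieszProduct n r t ^ p ∂torusMeasure
        ≤ ∫ t, testFun p ε n N r t * rieszProduct n (r + 1) t ∂torusMeasure := by
  obtain ⟨ρ, C, hρ2, hρ1, hC, hev⟩ := exists_comparison_bounds hp
  have hinv : 0 < (1 - ρ)⁻¹ := inv_pos.2 (by linarith)
  set Z := C * (2 * (1 - ρ)⁻¹) with hZ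
  have hZ0 : 0 < Z := by positivity
  set ε := min 1 (1 / (16 * Z)) with hε
  have hε0 : 0 < ε := lt_min one_pos (by positivity)
  have hεZ : ε * Z ≤ 1 / 16 := by
    calc ε * Z ≤ 1 / (16 * Z) * Z := by gcongr; exact min_le_right _ _
      _ = _ := by field_simp
  obtain ⟨C₁, hC1, hodd⟩ := exists_abs_integral_odd_le hp hε0
  refine ⟨ε, hε0, min_le_left _ _, ?_⟩
  filter_upwards [hev, hodd, eventually_goodRatio (p := p) (by norm_num : (0 : ℝ) < 1 / 64),
    eventually_ge_atTop (32 * C₁), eventually_ge_atTop 2] with d hd1 hd2 hd3 hd4 hd5 n hn N r hr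
  have hd0 : 0 < d := by linarith
  obtain ⟨hκ1, -, hκ3⟩ := isAlmostOdd_factors hn hd5 r N
  have ho1 := hd2 n hn N r r (by omega) (by omega) _ hκ1
  have ho3 := hd2 n hn N r r (by omega) (by omega) _ hκ3
  set I := ∫ t, rieszProduct n r t ^ p ∂torusMeasure with hI
  have hI0 : 0 ≤ I := integral_rieszProduct_rpow_nonneg n r p
  have hCd : C₁ / d * I ≤ 1 / 32 * I := by
    refine mul_le_mul_of_nonneg_right ?_ hI0
    rw [div_le_div_iff₀ hd0 (by norm_num)]; linarith
  have hcV := fun l => continuous_comparison hp n r l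
  have hcD := continuous_denom hp ε n N r
  have hV0 := fun l => comparison_nonneg p n r l
  have hc1 := continuous_tcos_nsmul (n (r + 1))
  have hc2 := continuous_tcos_nsmul (n (r + 2))
  have hVD := mul_comparison_le_denom (p := p) hε0.le n (N := N) (l := r) r (by omega)
  have hint : ∀ κ : Torus → ℝ, Continuous κ → Integrable (fun t =>
      comparison p n r r t ^ 2 / denom p ε n N r t * κ t) torusMeasure := fun κ hκ =>
    integrable_sq_div_mul hε0 (hcV r) hcD hκ (hV0 r) hVD
  have hmain : 1 / 8 * I ≤ ∫ t, comparison p n r r t ^ 2 / denom p ε n N r t *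
      (tcos (n (r + 1) • t) ^ 2 * tcos (n (r + 2) • t) ^ 2) ∂torusMeasure := by
    have hU := continuous_rieszProduct_rpow n r (by linarith : 0 ≤ p)
    have h1 : ∫ t, (rieszProduct n r t ^ p * (tcos (n (r + 1) • t) ^ 2 * tcos (n (r + 2) • t) ^ 2)
        - ε * ∑ l ∈ Finset.range (N + 1), comparison p n r l t) ∂torusMeasure
        ≤ ∫ t, comparison p n r r t ^ 2 / denom p ε n N r t *
          (tcos (n (r + 1) • t) ^ 2 * tcos (n (r + 2) • t) ^ 2) ∂torusMeasure := by
      refine integral_mono (Continuous.integrable_torus (by fun_prop)) (hint _ (by fun_prop))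
        fun t => ?_
      have hx0 : 0 ≤ tcos (n (r + 1) • t) ^ 2 * tcos (n (r + 2) • t) ^ 2 := by positivity
      have hx1 : tcos (n (r + 1) • t) ^ 2 * tcos (n (r + 2) • t) ^ 2 ≤ 1 :=
        mul_le_one₀ ((sq_le_one_iff_abs_le_one _).2 (abs_tcos_le_one _)) (sq_nonneg _)
          ((sq_le_one_iff_abs_le_one _).2 (abs_tcos_le_one _))
      have hE : 0 ≤ ε * ∑ l ∈ Finset.range (N + 1), comparison p n r l t :=
        mul_nonneg hε0.le (Finset.sum_nonneg fun l _ => hV0 l t)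
      have hU0 := Real.rpow_nonneg (rieszProduct_nonneg n r t) p
      have hD0 := denom_nonneg (p := p) hε0.le n N r t
      dsimp only
      rw [comparison_self]
      set U := rieszProduct n r t ^ p
      have hDd : denom p ε n N r t
        = U + ε * ∑ l ∈ Finset.range (N + 1), comparison p n r l t := rfl
      set X := ε * ∑ l ∈ Finset.range (N + 1), comparison p n r l t
      have h2 : U - X ≤ U ^ 2 / denom p ε n N r t := by
        rcases eq_or_lt_of_le hD0 with h | h
        · rw [← h, div_zero]; linarith
        · rw [le_div_iff₀ h, hDd]; nlinarith [sq_nonneg X]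
      have h3 := mul_le_mul_of_nonneg_right h2 hx0
      nlinarith
    refine le_trans ?_ h1
    rw [integral_sub (Continuous.integrable_torus (by fun_prop))
      (Continuous.integrable_torus (by fun_prop)), integral_const_mul,
      integral_finsetSum _ fun l _ => (hcV l).integrable_torus]
    have h4 := integral_rpow_mul_tcos_sq_ge hp hd3 le_rfl hn r
    have h5 : ∑ l ∈ Finset.range (N + 1), ∫ t, comparison p n r l t ∂torusMeasure ≤ Z * I := by
      calc _ ≤ ∑ l ∈ Finset.range (N + 1), C * ρ ^ ((r + 1 - l) + (l - (r + 1))) * I :=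
            Finset.sum_le_sum fun l _ => (hd1 n hn r l).1
        _ = C * (∑ l ∈ Finset.range (N + 1), ρ ^ ((r + 1 - l) + (l - (r + 1)))) * I := by
            rw [Finset.mul_sum, Finset.sum_mul]
        _ ≤ _ := by
            rw [hZ]
            gcongr
            exact sum_pow_dist_le (by linarith) hρ1 _ _
    have h6 := mul_le_mul_of_nonneg_left h5 hε0.le
    have h7 := mul_le_mul_of_nonneg_right hεZ hI0
    linarith
  simp only [testFun_mul_succ hp]
  have hi2 := hint (fun t => tcos (n (r + 1) • t) ^ 2 * tcos (n (r + 2) • t) ^ 2) (by fun_prop)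
  rw [integral_sub, integral_add hi2 (hint _ hκ1.1)]
  rotate_left
  · exact hi2.add (hint _ hκ1.1)
  · exact hint _ hκ3.1
  rw [abs_le] at ho1 ho3
  linarith [ho1.1, ho3.2]

/-- The test function is almost orthogonal to the other Riesz products. -/
theorem exists_abs_integral_testFun_mul_le {p ε : ℝ} (hp : 1 ≤ p) (hε : 0 < ε) :
    ∃ C : ℝ, 0 < C ∧ ∀ᶠ d in atTop, ∀ n, Lacunary n d → ∀ N r l, r + 1 ≤ N → l ≤ N → l ≠ r + 1 →
      |∫ t, testFun p ε n N r t * rieszProduct n l t ∂torusMeasure|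
        ≤ C / d * ∫ t, rieszProduct n r t ^ p ∂torusMeasure := by
  obtain ⟨C, hC, hodd⟩ := exists_abs_integral_odd_le hp hε
  refine ⟨C, hC, ?_⟩
  filter_upwards [hodd, eventually_ge_atTop 2] with d hd hd2 n hn N r l hr hl hlr
  obtain ⟨hκ1, hκ2, -⟩ := isAlmostOdd_factors hn hd2 r N
  rcases le_or_gt l r with h | h
  · simp only [testFun_mul_of_le hp ε n N h]
    exact hd n hn N r l (by omega) hl _ hκ1
  · simp only [testFun_mul_of_gt hp ε n N (by omega : r + 2 ≤ l)]
    exact hd n hn N r l (by omega) hl _ hκ2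

theorem abs_integral_testFun_mul_le_of_gt {p ε : ℝ} (hp : 1 ≤ p) (hε : 0 < ε) (n : ℕ → ℕ)
    {N r l : ℕ} (h : r + 2 ≤ l) (hl : l ≤ N) :
    |∫ t, testFun p ε n N r t * rieszProduct n l t ∂torusMeasure|
      ≤ 4 / ε * ∫ t, comparison p n r l t ∂torusMeasure := by
  rw [← integral_const_mul]
  refine abs_integral_le_integral_abs.trans ?_
  refine integral_mono (integrable_testFun_mul hp hε.le n N r (continuous_rieszProduct n l)).abs
    ((continuous_comparison hp n r l).const_mul _).integrable_torus fun t => ?_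
  have h1 := sq_div_le hε (comparison_nonneg p n r l t) (mul_comparison_le_denom hε.le n r hl t)
  have h2 := div_nonneg (sq_nonneg (comparison p n r l t)) (denom_nonneg (p := p) hε.le n N r t)
  have h3 := abs_trig_factors_le (abs_tcos_le_one (n (r + 1) • t)) (abs_tcos_le_one (n (r + 2) • t))
  dsimp only
  rw [testFun_mul_of_gt hp ε n N h, abs_mul, abs_mul, abs_of_nonneg h2]
  calc _ ≤ comparison p n r l t / ε * (2 * 2) :=
        mul_le_mul h1 (mul_le_mul h3.2.1 h3.2.2.1 (abs_nonneg _) (by norm_num))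
          (by positivity) (h2.trans h1)
    _ = _ := by ring

/-- The elementary inequality behind the decay in the case of a lower index: the weight `g` is small
where the ratio `x` of the two Riesz products is. -/
theorem rpow_mul_mul_rpow_mul_le {p b c x g : ℝ} (hp : 1 ≤ p) (hb : 0 ≤ b) (hc : 0 ≤ c) (hx : 0 ≤ x)
    (hg1 : g ≤ 1) (hgx : g ≤ √x) :
    b ^ (p - 1) * c * (x ^ (p - 1) * g)
      ≤ b ^ p * x ^ (p - 1 / (2 * p)) + c ^ p * x ^ (1 / 2 : ℝ) := by
  have hθ0 : 0 < 1 / (2 * p) := by positivity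
  have hθ1 : 1 / (2 * p) ≤ 1 / 2 := by
    rw [div_le_div_iff₀ (by positivity) (by norm_num)]; linarith
  have hL : 0 ≤ b ^ p * x ^ (p - 1 / (2 * p)) := by positivity
  have hR : 0 ≤ c ^ p * x ^ (1 / 2 : ℝ) := by positivity
  have hbx : 0 ≤ b * x := by positivity
  have e0 : b ^ (p - 1) * c * (x ^ (p - 1) * g) = (b * x) ^ (p - 1) * c * g := by
    rw [Real.mul_rpow hb hx]; ring
  rw [e0]
  rcases le_or_gt 1 x with h1 | h1
  · have hx0 : 0 < x := by linarith
    have hle : (b * x) ^ (p - 1) * c * g ≤ (b * x) ^ (p - 1) * c :=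
      mul_le_of_le_one_right (by positivity) hg1
    refine hle.trans ?_
    rcases le_total (c * x ^ (1 / (2 * p))) (b * x) with h2 | h2
    · have h3 : c ≤ b * x ^ (1 - 1 / (2 * p)) := by
        rw [Real.rpow_sub hx0, Real.rpow_one, ← mul_div_assoc, le_div_iff₀ (by positivity)]
        exact h2
      have h4 : (b * x) ^ (p - 1) * c ≤ b ^ p * x ^ (p - 1 / (2 * p)) := by
        calc _ ≤ (b * x) ^ (p - 1) * (b * x ^ (1 - 1 / (2 * p))) := by gcongr
          _ = b ^ (p - 1) * b * (x ^ (p - 1) * x ^ (1 - 1 / (2 * p))) := by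
              rw [Real.mul_rpow hb hx]; ring
          _ = _ := by
              rw [rpow_sub_one_mul_self hp hb, ← Real.rpow_add hx0]
              congr 2; ring
      linarith
    · have h4 : (b * x) ^ (p - 1) * c ≤ c ^ p * x ^ (1 / 2 : ℝ) := by
        calc _ ≤ (c * x ^ (1 / (2 * p))) ^ (p - 1) * c := by gcongr
          _ = c ^ (p - 1) * c * x ^ (1 / (2 * p) * (p - 1)) := by
              rw [Real.mul_rpow hc (by positivity), ← Real.rpow_mul hx]; ring
          _ ≤ _ := by
              rw [rpow_sub_one_mul_self hp hc]
              gcongr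
              rw [mul_sub, mul_one, show 1 / (2 * p) * p = 1 / 2 by field_simp]
              linarith
      linarith
  · have hle : (b * x) ^ (p - 1) * c * g ≤ (b * x) ^ (p - 1) * c * x ^ (1 / 2 : ℝ) := by
      rw [← Real.sqrt_eq_rpow]; gcongr
    refine hle.trans ?_
    rcases le_total c (b * x) with h2 | h2
    · have h4 : (b * x) ^ (p - 1) * c * x ^ (1 / 2 : ℝ) ≤ b ^ p * x ^ (p - 1 / (2 * p)) := by
        calc _ ≤ (b * x) ^ (p - 1) * (b * x) * x ^ (1 / 2 : ℝ) := by gcongr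
          _ = b ^ p * x ^ (p + 1 / 2) := by
              rw [rpow_sub_one_mul_self hp hbx, Real.mul_rpow hb hx, mul_assoc,
                ← Real.rpow_add_of_nonneg hx (by linarith) (by norm_num)]
          _ ≤ _ := by
              gcongr ?_ * ?_
              exact Real.rpow_le_rpow_of_exponent_ge' hx h1.le (by linarith) (by linarith)
      linarith
    · have h4 : (b * x) ^ (p - 1) * c * x ^ (1 / 2 : ℝ) ≤ c ^ p * x ^ (1 / 2 : ℝ) := by
        calc _ ≤ c ^ (p - 1) * c * x ^ (1 / 2 : ℝ) := by gcongr
          _ = _ := by rw [rpow_sub_one_mul_self hp hc]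
      linarith

/-- Decay of the pairing of the test function with Riesz products of lower index. -/
theorem exists_mul_abs_integral_testFun_mul_le_of_le {p ε : ℝ} (hp : 1 ≤ p) (hε : 0 < ε)
    (hε1 : ε ≤ 1) :
    ∃ ρ : ℝ, 0 < ρ ∧ ρ < 1 ∧ ∀ᶠ d in atTop, ∀ n, Lacunary n d → ∀ N r l, r ≤ N → l ≤ r →
      ∀ b c : ℝ, 0 ≤ b → 0 ≤ c →
      b ^ (p - 1) * c * |∫ t, testFun p ε n N r t * rieszProduct n l t ∂torusMeasure|
        ≤ 2 / ε * ρ ^ (r - l) * (b ^ p * ∫ t, rieszProduct n r t ^ p ∂torusMeasure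
          + c ^ p * ∫ t, rieszProduct n l t ^ p ∂torusMeasure) := by
  have hθ1 : 1 / (2 * p) ≤ 1 / 2 := by
    rw [div_le_div_iff₀ (by positivity) (by norm_num)]; linarith
  obtain ⟨ρ, hρ0, hρ1, hev⟩ := exists_integral_lower_power_le hp
    (by linarith : 1 / 2 ≤ p - 1 / (2 * p)) (by linarith [show 0 < 1 / (2 * p) by positivity])
  refine ⟨max ρ (63 / 64), lt_max_of_lt_left hρ0, max_lt hρ1 (by norm_num), ?_⟩
  filter_upwards [hev, eventually_goodRatio (p := p) (by norm_num : (0 : ℝ) < 1 / 64)]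
    with d hd1 hd2 n hn N r l hr hlr b c hb hc
  have hq0 : 0 ≤ p - 1 / (2 * p) := by linarith
  have hcont1 := continuous_rieszProduct_mul_rieszTail n l l r (by linarith : 0 ≤ p) hq0
  have hcont2 := continuous_rieszProduct_mul_rieszTail n l l r (by linarith : 0 ≤ p)
    (by norm_num : (0 : ℝ) ≤ 1 / 2)
  have hpt : ∀ t, b ^ (p - 1) * c * |testFun p ε n N r t * rieszProduct n l t| ≤
      2 / ε * (b ^ p * (rieszProduct n l t ^ p * rieszTail n l r t ^ (p - 1 / (2 * p)))
        + c ^ p * (rieszProduct n l t ^ p * rieszTail n l r t ^ (1 / 2 : ℝ))) := by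
    intro t
    have hR := rieszProduct_nonneg n l t
    have hT := rieszTail_nonneg n l r t
    have hg0 := locWeight_nonneg (p := p) hε.le n N r t
    have hg1 := locWeight_le_one (p := p) hε.le n N r t
    have hgT : locWeight p ε n N r t * ε ≤ √(rieszTail n l r t) := by
      refine locWeight_mul_le hε.le n N r t (Real.sqrt_nonneg _) ?_
      have h1 : rieszProduct n r t ^ p = comparison p n r l t * √(rieszTail n l r t) := by
        rw [comparison_of_le hlr, ← rieszProduct_mul_rieszTail n hlr t, Real.mul_rpow hR hT,
          Real.sqrt_eq_rpow]
        dsimp only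
        rw [mul_assoc, ← Real.rpow_add_of_nonneg hT (by linarith) (by norm_num), sub_add_cancel]
      have h2 := mul_comparison_le_denom (p := p) hε.le n r (hlr.trans hr) t
      rw [h1]
      nlinarith [Real.sqrt_nonneg (rieszTail n l r t)]
    have h3 := rpow_mul_mul_rpow_mul_le hp hb hc hT
      (mul_le_one₀ hg1 hε.le hε1) hgT
    have h4 := abs_testFun_le (p := p) hε.le n N r t
    have hRp := Real.rpow_nonneg hR p
    calc b ^ (p - 1) * c * |testFun p ε n N r t * rieszProduct n l t|
        ≤ b ^ (p - 1) * c * (2 * (rieszProduct n r t ^ (p - 1) * locWeight p ε n N r t)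
          * rieszProduct n l t) := by
          rw [abs_mul, abs_of_nonneg hR]
          gcongr
      _ = 2 / ε * (rieszProduct n l t ^ p *
          (b ^ (p - 1) * c * (rieszTail n l r t ^ (p - 1) * (locWeight p ε n N r t * ε)))) := by
          rw [← rpow_sub_one_mul_self hp hR, ← rieszProduct_mul_rieszTail n hlr t,
            Real.mul_rpow hR hT]
          field_simp
      _ ≤ 2 / ε * (rieszProduct n l t ^ p * (b ^ p * rieszTail n l r t ^ (p - 1 / (2 * p))
          + c ^ p * rieszTail n l r t ^ (1 / 2 : ℝ))) := by gcongr
      _ = _ := by ring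
  have hint := integrable_testFun_mul hp hε.le n N r (continuous_rieszProduct n l)
  have h1 := hd1 n hn l r hlr
  have h2 := integral_rieszProduct_mul_sqrt_tail_le hp hd2 le_rfl (by norm_num) hn hlr
  have hI1 := integral_rieszProduct_rpow_nonneg n r p
  have hI2 := integral_rieszProduct_rpow_nonneg n l p
  calc _ ≤ b ^ (p - 1) * c * ∫ t, |testFun p ε n N r t * rieszProduct n l t| ∂torusMeasure := by
        gcongr; exact abs_integral_le_integral_abs
    _ = ∫ t, b ^ (p - 1) * c * |testFun p ε n N r t * rieszProduct n l t| ∂torusMeasure := by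
        rw [integral_const_mul]
    _ ≤ ∫ t, 2 / ε * (b ^ p * (rieszProduct n l t ^ p * rieszTail n l r t ^ (p - 1 / (2 * p)))
        + c ^ p * (rieszProduct n l t ^ p * rieszTail n l r t ^ (1 / 2 : ℝ))) ∂torusMeasure :=
        integral_mono (hint.abs.const_mul _) (Continuous.integrable_torus (by fun_prop)) hpt
    _ = 2 / ε * (b ^ p * ∫ t, rieszProduct n l t ^ p * rieszTail n l r t ^ (p - 1 / (2 * p))
          ∂torusMeasure
        + c ^ p * ∫ t, rieszProduct n l t ^ p * rieszTail n l r t ^ (1 / 2 : ℝ)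
          ∂torusMeasure) := by
        rw [integral_const_mul, integral_add (Continuous.integrable_torus (by fun_prop))
          (Continuous.integrable_torus (by fun_prop)), integral_const_mul, integral_const_mul]
    _ ≤ 2 / ε * (b ^ p * (max ρ (63 / 64) ^ (r - l) * ∫ t, rieszProduct n r t ^ p ∂torusMeasure)
        + c ^ p * (max ρ (63 / 64) ^ (r - l) * ∫ t, rieszProduct n l t ^ p ∂torusMeasure)) := by
        gcongr
        · refine h1.trans ?_
          gcongr
          exact le_max_left _ _
        · refine h2.trans ?_
          gcongr
          exact le_max_right _ _
    _ = _ := by ring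

theorem rpow_sub_one_mul_le_add {p b c : ℝ} (hp : 1 ≤ p) (hb : 0 ≤ b) (hc : 0 ≤ c) :
    b ^ (p - 1) * c ≤ b ^ p + c ^ p := by
  have h1 := Real.rpow_nonneg hb p
  have h2 := Real.rpow_nonneg hc p
  rcases le_total c b with h | h
  · have : b ^ (p - 1) * c ≤ b ^ (p - 1) * b := by gcongr
    rw [rpow_sub_one_mul_self hp hb] at this
    linarith
  · have : b ^ (p - 1) * c ≤ c ^ (p - 1) * c := by gcongr
    rw [rpow_sub_one_mul_self hp hc] at this
    linarith

theorem rpow_sub_one_mul_le_mul_add {p x b η : ℝ} (hp : 1 ≤ p) (hx : 0 ≤ x) (hb : 0 ≤ b)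
    (hη : 0 < η) : x ^ (p - 1) * b ≤ η * x ^ p + (η⁻¹) ^ (p - 1) * b ^ p := by
  have h1 := mul_nonneg hη.le (Real.rpow_nonneg hx p)
  have h2 := mul_nonneg (Real.rpow_nonneg (inv_pos.2 hη).le (p - 1)) (Real.rpow_nonneg hb p)
  rcases le_total b (η * x) with h | h
  · have : x ^ (p - 1) * b ≤ η * x ^ p := by
      calc _ ≤ x ^ (p - 1) * (η * x) := by gcongr
        _ = _ := by rw [← rpow_sub_one_mul_self hp hx]; ring
    linarith
  · have h3 : x ≤ η⁻¹ * b := by rwa [le_inv_mul_iff₀ hη]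
    have : x ^ (p - 1) * b ≤ (η⁻¹) ^ (p - 1) * b ^ p := by
      calc _ ≤ (η⁻¹ * b) ^ (p - 1) * b := by gcongr
        _ = _ := by
          rw [Real.mul_rpow (inv_pos.2 hη).le hb, mul_assoc, rpow_sub_one_mul_self hp hb]
    linarith

/-- Geometric decay of the pairings of the test functions with the Riesz products. -/
theorem exists_mul_abs_integral_testFun_mul_le {p ε : ℝ} (hp : 1 ≤ p) (hε : 0 < ε) (hε1 : ε ≤ 1) :
    ∃ ρ C : ℝ, 0 < ρ ∧ ρ < 1 ∧ 0 < C ∧ ∀ᶠ d in atTop, ∀ n, Lacunary n d → ∀ N r l,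
      r + 1 ≤ N → l ≤ N → l ≠ r + 1 → ∀ b c : ℝ, 0 ≤ b → 0 ≤ c →
      b ^ (p - 1) * c * |∫ t, testFun p ε n N r t * rieszProduct n l t ∂torusMeasure|
        ≤ C * ρ ^ ((r + 1 - l) + (l - (r + 1))) *
          (b ^ p * ∫ t, rieszProduct n (r + 1) t ^ p ∂torusMeasure
          + c ^ p * ∫ t, rieszProduct n l t ^ p ∂torusMeasure) := by
  obtain ⟨ρ₁, h10, h11, hev1⟩ := exists_mul_abs_integral_testFun_mul_le_of_le hp hε hε1
  obtain ⟨ρ₂, C₂, h22, h21, hC2, hev2⟩ := exists_comparison_bounds hp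
  -- the means `∫ R_k ^ p` may decrease by the factor `θ`, which is closer to `1` than `ρ₂`
  set θ := (1 + ρ₂) / 2 with hθ
  have hθ0 : 0 < θ := by linarith
  have hθ2 : 1 / 2 ≤ θ := by linarith
  set ρ := max ρ₁ (ρ₂ / θ) with hρ
  have hρ0 : 0 < ρ := lt_max_of_lt_left h10
  have hρ1 : ρ < 1 := max_lt h11 (by rw [div_lt_one hθ0]; linarith)
  have hρ20 : 0 < ρ₂ := by linarith
  have hρ2 : ρ₂ ≤ ρ := by
    refine le_trans ?_ (le_max_right _ _)
    rw [le_div_iff₀ hθ0]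
    nlinarith
  refine ⟨ρ, 4 / ε / ρ + 8 / ε * C₂, hρ0, hρ1, by positivity, ?_⟩
  filter_upwards [hev1, hev2, eventually_goodRatio (p := p) (by linarith : 0 < (1 - ρ₂) / 2),
    eventually_goodRatio (p := p) (by norm_num : (0 : ℝ) < 1 / 2)]
    with d hd1 hd2 hd3 hd4 n hn N r l hr hl hlr b c hb hc
  set Ir := ∫ t, rieszProduct n r t ^ p ∂torusMeasure with hIr
  set Ir1 := ∫ t, rieszProduct n (r + 1) t ^ p ∂torusMeasure with hIr1
  set Il := ∫ t, rieszProduct n l t ^ p ∂torusMeasure with hIl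
  have hIr0 : 0 ≤ Ir := integral_rieszProduct_rpow_nonneg n r p
  have hIr10 : 0 ≤ Ir1 := integral_rieszProduct_rpow_nonneg n (r + 1) p
  have hIl0 : 0 ≤ Il := integral_rieszProduct_rpow_nonneg n l p
  have hrr : Ir ≤ 2 * Ir1 := integral_rieszProduct_le_two_mul hp hd4 le_rfl hn r
  have hw0 : 0 ≤ b ^ p * Ir1 + c ^ p * Il := by positivity
  have hbp := Real.rpow_nonneg hb p
  have hcp := Real.rpow_nonneg hc p
  rcases le_or_gt l r with h | h
  · refine (hd1 n hn N r l (by omega) h b c hb hc).trans ?_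
    rw [show r + 1 - l + (l - (r + 1)) = (r - l) + 1 by omega]
    calc 2 / ε * ρ₁ ^ (r - l) * (b ^ p * Ir + c ^ p * Il)
        ≤ 2 / ε * ρ ^ (r - l) * (2 * (b ^ p * Ir1 + c ^ p * Il)) := by
          gcongr
          · exact le_max_left _ _
          · nlinarith [mul_nonneg hcp hIl0, mul_le_mul_of_nonneg_left hrr hbp]
      _ = 4 / ε / ρ * ρ ^ (r - l + 1) * (b ^ p * Ir1 + c ^ p * Il) := by
          rw [pow_succ]; field_simp; ring
      _ ≤ _ := by
          gcongr
          have : 0 ≤ 8 / ε * C₂ := by positivity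
          linarith
  · have h2 : r + 2 ≤ l := by omega
    have e1 := abs_integral_testFun_mul_le_of_gt hp hε n h2 hl
    have e2 := (hd2 n hn r l).1
    have e3 := pow_mul_integral_rieszProduct_le hp hd3 hn (m := 1) (by linarith)
      (one_le_integral_onePlusCos_rpow hp) (show r ≤ l by omega)
    rw [show (1 : ℝ) - (1 - ρ₂) / 2 = θ by rw [hθ]; ring] at e3
    obtain ⟨m, hm⟩ : ∃ m, l = r + 1 + m := ⟨l - (r + 1), by omega⟩
    rw [show r + 1 - l + (l - (r + 1)) = m by omega] at e2 ⊢
    rw [show l - r = m + 1 by omega] at e3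
    have e4 : ρ₂ ^ m * Ir ≤ 2 * (ρ ^ m * Il) := by
      have h5 : ρ₂ ^ m ≤ ρ ^ m * θ ^ m := by
        rw [← mul_pow]
        refine pow_le_pow_left₀ hρ20.le ?_ m
        calc ρ₂ = ρ₂ / θ * θ := by field_simp
          _ ≤ _ := by gcongr; exact le_max_right _ _
      have h6 : θ ^ m * Ir ≤ 2 * Il := by
        have : 0 ≤ θ ^ m * Ir := by positivity
        rw [pow_succ] at e3
        nlinarith
      calc ρ₂ ^ m * Ir ≤ ρ ^ m * θ ^ m * Ir := by gcongr
        _ = ρ ^ m * (θ ^ m * Ir) := by ring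
        _ ≤ ρ ^ m * (2 * Il) := by gcongr
        _ = _ := by ring
    have e5 : ρ₂ ^ m * Ir ≤ 2 * (ρ ^ m * Ir1) := by
      calc ρ₂ ^ m * Ir ≤ ρ ^ m * (2 * Ir1) := by gcongr
        _ = _ := by ring
    calc _ ≤ (b ^ p + c ^ p) * (4 / ε * (C₂ * ρ₂ ^ m * Ir)) := by
          have := rpow_sub_one_mul_le_add hp hb hc
          gcongr
          exact e1.trans (by gcongr)
      _ = 4 / ε * C₂ * (b ^ p * (ρ₂ ^ m * Ir) + c ^ p * (ρ₂ ^ m * Ir)) := by ring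
      _ ≤ 4 / ε * C₂ * (b ^ p * (2 * (ρ ^ m * Ir1)) + c ^ p * (2 * (ρ ^ m * Il))) := by gcongr
      _ = 8 / ε * C₂ * ρ ^ m * (b ^ p * Ir1 + c ^ p * Il) := by ring
      _ ≤ _ := by
          gcongr
          have : 0 ≤ 4 / ε / ρ := by positivity
          linarith

/-- The same pairings are in addition small for large `d`: the pairings of distant indices by the
decay, those of close indices by the almost orthogonality. -/
theorem exists_eventually_mul_abs_integral_testFun_mul_le {p ε : ℝ} (hp : 1 ≤ p) (hε : 0 < ε)
    (hε1 : ε ≤ 1) :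
    ∃ ρ : ℝ, 0 < ρ ∧ ρ < 1 ∧ ∀ η : ℝ, 0 < η → ∀ᶠ d in atTop, ∀ n, Lacunary n d → ∀ N r l,
      r + 1 ≤ N → l ≤ N → l ≠ r + 1 → ∀ b c : ℝ, 0 ≤ b → 0 ≤ c →
      b ^ (p - 1) * c * |∫ t, testFun p ε n N r t * rieszProduct n l t ∂torusMeasure|
        ≤ η * (ρ ^ ((r + 1 - l) + (l - (r + 1))) *
          (b ^ p * ∫ t, rieszProduct n (r + 1) t ^ p ∂torusMeasure
          + c ^ p * ∫ t, rieszProduct n l t ^ p ∂torusMeasure)) := by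
  obtain ⟨ρ₀, C₀, h00, h01, hC0, hev0⟩ := exists_mul_abs_integral_testFun_mul_le hp hε hε1
  obtain ⟨C₁, hC1, hev1⟩ := exists_abs_integral_testFun_mul_le hp hε
  set ρ := √ρ₀ with hρ
  have hρ0 : 0 < ρ := Real.sqrt_pos.2 h00
  have hρ1 : ρ < 1 := by rw [hρ, Real.sqrt_lt' one_pos]; simpa using h01
  have hρρ : ρ₀ = ρ * ρ := (Real.mul_self_sqrt h00.le).symm
  refine ⟨ρ, hρ0, hρ1, fun η hη => ?_⟩
  obtain ⟨m₀, hm0⟩ := exists_pow_lt_of_lt_one (div_pos hη hC0) hρ1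
  rw [lt_div_iff₀ hC0] at hm0
  have hM := one_le_two_rpow hp
  have hlim : ∀ᶠ d : ℝ in atTop, C₁ * (2 * (2 ^ p) ^ m₀) / d ≤ η * ρ ^ m₀ :=
    (tendsto_const_nhds.div_atTop tendsto_id).eventually_le_const (by positivity)
  filter_upwards [hev0, hev1, hlim, eventually_gt_atTop 0,
    eventually_goodRatio (p := p) (by norm_num : (0 : ℝ) < 1 / 2)]
    with d hd0 hd1 hd2 hd3 hd4 n hn N r l hr hl hlr b c hb hc
  set Ir := ∫ t, rieszProduct n r t ^ p ∂torusMeasure with hIr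
  set Ir1 := ∫ t, rieszProduct n (r + 1) t ^ p ∂torusMeasure with hIr1
  set Il := ∫ t, rieszProduct n l t ^ p ∂torusMeasure with hIl
  have hIr0 : 0 ≤ Ir := integral_rieszProduct_rpow_nonneg n r p
  have hIr10 : 0 ≤ Ir1 := integral_rieszProduct_rpow_nonneg n (r + 1) p
  have hIl0 : 0 ≤ Il := integral_rieszProduct_rpow_nonneg n l p
  have hw0 : 0 ≤ b ^ p * Ir1 + c ^ p * Il := by positivity
  obtain ⟨m, hm⟩ : ∃ m, m = (r + 1 - l) + (l - (r + 1)) := ⟨_, rfl⟩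
  rcases le_or_gt m₀ m with h | h
  · refine (hd0 n hn N r l hr hl hlr b c hb hc).trans ?_
    rw [← hm, ← mul_assoc]
    refine mul_le_mul_of_nonneg_right ?_ hw0
    have h1 : ρ ^ m ≤ ρ ^ m₀ := pow_le_pow_of_le_one hρ0.le hρ1.le h
    have h2 : 0 < ρ ^ m := by positivity
    rw [hρρ, mul_pow, ← mul_assoc]
    refine mul_le_mul_of_nonneg_right ?_ h2.le
    linarith [mul_le_mul_of_nonneg_left h1 hC0.le]
  · have hpow : ∀ j, j ≤ m₀ → ((2 : ℝ) ^ p) ^ j ≤ (2 ^ p) ^ m₀ := fun j hj =>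
      pow_le_pow_right₀ hM hj
    have hrr : Ir ≤ 2 * Ir1 := integral_rieszProduct_le_two_mul hp hd4 le_rfl hn r
    have h1 : Ir ≤ 2 * (2 ^ p) ^ m₀ * Ir1 := by
      have := one_le_pow₀ hM (n := m₀)
      nlinarith
    have h2 : Ir ≤ 2 * (2 ^ p) ^ m₀ * Il := by
      rcases le_or_gt l r with h3 | h3
      · have h4 := integral_rieszProduct_le_pow_mul n hp h3
        have h5 := mul_le_mul_of_nonneg_right (hpow (r - l) (by omega)) hIl0
        have h6 : 0 ≤ ((2 : ℝ) ^ p) ^ m₀ * Il := by positivity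
        linarith
      · have h4 := pow_mul_integral_rieszProduct_le hp hd4 hn (m := 1) (by norm_num)
          (one_le_integral_onePlusCos_rpow hp) h3.le
        have h5 : Ir ≤ 2 ^ (l - r) * Il := by
          rw [show (1 : ℝ) - 1 / 2 = 1 / 2 by norm_num, div_pow, one_pow, one_div,
            inv_mul_le_iff₀ (by positivity)] at h4
          exact h4
        have h6 : (2 : ℝ) ^ (l - r) ≤ 2 * (2 ^ p) ^ m₀ := by
          rw [show l - r = m + 1 by omega, pow_succ, mul_comm]
          have h7 : (2 : ℝ) ≤ 2 ^ p := Real.self_le_rpow_of_one_le (by norm_num) hp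
          have h8 : (2 : ℝ) ^ m ≤ (2 ^ p) ^ m := pow_le_pow_left₀ (by norm_num) h7 m
          linarith [hpow m h.le]
        exact h5.trans (mul_le_mul_of_nonneg_right h6 hIl0)
    have hbp := Real.rpow_nonneg hb p
    have hcp := Real.rpow_nonneg hc p
    have e1 := hd1 n hn N r l hr hl hlr
    calc _ ≤ (b ^ p + c ^ p) * (C₁ / d * Ir) := by
          have := rpow_sub_one_mul_le_add hp hb hc
          gcongr
      _ = C₁ / d * (b ^ p * Ir + c ^ p * Ir) := by ring
      _ ≤ C₁ / d * (b ^ p * (2 * (2 ^ p) ^ m₀ * Ir1) + c ^ p * (2 * (2 ^ p) ^ m₀ * Il)) := by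
          gcongr
      _ = C₁ * (2 * (2 ^ p) ^ m₀) / d * (b ^ p * Ir1 + c ^ p * Il) := by ring
      _ ≤ η * ρ ^ m * (b ^ p * Ir1 + c ^ p * Il) := by
          refine mul_le_mul_of_nonneg_right (hd2.trans ?_) hw0
          have := pow_le_pow_of_le_one hρ0.le hρ1.le h.le
          gcongr
      _ = _ := by rw [← hm]; ring

/-! ### The lower bound -/

section
variable {E : Type*} [NormedAddCommGroup E] [NormedSpace ℝ E]

theorem continuous_sum_rieszProduct_smul (n : ℕ → ℕ) (v : ℕ → E) (s : Finset ℕ) :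
    Continuous fun t => ∑ k ∈ s, rieszProduct n k t • v k :=
  continuous_finsetSum _ fun k _ => (continuous_rieszProduct n k).smul continuous_const

/-- Pairing the sum with a test function, and with a functional that norms the vector of index
`r + 1`. -/
theorem norm_mul_integral_testFun_mul_le {p ε : ℝ} (hp : 1 ≤ p) (hε : 0 < ε) (n : ℕ → ℕ)
    (v : ℕ → E) {N r : ℕ} (hr : r + 1 ≤ N) :
    ‖v (r + 1)‖ * ∫ t, testFun p ε n N r t * rieszProduct n (r + 1) t ∂torusMeasure
      ≤ ∫ t, 2 * (rieszProduct n r t ^ (p - 1) * locWeight p ε n N r t) *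
          ‖∑ k ∈ Finset.range (N + 1), rieszProduct n k t • v k‖ ∂torusMeasure
        + ∑ l ∈ (Finset.range (N + 1)).erase (r + 1),
          ‖v l‖ * |∫ t, testFun p ε n N r t * rieszProduct n l t ∂torusMeasure| := by
  obtain ⟨f, hf1, hf2⟩ := exists_dual_vector'' ℝ (v (r + 1))
  have hf2' : f (v (r + 1)) = ‖v (r + 1)‖ := by simpa using hf2
  have hfle : ∀ x, |f x| ≤ ‖x‖ := fun x => by
    simpa using f.le_of_opNorm_le hf1 x
  have hS := continuous_sum_rieszProduct_smul n v (Finset.range (N + 1))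
  have hint := fun k => integrable_testFun_mul hp hε.le n N r (continuous_rieszProduct n k)
  have h1 : ∫ t, testFun p ε n N r t * f (∑ k ∈ Finset.range (N + 1), rieszProduct n k t • v k)
      ∂torusMeasure = ∑ k ∈ Finset.range (N + 1),
        f (v k) * ∫ t, testFun p ε n N r t * rieszProduct n k t ∂torusMeasure := by
    simp_rw [← integral_const_mul]
    rw [← integral_finsetSum _ fun k _ => (hint k).const_mul _]
    refine integral_congr_ae (Eventually.of_forall fun t => ?_)
    simp only [map_sum, map_smul, smul_eq_mul, Finset.mul_sum]
    exact Finset.sum_congr rfl fun k _ => by ring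
  rw [← Finset.add_sum_erase _ _ (Finset.mem_range.2 (by omega : r + 1 < N + 1)), hf2'] at h1
  have h2 : ∫ t, testFun p ε n N r t * f (∑ k ∈ Finset.range (N + 1), rieszProduct n k t • v k)
      ∂torusMeasure ≤ ∫ t, 2 * (rieszProduct n r t ^ (p - 1) * locWeight p ε n N r t) *
          ‖∑ k ∈ Finset.range (N + 1), rieszProduct n k t • v k‖ ∂torusMeasure := by
    refine integral_mono (integrable_testFun_mul hp hε.le n N r (f.continuous.comp hS)) ?_
      fun t => ?_
    · refine Integrable.mono' (g := fun t => 2 * (rieszProduct n r t ^ (p - 1) * 1) *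
        ‖∑ k ∈ Finset.range (N + 1), rieszProduct n k t • v k‖) ?_ ?_
        (Eventually.of_forall fun t => ?_)
      · have := continuous_rieszProduct_rpow n r (by linarith : 0 ≤ p - 1)
        exact Continuous.integrable_torus (by fun_prop)
      · refine Measurable.aestronglyMeasurable (Measurable.mul ?_ hS.norm.measurable)
        exact ((continuous_rieszProduct_rpow n r (by linarith)).measurable.mul
          (measurable_locWeight hp ε n N r)).const_mul _
      · have e1 := Real.rpow_nonneg (rieszProduct_nonneg n r t) (p - 1)
        have e2 := locWeight_nonneg (p := p) hε.le n N r t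
        have e3 := locWeight_le_one (p := p) hε.le n N r t
        rw [Real.norm_of_nonneg (by positivity)]
        gcongr
    · have e1 := abs_testFun_le (p := p) hε.le n N r t
      refine (le_abs_self _).trans ?_
      rw [abs_mul]
      exact mul_le_mul e1 (hfle _) (abs_nonneg _) ((abs_nonneg _).trans e1)
  have h3 : -∑ l ∈ (Finset.range (N + 1)).erase (r + 1),
        f (v l) * ∫ t, testFun p ε n N r t * rieszProduct n l t ∂torusMeasure
      ≤ ∑ l ∈ (Finset.range (N + 1)).erase (r + 1),
        ‖v l‖ * |∫ t, testFun p ε n N r t * rieszProduct n l t ∂torusMeasure| := by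
    rw [← Finset.sum_neg_distrib]
    refine Finset.sum_le_sum fun l _ => ?_
    refine (neg_le_abs _).trans ?_
    rw [abs_mul]
    exact mul_le_mul_of_nonneg_right (hfle _) (abs_nonneg _)
  linarith

end

/-- The lower bound up to a small multiple of the full sum, for the terms of positive index. -/
theorem exists_sum_succ_le {p : ℝ} (hp : 1 ≤ p) :
    ∃ C : ℝ, 0 < C ∧ ∀ η : ℝ, 0 < η → ∀ᶠ d in atTop, ∀ n, Lacunary n d →
      ∀ (E : Type*) [NormedAddCommGroup E] [NormedSpace ℝ E] (v : ℕ → E) (N : ℕ),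
      ∑ r ∈ Finset.range N, ‖v (r + 1)‖ ^ p * ∫ t, rieszProduct n (r + 1) t ^ p ∂torusMeasure
        ≤ C * ∫ t, ‖∑ k ∈ Finset.range (N + 1), rieszProduct n k t • v k‖ ^ p ∂torusMeasure
          + η * ∑ k ∈ Finset.range (N + 1),
            ‖v k‖ ^ p * ∫ t, rieszProduct n k t ^ p ∂torusMeasure := by
  obtain ⟨ε, hε, hε1, hdiag⟩ := exists_integral_testFun_mul_succ_ge hp
  obtain ⟨ρ, hρ0, hρ1, hoff⟩ := exists_eventually_mul_abs_integral_testFun_mul_le hp hε hε1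
  have hinv : 0 < (1 - ρ)⁻¹ := inv_pos.2 (by linarith)
  set A : ℝ := 2 * ((1 / 64)⁻¹) ^ (p - 1) with hA
  have hA0 : 0 < A := by positivity
  set M : ℝ := 32 * 2 ^ p with hM
  have hM0 : 0 < M := by positivity
  refine ⟨M * (A * (2 / ε)), by positivity, fun η hη => ?_⟩
  set η₁ := η / (M * (4 * (1 - ρ)⁻¹)) with hη1
  have hη10 : 0 < η₁ := by positivity
  filter_upwards [hdiag, hoff η₁ hη10] with d hd1 hd2 n hn E _ _ v N
  set I : ℕ → ℝ := fun k => ∫ t, rieszProduct n k t ^ p ∂torusMeasure with hI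
  have hI0 : ∀ k, 0 ≤ I k := fun k => integral_rieszProduct_rpow_nonneg n k p
  set w : ℕ → ℝ := fun k => ‖v k‖ ^ p * I k with hw
  have hw0 : ∀ k, 0 ≤ w k := fun k => mul_nonneg (by positivity) (hI0 k)
  set S : Torus → ℝ := fun t => ‖∑ k ∈ Finset.range (N + 1), rieszProduct n k t • v k‖ with hS
  have hSc : Continuous S := (continuous_sum_rieszProduct_smul n v _).norm
  have hS0 : ∀ t, 0 ≤ S t := fun t => norm_nonneg _
  have hSp : Continuous fun t => S t ^ p := hSc.rpow_const fun _ => Or.inr (by linarith)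
  have hgS : ∀ r, Integrable (fun t => locWeight p ε n N r t * S t ^ p) torusMeasure := by
    intro r
    refine Integrable.mono' (g := fun t => S t ^ p) hSp.integrable_torus
      ((measurable_locWeight hp ε n N r).mul hSp.measurable).aestronglyMeasurable
      (Eventually.of_forall fun t => ?_)
    have e2 := locWeight_nonneg (p := p) hε.le n N r t
    have e3 := locWeight_le_one (p := p) hε.le n N r t
    have e4 := Real.rpow_nonneg (hS0 t) p
    rw [Real.norm_of_nonneg (by positivity)]
    exact mul_le_of_le_one_left e4 e3
  -- one term
  have hterm : ∀ r ∈ Finset.range N, w (r + 1) ≤ M * (A * ∫ t, locWeight p ε n N r t * S t ^ p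
      ∂torusMeasure + η₁ * ∑ l ∈ Finset.range (N + 1),
        ρ ^ ((r + 1 - l) + (l - (r + 1))) * (w (r + 1) + w l)) := by
    intro r hr
    have hr' : r + 1 ≤ N := Finset.mem_range.1 hr
    set b := ‖v (r + 1)‖ with hb
    have hb0 : 0 ≤ b := norm_nonneg _
    have hbp : 0 ≤ b ^ (p - 1) := by positivity
    have h1 := mul_le_mul_of_nonneg_left (norm_mul_integral_testFun_mul_le hp hε n v hr') hbp
    rw [mul_add, Finset.mul_sum, ← mul_assoc, rpow_sub_one_mul_self hp hb0] at h1
    have h2 := mul_le_mul_of_nonneg_left (hd1 n hn N r hr') (by positivity : 0 ≤ b ^ p)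
    have h3 : ∑ l ∈ (Finset.range (N + 1)).erase (r + 1), b ^ (p - 1) *
          (‖v l‖ * |∫ t, testFun p ε n N r t * rieszProduct n l t ∂torusMeasure|)
        ≤ η₁ * ∑ l ∈ Finset.range (N + 1),
          ρ ^ ((r + 1 - l) + (l - (r + 1))) * (w (r + 1) + w l) := by
      rw [Finset.mul_sum]
      refine (Finset.sum_le_sum fun l hl => ?_).trans
        (Finset.sum_le_sum_of_subset_of_nonneg (Finset.erase_subset _ _) fun l _ _ => ?_)
      · rw [← mul_assoc]
        obtain ⟨hl1, hl2⟩ := Finset.mem_erase.1 hl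
        exact hd2 n hn N r l hr' (Nat.lt_succ_iff.1 (Finset.mem_range.1 hl2)) hl1 b ‖v l‖ hb0
          (norm_nonneg _)
      · have := hw0 (r + 1)
        have := hw0 l
        positivity
    have h4 : b ^ (p - 1) * ∫ t, 2 * (rieszProduct n r t ^ (p - 1) * locWeight p ε n N r t) * S t
        ∂torusMeasure ≤ 1 / 32 * (b ^ p * I r)
          + A * ∫ t, locWeight p ε n N r t * S t ^ p ∂torusMeasure := by
      have hc := continuous_rieszProduct_rpow n r (by linarith : 0 ≤ p)
      rw [← integral_const_mul, hI, ← integral_const_mul, ← integral_const_mul,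
        ← integral_const_mul, ← integral_add (Continuous.integrable_torus (by fun_prop))
        ((hgS r).const_mul _)]
      refine integral_mono_of_nonneg (Eventually.of_forall fun t => ?_)
        ((Continuous.integrable_torus (by fun_prop)).add ((hgS r).const_mul _))
        (Eventually.of_forall fun t => ?_)
      · have e1 := Real.rpow_nonneg (rieszProduct_nonneg n r t) (p - 1)
        have e2 := locWeight_nonneg (p := p) hε.le n N r t
        have e3 := hS0 t
        dsimp only [Pi.zero_apply]
        positivity
      · have e0 := rieszProduct_nonneg n r t
        have e2 := locWeight_nonneg (p := p) hε.le n N r t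
        have e3 := locWeight_le_one (p := p) hε.le n N r t
        have e4 := rpow_sub_one_mul_le_mul_add hp (mul_nonneg hb0 e0) (hS0 t)
          (by norm_num : (0 : ℝ) < 1 / 64)
        rw [Real.mul_rpow hb0 e0, Real.mul_rpow hb0 e0] at e4
        have e5 := mul_le_mul_of_nonneg_left e4 e2
        have e6 : 0 ≤ b ^ p * rieszProduct n r t ^ p := by positivity
        have e7 := mul_le_of_le_one_left e6 e3
        dsimp only
        rw [hA]
        linarith
    have h5 : I (r + 1) ≤ 2 ^ p * I r := by
      simpa using integral_rieszProduct_le_pow_mul n hp (Nat.le_succ r)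
    have h6 : w (r + 1) ≤ M * (1 / 32 * (b ^ p * I r)) := by
      calc w (r + 1) ≤ b ^ p * (2 ^ p * I r) := by simp only [hw]; gcongr
        _ = _ := by rw [hM]; ring
    refine h6.trans (mul_le_mul_of_nonneg_left ?_ hM0.le)
    linarith
  have hover : ∑ r ∈ Finset.range N, ∫ t, locWeight p ε n N r t * S t ^ p ∂torusMeasure
      ≤ 2 / ε * ∫ t, S t ^ p ∂torusMeasure := by
    rw [← integral_finsetSum _ fun r _ => hgS r, ← integral_const_mul]
    refine integral_mono (integrable_finsetSum _ fun r _ => hgS r)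
      (hSp.const_mul _).integrable_torus fun t => ?_
    dsimp only
    rw [← Finset.sum_mul]
    exact mul_le_mul_of_nonneg_right (sum_locWeight_le hp hε n N t) (Real.rpow_nonneg (hS0 t) p)
  have herr : ∑ r ∈ Finset.range N, ∑ l ∈ Finset.range (N + 1),
        ρ ^ ((r + 1 - l) + (l - (r + 1))) * (w (r + 1) + w l)
      ≤ 4 * (1 - ρ)⁻¹ * ∑ k ∈ Finset.range (N + 1), w k := by
    refine le_trans ?_ (sum_sum_pow_dist_le hρ0.le hρ1 (Finset.range (N + 1)) hw0)
    rw [Finset.sum_range_succ' _ N]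
    refine le_add_of_nonneg_right (Finset.sum_nonneg fun l _ => ?_)
    have := hw0 0
    have := hw0 l
    positivity
  calc ∑ r ∈ Finset.range N, w (r + 1)
      ≤ M * (A * ∑ r ∈ Finset.range N, ∫ t, locWeight p ε n N r t * S t ^ p ∂torusMeasure
        + η₁ * ∑ r ∈ Finset.range N, ∑ l ∈ Finset.range (N + 1),
          ρ ^ ((r + 1 - l) + (l - (r + 1))) * (w (r + 1) + w l)) := by
        refine (Finset.sum_le_sum hterm).trans (le_of_eq ?_)
        rw [← Finset.mul_sum, Finset.sum_add_distrib, ← Finset.mul_sum, ← Finset.mul_sum]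
    _ ≤ M * (A * (2 / ε * ∫ t, S t ^ p ∂torusMeasure)
        + η₁ * (4 * (1 - ρ)⁻¹ * ∑ k ∈ Finset.range (N + 1), w k)) := by gcongr
    _ = _ := by
        have : 1 - ρ ≠ 0 := by linarith
        simp only [hη1, hS]
        field_simp

theorem norm_sum_rieszProduct_smul_le {E : Type*} [NormedAddCommGroup E] [NormedSpace ℝ E]
    (n : ℕ → ℕ) (v : ℕ → E) (s : Finset ℕ) (t : Torus) :
    ‖∑ k ∈ s, rieszProduct n k t • v k‖ ≤ ∑ k ∈ s, ‖v k‖ * rieszProduct n k t := by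
  refine (norm_sum_le _ _).trans (Finset.sum_le_sum fun k _ => ?_)
  rw [norm_smul, Real.norm_of_nonneg (rieszProduct_nonneg n k t), mul_comm]

theorem exists_integral_norm_rpow_le {p : ℝ} (hp : 1 ≤ p) :
    ∃ C : ℝ, 0 < C ∧ ∀ᶠ d in atTop, ∀ n, Lacunary n d →
      ∀ (E : Type*) [NormedAddCommGroup E] [NormedSpace ℝ E] (v : ℕ → E) (N : ℕ),
      ∫ t, ‖∑ k ∈ Finset.range N, rieszProduct n k t • v k‖ ^ p ∂torusMeasure
        ≤ C * ∑ k ∈ Finset.range N, ‖v k‖ ^ p * ∫ t, rieszProduct n k t ^ p ∂torusMeasure := by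
  obtain ⟨C, hC, hev⟩ := exists_integral_rpow_sum_le hp
  refine ⟨C, hC, ?_⟩
  filter_upwards [hev] with d hd n hn E _ _ v N
  refine le_trans ?_ (hd n hn (fun k => ‖v k‖) (fun k => norm_nonneg _) N)
  refine integral_torus_mono ?_ ?_ fun t => ?_
  · exact (continuous_sum_rieszProduct_smul n v _).norm.rpow_const fun _ => Or.inr (by linarith)
  · exact (continuous_finsetSum _ fun k _ => (continuous_rieszProduct n k).const_mul _).rpow_const
      fun _ => Or.inr (by linarith)
  · exact Real.rpow_le_rpow (norm_nonneg _) (norm_sum_rieszProduct_smul_le n v _ t) (by linarith)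

theorem exists_le_integral_norm_rpow {p : ℝ} (hp : 1 ≤ p) :
    ∃ C : ℝ, 0 < C ∧ ∀ᶠ d in atTop, ∀ n, Lacunary n d →
      ∀ (E : Type*) [NormedAddCommGroup E] [NormedSpace ℝ E] (v : ℕ → E) (N : ℕ),
      ∑ k ∈ Finset.range (N + 1), ‖v k‖ ^ p * ∫ t, rieszProduct n k t ^ p ∂torusMeasure
        ≤ C * ∫ t, ‖∑ k ∈ Finset.range (N + 1), rieszProduct n k t • v k‖ ^ p ∂torusMeasure := by
  obtain ⟨C₁, hC1, hlow⟩ := exists_sum_succ_le hp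
  obtain ⟨C₂, hC2, hup⟩ := exists_integral_norm_rpow_le hp
  set B : ℝ := 2 ^ p * C₂ + 1 with hB
  have hB0 : 0 < B := by positivity
  refine ⟨2 * (2 ^ p + B * C₁), by positivity, ?_⟩
  filter_upwards [hlow (1 / (2 * B)) (by positivity), hup] with d hd1 hd2 n hn E _ _ v N
  have h1 := hd1 n hn E v N
  set J := ∫ t, ‖∑ k ∈ Finset.range (N + 1), rieszProduct n k t • v k‖ ^ p ∂torusMeasure with hJ
  set W := ∑ k ∈ Finset.range (N + 1), ‖v k‖ ^ p * ∫ t, rieszProduct n k t ^ p ∂torusMeasure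
    with hW
  set W' := ∑ r ∈ Finset.range N, ‖v (r + 1)‖ ^ p *
    ∫ t, rieszProduct n (r + 1) t ^ p ∂torusMeasure with hW'
  have hWW : W = W' + ‖v 0‖ ^ p := by
    rw [hW, Finset.sum_range_succ']
    simp [rieszProduct_zero, hW']
  -- the sum without the term of index `0`
  set v' : ℕ → E := fun k => if k = 0 then 0 else v k with hv'
  have h2 : ∫ t, ‖∑ k ∈ Finset.range (N + 1), rieszProduct n k t • v' k‖ ^ p ∂torusMeasure
      ≤ C₂ * W' := by
    refine (hd2 n hn E v' (N + 1)).trans (le_of_eq ?_)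
    rw [Finset.sum_range_succ']
    simp [hv', Real.zero_rpow (by linarith : p ≠ 0), hW']
  have hc : ∀ u : ℕ → E, Continuous fun t =>
      ‖∑ k ∈ Finset.range (N + 1), rieszProduct n k t • u k‖ ^ p := fun u =>
    (continuous_sum_rieszProduct_smul n u _).norm.rpow_const fun _ => Or.inr (by linarith)
  have h3 : ‖v 0‖ ^ p ≤ 2 ^ p * (J + C₂ * W') := by
    have h4 : ∫ _ : Torus, ‖v 0‖ ^ p ∂torusMeasure ≤
        ∫ t, 2 ^ p * (‖∑ k ∈ Finset.range (N + 1), rieszProduct n k t • v k‖ ^ p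
          + ‖∑ k ∈ Finset.range (N + 1), rieszProduct n k t • v' k‖ ^ p) ∂torusMeasure := by
      refine integral_torus_mono continuous_const
        (((hc v).add (hc v')).const_mul _) fun t => ?_
      have h5 : v 0 = ∑ k ∈ Finset.range (N + 1), rieszProduct n k t • v k
          - ∑ k ∈ Finset.range (N + 1), rieszProduct n k t • v' k := by
        rw [← Finset.sum_sub_distrib, Finset.sum_range_succ']
        simp [hv', rieszProduct_zero]
      set x := ∑ k ∈ Finset.range (N + 1), rieszProduct n k t • v k
      set y := ∑ k ∈ Finset.range (N + 1), rieszProduct n k t • v' k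
      have h6 : ‖v 0‖ ≤ 2 * max ‖x‖ ‖y‖ := by
        rw [h5]
        refine (norm_sub_le x y).trans ?_
        linarith [le_max_left ‖x‖ ‖y‖, le_max_right ‖x‖ ‖y‖]
      have hm0 : 0 ≤ max ‖x‖ ‖y‖ := (norm_nonneg x).trans (le_max_left _ _)
      calc ‖v 0‖ ^ p ≤ (2 * max ‖x‖ ‖y‖) ^ p := by gcongr
        _ = 2 ^ p * max ‖x‖ ‖y‖ ^ p := Real.mul_rpow (by norm_num) hm0
        _ ≤ _ := by
          have e1 : 0 ≤ ‖x‖ ^ p := by positivity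
          have e2 : 0 ≤ ‖y‖ ^ p := by positivity
          gcongr
          rcases max_choice ‖x‖ ‖y‖ with e | e <;> rw [e] <;> linarith
    rw [integral_const, probReal_univ, one_smul, integral_const_mul,
      integral_add (hc v).integrable_torus (hc v').integrable_torus] at h4
    refine h4.trans ?_
    gcongr
  have hbig : W ≤ 2 ^ p * J + B * W' := by
    rw [hWW, hB]; linarith
  have h7 := mul_le_mul_of_nonneg_left h1 hB0.le
  have h8 : B * (C₁ * J + 1 / (2 * B) * W) = B * C₁ * J + W / 2 := by field_simp
  rw [h8] at h7
  linarith

theorem mainTheorem1 (p : ℝ) (hp : 1 ≤ p) :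
    ∃ d c C : ℝ, 0 < d ∧ 0 < c ∧ 0 < C ∧
      ∀ n : ℕ → ℕ, (∀ j, 1 ≤ j → 0 < n j) →
        (∀ j, 1 ≤ j → d ≤ (n (j + 1) : ℝ) / (n j : ℝ)) →
      ∀ (E : Type*) [NormedAddCommGroup E] [NormedSpace ℝ E] (v : ℕ → E) (N : ℕ),
        c * ∑ k ∈ Finset.range (N + 1), ‖v k‖ ^ p * ∫ t, rieszProduct n k t ^ p ∂torusMeasure
            ≤ ∫ t, ‖∑ k ∈ Finset.range (N + 1), rieszProduct n k t • v k‖ ^ p ∂torusMeasure ∧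
        ∫ t, ‖∑ k ∈ Finset.range (N + 1), rieszProduct n k t • v k‖ ^ p ∂torusMeasure
            ≤ C * ∑ k ∈ Finset.range (N + 1),
                ‖v k‖ ^ p * ∫ t, rieszProduct n k t ^ p ∂torusMeasure := by
  obtain ⟨C₁, hC1, hlow⟩ := exists_le_integral_norm_rpow hp
  obtain ⟨C₂, hC2, hup⟩ := exists_integral_norm_rpow_le hp
  obtain ⟨d, ⟨h1, h2⟩, hd⟩ := ((hlow.and hup).and (eventually_gt_atTop 0)).exists
  refine ⟨d, C₁⁻¹, C₂, hd, inv_pos.2 hC1, hC2, fun n hn hnd E _ _ v N => ?_⟩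
  have hlac : Lacunary n d := ⟨hn, fun j hj => by
    have := hnd j hj
    rwa [le_div_iff₀ (by exact_mod_cast hn j hj)] at this⟩
  refine ⟨?_, h2 n hlac E v (N + 1)⟩
  rw [inv_mul_le_iff₀ hC1]
  exact h1 n hlac E v N
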